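/- **Conventions.** An action of a monoidal category $\mathcal{M}$ on a category $\mathcal{D}$ is a monoidal functor from $\mathcal{M}$ to the category of endofunctors of $\mathcal{D}$ (with composition as tensor product). A $\mathbb{Q}$-linear category is an additive category in which $n\cdot\mathrm{id}$ is an isomorphism for every integer $n\neq 0$; it is pseudo-abelian if every idempotent endomorphism has a kernel. **The category $\mathcal{C}$.** Let $\mathcal{C}'$ be the free monoidal category with zero object (zero morphisms being preserved by $\otimes$) generated by an object $F$ and morphisms $\mathbb{1}\to F^2$, $F^2\to\mathbb{1}$, subject to the relations: (i) $\mathbb{1}\to F^2\to\mathbb{1}$ is the identity; (ii) $F\to F^2F=FF^2\to F$ is zero; (iii) $F\to FF^2=F^2F\to F$ is zero. Its $\mathbb{Q}$-linearization is the completion under finite products of the category with the same objects and with $\mathrm{Hom}(X,Y)=\mathbb{Q}\text{-span}(\mathrm{Hom}_{\mathcal{C}'}(X,Y)-\{0\})$, and $\mathcal{C}$ is the Karoubi envelope of this $\mathbb{Q}$-linearization, with the induced monoidal structure. **Crystals.** A (finite, normal, $\mathfrak{sl}_2$-)crystal is a finite set $B$ with maps $\mathrm{wt},\varepsilon,\phi\colon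 B\to\mathbb{Z}$ and $e,f\colon B\to B\sqcup\{0\}$ such that $\phi(b)=\varepsilon(b)+\mathrm{wt}(b)$; if $eb\in B$ then $\mathrm{wt}(eb)=\mathrm{wt}(b)+2$, $\varepsilon(eb)=\varepsilon(b)-1$, $\phi(eb)=\phi(b)+1$; if $fb\in B$ then $\mathrm{wt}(fb)=\mathrm{wt}(b)-2$, $\varepsilon(fb)=\varepsilon(b)+1$, $\phi(fb)=\phi(b)-1$; $b=eb'$ if and only if $fb=b'$; and $\varepsilon(b)=\max\{n\mid e^nb\ne0\}$, $\phi(b)=\max\{n\mid f^nb\neq0\}$. A morphism $A\to B$ is a map $A\to B\sqcup\{0\}$ compatible with $e,f,\varepsilon,\phi,\mathrm{wt}$. Let $\mathbb{B}(n)=\{v_n,v_{n-2},\dots,v_{-n}\}$ with $\mathrm{wt}(v_k)=k$ and $ev_k=v_{k+2}$ for $k\ne n$, $ev_n=0$. The tensor product $A\otimes B$ is the set $A\times B$ with $\mathrm{wt}(a\otimes b)=\mathrm{wt}(a)+\mathrm{wt}(b)$; $e(a\otimes b)=ea\otimes b$ if $\varepsilon(a)>\phi(b)$ and $a\otimes eb$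 otherwise; $f(a\otimes b)=fa\otimes b$ if $\varepsilon(a)\ge\phi(b)$ and $a\otimes fb$ otherwise; $\varepsilon(a\otimes b)=\max\{\varepsilon(b),\varepsilon(a)-\mathrm{wt}(b)\}$; $\phi(a\otimes b)=\max\{\phi(a),\phi(b)+\mathrm{wt}(a)\}$. This makes the category $\mathrm{Crystals}$ monoidal, with unit $\mathbb{B}(0)$. **The category $\mathrm{Crystals}_{\mathbb{Q}}$.** Its objects are formal sums $\bigoplus_{n\ge0}\mathbb{B}(n)\boxtimes V_n$ with $V_n$ finite sets, all but finitely many of them empty; a morphism to $\bigoplus_n\mathbb{B}(n)\boxtimes W_n$ is a family of linear maps $\mathbb{Q}\text{-span}\,V_n\to\mathbb{Q}\text{-span}\,W_n$. Let $V_{ij}^k$ be the set of non-zero morphisms $\mathbb{B}(k)\to\mathbb{B}(i)\otimes\mathbb{B}(j)$. The tensor product of $\bigoplus_i\mathbb{B}(i)\boxtimes X_i$ and $\bigoplus_j\mathbb{B}(j)\boxtimes Y_j$ is $\bigoplus_k\mathbb{B}(k)\boxtimes\bigsqcup_{i,j}X_i\times Y_j\times V_{ij}^k$, and its associativity constraint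 is given by the bijections $\bigsqcup_\alpha V_{ij}^\alpha\times V_{\alpha k}^l\to\bigsqcup_\beta V_{i\beta}^l\times V_{jk}^\beta$ which express the associativity of the tensor product of crystals: both sides are identified, by composition, with the set of non-zero morphisms $\mathbb{B}(l)\to\mathbb{B}(i)\otimes\mathbb{B}(j)\otimes\mathbb{B}(k)$. The functor $\mathrm{Crystals}\to\mathrm{Crystals}_{\mathbb{Q}}$ sends $B$ to $\bigoplus_n\mathbb{B}(n)\boxtimes V_n$ with $V_n$ the set of non-zero morphisms $\mathbb{B}(n)\to B$, and a morphism $\beta$ to the linear maps extending $v\mapsto\beta\circ v$ (read as $0$ if $\beta\circ v=0$). **The category $\mathcal{O}^{\mathbb{Z}}$.** Let $\mathrm{Vect}^{\mathbb{Z}}$ be the category of finite dimensional graded complex vector spaces, with $V\langle n\rangle_i=V_{i-n}$. Let $\mathcal{O}_0^{\mathbb{Z}}$ be the category of tuples $(\Psi,\Phi,\mathrm{var},\mathrm{can})$ with $\Psi,\Phi\in\mathrm{Vect}^{\mathbb{Z}}$, $\mathrm{var}\colon\Phi\to\Psi\langle-1\rangle$, $\mathrm{can}\colon\Psi\to\Phi\langle-1\rangle$,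 $\mathrm{var}\circ\mathrm{can}=0$. Put $\mathcal{O}^{\mathbb{Z}}=\mathrm{Vect}^{\mathbb{Z}}\oplus\bigoplus_{k\ge0}\mathcal{O}_0^{\mathbb{Z}}$ (only finitely many non-zero components), with projections $\mathrm{pr}_{-1},\mathrm{pr}_k$ and inclusions $i_{-1},i_k$ ($k\geq 0$). Let $\pi^*V=(V\langle1\rangle,V\langle2\rangle\oplus V,(0\ \mathrm{id}),\binom{\mathrm{id}}{0})$, $\pi_*(\Psi,\Phi,\mathrm{var},\mathrm{can})=\Phi$, and $$F_{\mathcal{O}}(V)=i_0\pi^*\mathrm{pr}_{-1}V\oplus i_{-1}\pi_*\mathrm{pr}_0V\oplus i_1\mathrm{pr}_0V\oplus\bigoplus_{k\ge1}\bigl(i_{k-1}\mathrm{pr}_kV\oplus i_{k+1}\mathrm{pr}_kV\bigr).$$ **Proposition.** The category $\mathrm{Crystals}_{\mathbb{Q}}$ is $\mathbb{Q}$-linear and pseudo-abelian, and there is a $\mathbb{Q}$-linear monoidal equivalence $\mathcal{C}\simeq\mathrm{Crystals}_{\mathbb{Q}}$ sending $F$ to (an object isomorphic to) $\mathbb{B}(1)$.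 Moreover there is a $\mathbb{Q}$-linear action of $\mathcal{C}$ on $\mathcal{O}^{\mathbb{Z}}$ in which $F$ acts by a functor isomorphic to $F_{\mathcal{O}}$. Through the equivalence it corresponds, up to monoidal isomorphism, to a $\mathbb{Q}$-linear action of $\mathrm{Crystals}_{\mathbb{Q}}$ on $\mathcal{O}^{\mathbb{Z}}$ in which $\mathbb{B}(1)$ acts by $F_{\mathcal{O}}$. The functor $\mathrm{Crystals}\to\mathrm{Crystals}_{\mathbb{Q}}$ carries a monoidal structure, and by composition one obtains an action of $\mathrm{Crystals}$ on $\mathcal{O}^{\mathbb{Z}}$ in which $\mathbb{B}(1)$ acts by $F_{\mathcal{O}}$. -/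

import Mathlib

open CategoryTheory CategoryTheory.Limits CategoryTheory.MonoidalCategory

attribute [local instance] CategoryTheory.CategoryStruct.toQuiver

attribute [local instance] CategoryTheory.endofunctorMonoidalCategory

noncomputable section

/-! ### The free monoidal category on a self-dual object -/

/-- Objects of the free monoidal category with zero object on one generator `F`. -/
inductive CPrime : Type
  | F : CPrime
  | zero : CPrime
  | unit : CPrime
  | tensor : CPrime → CPrime → CPrime

namespace CPrime

/-- Formal morphisms: besides the structural morphisms of a monoidal category there are the zero
morphisms and the two generators `cup : 𝟙 ⟶ F ⊗ F` and `cap : F ⊗ F ⟶ 𝟙`. -/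
inductive Pre : CPrime → CPrime → Type
  | cup : Pre unit (tensor F F)
  | cap : Pre (tensor F F) unit
  | zeroHom (X Y : CPrime) : Pre X Y
  | id (X : CPrime) : Pre X X
  | comp {X Y Z : CPrime} (f : Pre X Y) (g : Pre Y Z) : Pre X Z
  | tensorHom {W X Y Z : CPrime} (f : Pre W Y) (g : Pre X Z) : Pre (tensor W X) (tensor Y Z)
  | assocHom (X Y Z : CPrime) : Pre (tensor (tensor X Y) Z) (tensor X (tensor Y Z))
  | assocInv (X Y Z : CPrime) : Pre (tensor X (tensor Y Z)) (tensor (tensor X Y) Z)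
  | leftHom (X : CPrime) : Pre (tensor unit X) X
  | leftInv (X : CPrime) : Pre X (tensor unit X)
  | rightHom (X : CPrime) : Pre (tensor X unit) X
  | rightInv (X : CPrime) : Pre X (tensor X unit)

open Pre

/-- The congruence generated by the axioms of a monoidal category, the axioms for zero morphisms
(preserved by the tensor product), the fact that `zero` is a zero object, and the three relations
`cup ≫ cap = 𝟙`, `(F ◁ cup) ≫ (cap ▷ F) = 0`, `(cup ▷ F) ≫ (F ◁ cap) = 0` (up to structural
isomorphisms). -/
inductive Rel : ∀ {X Y : CPrime}, Pre X Y → Pre X Y → Prop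
  | refl {X Y : CPrime} (f : Pre X Y) : Rel f f
  | symm {X Y : CPrime} {f g : Pre X Y} : Rel f g → Rel g f
  | trans {X Y : CPrime} {f g h : Pre X Y} : Rel f g → Rel g h → Rel f h
  | comp {X Y Z : CPrime} {f f' : Pre X Y} {g g' : Pre Y Z} :
      Rel f f' → Rel g g' → Rel (f.comp g) (f'.comp g')
  | tensorHom {W X Y Z : CPrime} {f f' : Pre W Y} {g g' : Pre X Z} :
      Rel f f' → Rel g g' → Rel (f.tensorHom g) (f'.tensorHom g')
  -- category axioms
  | id_comp {X Y : CPrime} (f : Pre X Y) : Rel ((Pre.id X).comp f) f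
  | comp_id {X Y : CPrime} (f : Pre X Y) : Rel (f.comp (Pre.id Y)) f
  | assoc {W X Y Z : CPrime} (f : Pre W X) (g : Pre X Y) (h : Pre Y Z) :
      Rel ((f.comp g).comp h) (f.comp (g.comp h))
  -- the tensor product is a bifunctor
  | tensor_id (X Y : CPrime) : Rel ((Pre.id X).tensorHom (Pre.id Y)) (Pre.id (tensor X Y))
  | tensor_comp {X₁ Y₁ Z₁ X₂ Y₂ Z₂ : CPrime} (f₁ : Pre X₁ Y₁) (f₂ : Pre X₂ Y₂)
      (g₁ : Pre Y₁ Z₁) (g₂ : Pre Y₂ Z₂) :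
      Rel ((f₁.tensorHom f₂).comp (g₁.tensorHom g₂)) ((f₁.comp g₁).tensorHom (f₂.comp g₂))
  -- associator and unitors
  | assoc_hom_inv (X Y Z : CPrime) : Rel ((assocHom X Y Z).comp (assocInv X Y Z)) (Pre.id _)
  | assoc_inv_hom (X Y Z : CPrime) : Rel ((assocInv X Y Z).comp (assocHom X Y Z)) (Pre.id _)
  | assoc_nat {X₁ X₂ X₃ Y₁ Y₂ Y₃ : CPrime} (f₁ : Pre X₁ Y₁) (f₂ : Pre X₂ Y₂) (f₃ : Pre X₃ Y₃) :
      Rel (((f₁.tensorHom f₂).tensorHom f₃).comp (assocHom Y₁ Y₂ Y₃))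
        ((assocHom X₁ X₂ X₃).comp (f₁.tensorHom (f₂.tensorHom f₃)))
  | left_hom_inv (X : CPrime) : Rel ((leftHom X).comp (leftInv X)) (Pre.id _)
  | left_inv_hom (X : CPrime) : Rel ((leftInv X).comp (leftHom X)) (Pre.id _)
  | left_nat {X Y : CPrime} (f : Pre X Y) :
      Rel (((Pre.id unit).tensorHom f).comp (leftHom Y)) ((leftHom X).comp f)
  | right_hom_inv (X : CPrime) : Rel ((rightHom X).comp (rightInv X)) (Pre.id _)
  | right_inv_hom (X : CPrime) : Rel ((rightInv X).comp (rightHom X)) (Pre.id _)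
  | right_nat {X Y : CPrime} (f : Pre X Y) :
      Rel ((f.tensorHom (Pre.id unit)).comp (rightHom Y)) ((rightHom X).comp f)
  | pentagon (W X Y Z : CPrime) :
      Rel (((assocHom W X Y).tensorHom (Pre.id Z)).comp
          ((assocHom W (tensor X Y) Z).comp ((Pre.id W).tensorHom (assocHom X Y Z))))
        ((assocHom (tensor W X) Y Z).comp (assocHom W X (tensor Y Z)))
  | triangle (X Y : CPrime) :
      Rel ((assocHom X unit Y).comp ((Pre.id X).tensorHom (leftHom Y)))
        ((rightHom X).tensorHom (Pre.id Y))
  -- zero morphisms and the zero object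
  | zero_comp {X Y Z : CPrime} (f : Pre Y Z) : Rel ((zeroHom X Y).comp f) (zeroHom X Z)
  | comp_zero {X Y Z : CPrime} (f : Pre X Y) : Rel (f.comp (zeroHom Y Z)) (zeroHom X Z)
  | zero_tensor {W X Y Z : CPrime} (f : Pre X Z) :
      Rel ((zeroHom W Y).tensorHom f) (zeroHom (tensor W X) (tensor Y Z))
  | tensor_zero {W X Y Z : CPrime} (f : Pre W Y) :
      Rel (f.tensorHom (zeroHom X Z)) (zeroHom (tensor W X) (tensor Y Z))
  | id_zero : Rel (Pre.id zero) (zeroHom zero zero)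
  -- (i): the composition `𝟙 ⟶ F² ⟶ 𝟙` is the identity
  | cup_cap : Rel (cup.comp cap) (Pre.id unit)
  -- (ii): the composition `F ⟶ F²F = FF² ⟶ F` is zero
  | zigzag_left :
      Rel ((leftInv F).comp ((cup.tensorHom (Pre.id F)).comp ((assocHom F F F).comp
        (((Pre.id F).tensorHom cap).comp (rightHom F))))) (zeroHom F F)
  -- (iii): the composition `F ⟶ FF² = F²F ⟶ F` is zero
  | zigzag_right :
      Rel ((rightInv F).comp (((Pre.id F).tensorHom cup).comp ((assocInv F F F).comp
        ((cap.tensorHom (Pre.id F)).comp (leftHom F))))) (zeroHom F F)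

instance preSetoid (X Y : CPrime) : Setoid (Pre X Y) :=
  ⟨Rel, ⟨Rel.refl, Rel.symm, Rel.trans⟩⟩

instance instCat : Category CPrime where
  Hom X Y := Quotient (preSetoid X Y)
  id X := ⟦Pre.id X⟧
  comp := Quotient.map₂ Pre.comp (fun _ _ hf _ _ hg => Rel.comp hf hg)
  id_comp := by rintro X Y ⟨f⟩; exact Quotient.sound (Rel.id_comp f)
  comp_id := by rintro X Y ⟨f⟩; exact Quotient.sound (Rel.comp_id f)
  assoc := by rintro W X Y Z ⟨f⟩ ⟨g⟩ ⟨h⟩; exact Quotient.sound (Rel.assoc f g h)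

/-- The tensor product of morphisms. -/
def tmap {W X Y Z : CPrime} : (W ⟶ Y) → (X ⟶ Z) → (tensor W X ⟶ tensor Y Z) :=
  Quotient.map₂ Pre.tensorHom (fun _ _ hf _ _ hg => Rel.tensorHom hf hg)

instance instMonoidalStruct : MonoidalCategoryStruct CPrime where
  tensorObj X Y := tensor X Y
  tensorHom f g := tmap f g
  whiskerLeft X _ _ f := tmap (𝟙 X) f
  whiskerRight f Y := tmap f (𝟙 Y)
  tensorUnit := unit
  associator X Y Z := ⟨⟦assocHom X Y Z⟧, ⟦assocInv X Y Z⟧,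
    Quotient.sound (Rel.assoc_hom_inv X Y Z), Quotient.sound (Rel.assoc_inv_hom X Y Z)⟩
  leftUnitor X := ⟨⟦leftHom X⟧, ⟦leftInv X⟧,
    Quotient.sound (Rel.left_hom_inv X), Quotient.sound (Rel.left_inv_hom X)⟩
  rightUnitor X := ⟨⟦rightHom X⟧, ⟦rightInv X⟧,
    Quotient.sound (Rel.right_hom_inv X), Quotient.sound (Rel.right_inv_hom X)⟩

instance instMonoidal : MonoidalCategory CPrime := MonoidalCategory.ofTensorHom
  (id_tensorHom_id := fun X Y => Quotient.sound (Rel.tensor_id X Y))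
  (id_tensorHom := fun _ _ _ _ => rfl)
  (tensorHom_id := fun _ _ => rfl)
  (tensorHom_comp_tensorHom := by
    rintro _ _ _ _ _ _ ⟨f₁⟩ ⟨f₂⟩ ⟨g₁⟩ ⟨g₂⟩; exact Quotient.sound (Rel.tensor_comp f₁ f₂ g₁ g₂))
  (associator_naturality := by
    rintro _ _ _ _ _ _ ⟨f₁⟩ ⟨f₂⟩ ⟨f₃⟩; exact Quotient.sound (Rel.assoc_nat f₁ f₂ f₃))
  (leftUnitor_naturality := by rintro _ _ ⟨f⟩; exact Quotient.sound (Rel.left_nat f))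
  (rightUnitor_naturality := by rintro _ _ ⟨f⟩; exact Quotient.sound (Rel.right_nat f))
  (pentagon := fun W X Y Z => Quotient.sound (Rel.pentagon W X Y Z))
  (triangle := fun X Y => Quotient.sound (Rel.triangle X Y))

instance instZeroMorphisms : HasZeroMorphisms CPrime where
  zero X Y := ⟨⟦zeroHom X Y⟧⟩
  comp_zero := by rintro X Y ⟨f⟩ Z; exact Quotient.sound (Rel.comp_zero f)
  zero_comp := by rintro X Y Z ⟨f⟩; exact Quotient.sound (Rel.zero_comp f)

end CPrime

/-- A monoidal category with zero morphisms whose tensor product preserves zero morphisms. -/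
class ZeroTensor (C : Type*) [Category C] [HasZeroMorphisms C] [MonoidalCategory C] : Prop where
  zero_tensor : ∀ {W X Y Z : C} (f : X ⟶ Z), (0 : W ⟶ Y) ⊗ₘ f = 0
  tensor_zero : ∀ {W X Y Z : C} (f : W ⟶ Y), f ⊗ₘ (0 : X ⟶ Z) = 0

instance CPrime.instZeroTensor : ZeroTensor CPrime where
  zero_tensor := by rintro _ _ _ _ ⟨f⟩; exact Quotient.sound (CPrime.Rel.zero_tensor f)
  tensor_zero := by rintro _ _ _ _ ⟨f⟩; exact Quotient.sound (CPrime.Rel.tensor_zero f)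

/-! ### Reduced `ℚ`-spans and the `ℚ`-linearization -/

/-- The `ℚ`-span of the non-zero elements of a pointed set. -/
abbrev RedSpan (A : Type*) [Zero A] := {a : A // a ≠ 0} →₀ ℚ

namespace RedSpan

variable {A B D : Type*} [Zero A] [Zero B] [Zero D]

open scoped Classical in
/-- The basis vector of `a`, understood to be zero for `a = 0`. -/
def δ (a : A) : RedSpan A := if h : a = 0 then 0 else Finsupp.single ⟨a, h⟩ 1

theorem δ_zero : δ (0 : A) = 0 := by simp [δ]

theorem δ_ne (a : {a : A // a ≠ 0}) : δ a.1 = Finsupp.single a 1 := by simp [δ, a.2]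

/-- The bilinear extension of a map in two variables. -/
def bilift (m : A → B → D) : RedSpan A →ₗ[ℚ] RedSpan B →ₗ[ℚ] RedSpan D :=
  Finsupp.linearCombination ℚ fun a => Finsupp.linearCombination ℚ fun b => δ (m a.1 b.1)

theorem bilift_δ (m : A → B → D) (hl : ∀ b, m 0 b = 0) (hr : ∀ a, m a 0 = 0) (a : A) (b : B) :
    bilift m (δ a) (δ b) = δ (m a b) := by
  by_cases ha : a = 0
  · subst ha; simp [δ_zero, hl]
  by_cases hb : b = 0
  · subst hb; simp [δ_zero, hr]
  rw [δ_ne ⟨a, ha⟩, δ_ne ⟨b, hb⟩]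
  simp [bilift]

theorem bilift_add_right (m : A → B → D) (a : RedSpan A) (b b' : RedSpan B) :
    bilift m a (b + b') = bilift m a b + bilift m a b' := map_add _ _ _

theorem bilift_smul_right (m : A → B → D) (a : RedSpan A) (c : ℚ) (b : RedSpan B) :
    bilift m a (c • b) = c • bilift m a b := map_smul _ _ _

theorem bilift_add_left (m : A → B → D) (a a' : RedSpan A) (b : RedSpan B) :
    bilift m (a + a') b = bilift m a b + bilift m a' b := LinearMap.map_add₂ _ _ _ _

theorem bilift_smul_left (m : A → B → D) (c : ℚ) (a : RedSpan A) (b : RedSpan B) :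
    bilift m (c • a) b = c • bilift m a b := LinearMap.map_smul₂ _ _ _ _

theorem lhom_ext {M : Type*} [AddCommGroup M] [Module ℚ M] {f g : RedSpan A →ₗ[ℚ] M}
    (h : ∀ a, f (δ a) = g (δ a)) : f = g := by
  ext a
  simpa [δ_ne] using h a.1

theorem induction {p : RedSpan A → Prop} (x : RedSpan A) (h0 : ∀ a, p (δ a))
    (hadd : ∀ x y, p x → p y → p (x + y)) (hs : ∀ (c : ℚ) x, p x → p (c • x)) : p x := by
  induction x using Finsupp.induction_linear with
  | zero => simpa [δ_zero] using h0 0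
  | add x y hx hy => exact hadd x y hx hy
  | single a c =>
    have := hs c _ (h0 a.1)
    simpa [δ_ne] using this

end RedSpan

/-- The category with the objects of `C` and with
`Hom(X, Y) = ℚ-span (Hom_C(X, Y) - {0})`. -/
structure QLin (C : Type*) where
  as : C

namespace QLin

open RedSpan

variable {C : Type*} [Category C] [HasZeroMorphisms C]

instance instCat : Category (QLin C) where
  Hom X Y := RedSpan (X.as ⟶ Y.as)
  id X := δ (𝟙 X.as)
  comp f g := bilift (fun f g => f ≫ g) f g
  id_comp {X Y} f := by
    induction f using RedSpan.induction with
    | h0 a => rw [bilift_δ] <;> simp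
    | hadd x y hx hy => rw [map_add, hx, hy]
    | hs c x hx => rw [map_smul, hx]
  comp_id {X Y} f := by
    induction f using RedSpan.induction with
    | h0 a => rw [bilift_δ] <;> simp
    | hadd x y hx hy => rw [map_add, LinearMap.add_apply, hx, hy]
    | hs c x hx => rw [map_smul, LinearMap.smul_apply, hx]
  assoc {W X Y Z} f g h := by
    induction f using RedSpan.induction with
    | hadd x y hx hy => simp only [map_add, LinearMap.add_apply, hx, hy]
    | hs c x hx => simp only [map_smul, LinearMap.smul_apply, hx]
    | h0 f =>
    induction g using RedSpan.induction with
    | hadd x y hx hy => simp only [map_add, LinearMap.add_apply, hx, hy]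
    | hs c x hx => simp only [map_smul, LinearMap.smul_apply, hx]
    | h0 g =>
    induction h using RedSpan.induction with
    | hadd x y hx hy => simp only [map_add, hx, hy]
    | hs c x hx => simp only [map_smul, hx]
    | h0 h =>
    rw [bilift_δ, bilift_δ, bilift_δ, bilift_δ] <;> simp

instance instHomGroup (X Y : QLin C) : AddCommGroup (X ⟶ Y) :=
  inferInstanceAs (AddCommGroup (RedSpan (X.as ⟶ Y.as)))

instance instHomModule (X Y : QLin C) : Module ℚ (X ⟶ Y) :=
  inferInstanceAs (Module ℚ (RedSpan (X.as ⟶ Y.as)))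

theorem add_comp' {X Y Z : QLin C} (f f' : X ⟶ Y) (g : Y ⟶ Z) :
    (f + f') ≫ g = f ≫ g + f' ≫ g := bilift_add_left _ f f' g

theorem comp_add' {X Y Z : QLin C} (f : X ⟶ Y) (g g' : Y ⟶ Z) :
    f ≫ (g + g') = f ≫ g + f ≫ g' := bilift_add_right _ f g g'

theorem smul_comp' {X Y Z : QLin C} (c : ℚ) (f : X ⟶ Y) (g : Y ⟶ Z) :
    (c • f) ≫ g = c • (f ≫ g) := bilift_smul_left _ c f g

theorem comp_smul' {X Y Z : QLin C} (f : X ⟶ Y) (c : ℚ) (g : Y ⟶ Z) :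
    f ≫ (c • g) = c • (f ≫ g) := bilift_smul_right _ f c g

instance instPreadditive : Preadditive (QLin C) where
  add_comp _ _ _ f f' g := by
    have h := add_comp' f f' g
    exact h
  comp_add _ _ _ f g g' := by
    have h := comp_add' f g g'
    exact h

instance instLinear : Linear ℚ (QLin C) where
  smul_comp _ _ _ c f g := by
    have h := smul_comp' c f g
    exact h
  comp_smul _ _ _ f c g := by
    have h := comp_smul' f c g
    exact h

/-- The morphism of the linearization given by a morphism of `C`. -/
def hom {X Y : C} (f : X ⟶ Y) : (⟨X⟩ : QLin C) ⟶ ⟨Y⟩ := δ f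

theorem hom_comp {X Y Z : C} (f : X ⟶ Y) (g : Y ⟶ Z) : hom f ≫ hom g = hom (f ≫ g) :=
  bilift_δ _ (by simp) (by simp) f g

theorem hom_id (X : C) : hom (𝟙 X) = 𝟙 (⟨X⟩ : QLin C) := rfl

theorem ind {X Y : QLin C} {p : (X ⟶ Y) → Prop} (x : X ⟶ Y) (h0 : ∀ a : X.as ⟶ Y.as, p (hom a))
    (hadd : ∀ x y, p x → p y → p (x + y)) (hs : ∀ (c : ℚ) x, p x → p (c • x)) : p x :=
  RedSpan.induction x h0 hadd hs

variable [MonoidalCategory C] [ZeroTensor C]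

/-- The tensor product of morphisms, extended bilinearly. -/
def tens {W X Y Z : QLin C} :
    (W ⟶ Y) →ₗ[ℚ] (X ⟶ Z) →ₗ[ℚ] ((⟨W.as ⊗ X.as⟩ : QLin C) ⟶ ⟨Y.as ⊗ Z.as⟩) :=
  bilift (A := W.as ⟶ Y.as) (B := X.as ⟶ Z.as) (D := W.as ⊗ X.as ⟶ Y.as ⊗ Z.as)
    fun f g => f ⊗ₘ g

theorem tens_hom {W X Y Z : C} (f : W ⟶ Y) (g : X ⟶ Z) :
    tens (hom f) (hom g) = hom (f ⊗ₘ g) :=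
  bilift_δ _ ZeroTensor.zero_tensor ZeroTensor.tensor_zero f g

/-- The isomorphism of the linearization given by an isomorphism of `C`. -/
def iso {X Y : C} (e : X ≅ Y) : (⟨X⟩ : QLin C) ≅ ⟨Y⟩ :=
  ⟨hom e.hom, hom e.inv, by rw [hom_comp, e.hom_inv_id, hom_id],
    by rw [hom_comp, e.inv_hom_id, hom_id]⟩

instance instMonoidalStruct : MonoidalCategoryStruct (QLin C) where
  tensorObj X Y := ⟨X.as ⊗ Y.as⟩
  tensorHom f g := tens f g
  whiskerLeft X _ _ f := tens (𝟙 X) f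
  whiskerRight f Y := tens f (𝟙 Y)
  tensorUnit := ⟨𝟙_ C⟩
  associator X Y Z := iso (α_ X.as Y.as Z.as)
  leftUnitor X := iso (λ_ X.as)
  rightUnitor X := iso (ρ_ X.as)

instance instMonoidal : MonoidalCategory (QLin C) := MonoidalCategory.ofTensorHom
  (id_tensorHom_id := fun X Y => by
    change tens (hom (𝟙 X.as)) (hom (𝟙 Y.as)) = hom (𝟙 (X.as ⊗ Y.as))
    rw [tens_hom, MonoidalCategory.id_tensorHom_id])
  (id_tensorHom := fun _ _ _ _ => rfl)
  (tensorHom_id := fun _ _ => rfl)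
  (tensorHom_comp_tensorHom := by
    intro X₁ Y₁ Z₁ X₂ Y₂ Z₂ f₁ f₂ g₁ g₂
    change tens f₁ f₂ ≫ tens g₁ g₂ = tens (f₁ ≫ g₁) (f₂ ≫ g₂)
    induction f₁ using ind with
    | hadd x y hx hy => simp only [map_add, LinearMap.add_apply, Preadditive.add_comp, hx, hy]
    | hs c x hx => simp only [map_smul, LinearMap.smul_apply, Linear.smul_comp, hx]
    | h0 f₁ =>
    induction f₂ using ind with
    | hadd x y hx hy => simp only [map_add, Preadditive.add_comp, hx, hy]
    | hs c x hx => simp only [map_smul, Linear.smul_comp, hx]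
    | h0 f₂ =>
    induction g₁ using ind with
    | hadd x y hx hy => simp only [map_add, LinearMap.add_apply, Preadditive.comp_add, hx, hy]
    | hs c x hx => simp only [map_smul, LinearMap.smul_apply, Linear.comp_smul, hx]
    | h0 g₁ =>
    induction g₂ using ind with
    | hadd x y hx hy => simp only [map_add, Preadditive.comp_add, hx, hy]
    | hs c x hx => simp only [map_smul, Linear.comp_smul, hx]
    | h0 g₂ =>
    rw [hom_comp, hom_comp, tens_hom, tens_hom, tens_hom, hom_comp,
      MonoidalCategory.tensorHom_comp_tensorHom])
  (associator_naturality := by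
    intro X₁ X₂ X₃ Y₁ Y₂ Y₃ f₁ f₂ f₃
    change tens (tens f₁ f₂) f₃ ≫ hom (α_ Y₁.as Y₂.as Y₃.as).hom =
      hom (α_ X₁.as X₂.as X₃.as).hom ≫ tens f₁ (tens f₂ f₃)
    induction f₁ using ind with
    | hadd x y hx hy =>
      simp only [map_add, LinearMap.add_apply, Preadditive.add_comp, Preadditive.comp_add, hx, hy]
    | hs c x hx =>
      simp only [map_smul, LinearMap.smul_apply, Linear.smul_comp, Linear.comp_smul, hx]
    | h0 f₁ =>
    induction f₂ using ind with
    | hadd x y hx hy =>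
      simp only [map_add, LinearMap.add_apply, Preadditive.add_comp, Preadditive.comp_add, hx, hy]
    | hs c x hx =>
      simp only [map_smul, LinearMap.smul_apply, Linear.smul_comp, Linear.comp_smul, hx]
    | h0 f₂ =>
    induction f₃ using ind with
    | hadd x y hx hy => simp only [map_add, Preadditive.add_comp, Preadditive.comp_add, hx, hy]
    | hs c x hx => simp only [map_smul, Linear.smul_comp, Linear.comp_smul, hx]
    | h0 f₃ =>
    rw [tens_hom, tens_hom, tens_hom, tens_hom, hom_comp, hom_comp,
      MonoidalCategory.associator_naturality])
  (leftUnitor_naturality := by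
    intro X Y f
    change tens (hom (𝟙 (𝟙_ C))) f ≫ hom (λ_ Y.as).hom = hom (λ_ X.as).hom ≫ f
    induction f using ind with
    | hadd x y hx hy => simp only [map_add, Preadditive.add_comp, Preadditive.comp_add, hx, hy]
    | hs c x hx => simp only [map_smul, Linear.smul_comp, Linear.comp_smul, hx]
    | h0 f => rw [tens_hom, hom_comp, hom_comp, MonoidalCategory.id_tensorHom,
        MonoidalCategory.leftUnitor_naturality])
  (rightUnitor_naturality := by
    intro X Y f
    change tens f (hom (𝟙 (𝟙_ C))) ≫ hom (ρ_ Y.as).hom = hom (ρ_ X.as).hom ≫ f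
    induction f using ind with
    | hadd x y hx hy =>
      simp only [map_add, LinearMap.add_apply, Preadditive.add_comp, Preadditive.comp_add, hx, hy]
    | hs c x hx =>
      simp only [map_smul, LinearMap.smul_apply, Linear.smul_comp, Linear.comp_smul, hx]
    | h0 f => rw [tens_hom, hom_comp, hom_comp, MonoidalCategory.tensorHom_id,
        MonoidalCategory.rightUnitor_naturality])
  (pentagon := by
    intro W X Y Z
    change tens (hom _) (hom (𝟙 Z.as)) ≫ hom _ ≫ tens (hom (𝟙 W.as)) (hom _) = hom _ ≫ hom _
    rw [tens_hom, tens_hom, hom_comp, hom_comp, hom_comp, MonoidalCategory.id_tensorHom,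
      MonoidalCategory.tensorHom_id]
    exact congrArg hom (MonoidalCategory.pentagon W.as X.as Y.as Z.as))
  (triangle := by
    intro X Y
    change hom _ ≫ tens (hom (𝟙 X.as)) (hom _) = tens (hom _) (hom (𝟙 Y.as))
    rw [tens_hom, tens_hom, hom_comp, MonoidalCategory.id_tensorHom,
      MonoidalCategory.tensorHom_id]
    exact congrArg hom (MonoidalCategory.triangle X.as Y.as))

instance instMonoidalPreadditive : MonoidalPreadditive (QLin C) where
  whiskerLeft_zero {X Y Z} := map_zero (tens (𝟙 X))
  zero_whiskerRight {X Y Z} := by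
    change tens 0 (𝟙 X) = 0
    rw [map_zero, LinearMap.zero_apply]
  whiskerLeft_add {X Y Z} f g := map_add (tens (𝟙 X)) f g
  add_whiskerRight {X Y Z} f g := by
    change tens (f + g) (𝟙 X) = tens f (𝟙 X) + tens g (𝟙 X)
    rw [map_add, LinearMap.add_apply]

end QLin

/-! ### Monoidal structures on the additive completion and on the Karoubi envelope -/

section Mat

variable {C : Type*} [Category C] [Preadditive C]

open scoped Classical in
/-- The matrix with exactly one, prescribed, non-zero entry in each row. -/
def Mat_.mono {M N : Mat_ C} (e : M.ι → N.ι) (t : ∀ i, M.X i ⟶ N.X (e i)) : M ⟶ N :=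
  fun i j => if h : e i = j then t i ≫ eqToHom (congrArg N.X h) else 0

theorem Mat_.mono_apply_self {M N : Mat_ C} (e : M.ι → N.ι) (t : ∀ i, M.X i ⟶ N.X (e i))
    (i : M.ι) : Mat_.mono e t i (e i) = t i := by simp [Mat_.mono]

theorem Mat_.mono_apply_ne {M N : Mat_ C} (e : M.ι → N.ι) (t : ∀ i, M.X i ⟶ N.X (e i))
    (i : M.ι) (j : N.ι) (h : e i ≠ j) : Mat_.mono e t i j = 0 := by simp [Mat_.mono, h]

theorem Mat_.mono_comp_apply {M N K : Mat_ C} (e : M.ι → N.ι) (t : ∀ i, M.X i ⟶ N.X (e i))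
    (f : N ⟶ K) (i : M.ι) (k : K.ι) : (Mat_.mono e t ≫ f) i k = t i ≫ f (e i) k := by
  classical
  rw [Mat_.comp_apply, Finset.sum_eq_single (e i), Mat_.mono_apply_self]
  · intro j _ hj
    rw [Mat_.mono_apply_ne _ _ _ _ (Ne.symm hj), zero_comp]
  · simp

theorem Mat_.comp_mono_apply {M N K : Mat_ C} (e : N.ι → K.ι) (he : Function.Injective e)
    (t : ∀ i, N.X i ⟶ K.X (e i)) (f : M ⟶ N) (i : M.ι) (k : N.ι) :
    (f ≫ Mat_.mono e t) i (e k) = f i k ≫ t k := by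
  classical
  rw [Mat_.comp_apply, Finset.sum_eq_single k, Mat_.mono_apply_self]
  · intro j _ hj
    rw [Mat_.mono_apply_ne _ _ _ _ (fun h => hj (he h)), comp_zero]
  · simp

theorem Mat_.mono_comp_mono {M N K : Mat_ C} (e : M.ι → N.ι) (t : ∀ i, M.X i ⟶ N.X (e i))
    (e' : N.ι → K.ι) (t' : ∀ i, N.X i ⟶ K.X (e' i)) :
    Mat_.mono e t ≫ Mat_.mono e' t' = Mat_.mono (e' ∘ e) (fun i => t i ≫ t' (e i)) := by
  ext i k
  rw [Mat_.mono_comp_apply]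
  by_cases h : e' (e i) = k
  · subst h
    rw [Mat_.mono_apply_self]
    exact (Mat_.mono_apply_self (M := M) (N := K) (e' ∘ e) (fun i => t i ≫ t' (e i)) i).symm
  · rw [Mat_.mono_apply_ne _ _ _ _ h]
    exact comp_zero.trans (Mat_.mono_apply_ne (M := M) (N := K) _ _ _ _ h).symm

theorem Mat_.id_eq_mono (M : Mat_ C) : 𝟙 M = Mat_.mono (fun i => i) (fun i => 𝟙 (M.X i)) := by
  ext i k
  by_cases h : i = k
  · subst h
    rw [Mat_.id_apply_self]
    exact (Mat_.mono_apply_self (M := M) (N := M) (fun i => i) (fun i => 𝟙 (M.X i)) i).symm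
  · rw [Mat_.mono_apply_ne _ _ _ _ h, Mat_.id_apply_of_ne _ _ _ h]

open scoped Classical in
/-- The isomorphism given by a reindexing and isomorphisms of the entries. -/
def Mat_.monoIso {M N : Mat_ C} (e : M.ι ≃ N.ι) (t : ∀ i, M.X i ≅ N.X (e i)) : M ≅ N where
  hom := Mat_.mono e fun i => (t i).hom
  inv := fun j i => if h : e i = j then eqToHom (congrArg N.X h.symm) ≫ (t i).inv else 0
  hom_inv_id := by
    ext i k
    refine (Mat_.mono_comp_apply _ _ _ _ _).trans ?_
    by_cases h : i = k
    · subst h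
      rw [Mat_.id_apply_self]
      simp
    · have h' : e k ≠ e i := fun h'' => h (e.injective h'').symm
      rw [Mat_.id_apply_of_ne _ _ _ h, dif_neg h', comp_zero]
  inv_hom_id := by
    ext i k
    obtain ⟨i, rfl⟩ := e.surjective i
    obtain ⟨k, rfl⟩ := e.surjective k
    refine (Mat_.comp_mono_apply _ e.injective _ _ _ _).trans ?_
    by_cases h : i = k
    · subst h
      rw [Mat_.id_apply_self]
      simp
    · have h' : e k ≠ e i := fun h'' => h (e.injective h'').symm
      have h'' : e i ≠ e k := Ne.symm h'
      rw [Mat_.id_apply_of_ne _ _ _ h'', dif_neg h', zero_comp]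

variable [MonoidalCategory C] [MonoidalPreadditive C]

/-- The tensor product of families of objects. -/
def Mat_.tensObj (M N : Mat_ C) : Mat_ C := ⟨M.ι × N.ι, fun p => M.X p.1 ⊗ N.X p.2⟩

/-- The tensor product of matrices. -/
def Mat_.tens {M N P Q : Mat_ C} (f : M ⟶ P) (g : N ⟶ Q) : Mat_.tensObj M N ⟶ Mat_.tensObj P Q :=
  fun p q => f p.1 q.1 ⊗ₘ g p.2 q.2

theorem Mat_.tens_mono {M N P Q : Mat_ C} (e : M.ι → P.ι) (t : ∀ i, M.X i ⟶ P.X (e i))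
    (e' : N.ι → Q.ι) (t' : ∀ i, N.X i ⟶ Q.X (e' i)) :
    Mat_.tens (Mat_.mono e t) (Mat_.mono e' t') =
      Mat_.mono (Prod.map e e') (fun p : M.ι × N.ι => t p.1 ⊗ₘ t' p.2) := by
  ext ⟨i, j⟩ ⟨k, l⟩
  change Mat_.mono e t i k ⊗ₘ Mat_.mono e' t' j l = _
  by_cases h : e i = k
  · by_cases h' : e' j = l
    · subst h h'
      rw [Mat_.mono_apply_self, Mat_.mono_apply_self]
      exact (Mat_.mono_apply_self (M := Mat_.tensObj M N) (N := Mat_.tensObj P Q)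
        (Prod.map e e') (fun p : M.ι × N.ι => t p.1 ⊗ₘ t' p.2) (i, j)).symm
    · refine Eq.trans ?_ (Mat_.mono_apply_ne (M := Mat_.tensObj M N) (N := Mat_.tensObj P Q)
        (Prod.map e e') (fun p : M.ι × N.ι => t p.1 ⊗ₘ t' p.2) (i, j) (k, l) (fun h'' => h' (congrArg Prod.snd h''))).symm
      rw [Mat_.mono_apply_ne _ _ _ _ h', MonoidalPreadditive.tensor_zero]
      rfl
  · refine Eq.trans ?_ (Mat_.mono_apply_ne (M := Mat_.tensObj M N) (N := Mat_.tensObj P Q)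
        (Prod.map e e') (fun p : M.ι × N.ι => t p.1 ⊗ₘ t' p.2) (i, j) (k, l) (fun h'' => h (congrArg Prod.fst h''))).symm
    rw [Mat_.mono_apply_ne _ _ _ _ h, MonoidalPreadditive.zero_tensor]
    rfl

instance Mat_.instMonoidalStruct : MonoidalCategoryStruct (Mat_ C) where
  tensorObj M N := Mat_.tensObj M N
  tensorHom f g := Mat_.tens f g
  whiskerLeft M _ _ f := Mat_.tens (𝟙 M) f
  whiskerRight f N := Mat_.tens f (𝟙 N)
  tensorUnit := ⟨PUnit, fun _ => 𝟙_ C⟩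
  associator M N P := Mat_.monoIso (Equiv.prodAssoc _ _ _) fun p => α_ (M.X p.1.1) (N.X p.1.2) (P.X p.2)
  leftUnitor M := Mat_.monoIso (Equiv.punitProd _) fun p => λ_ (M.X p.2)
  rightUnitor M := Mat_.monoIso (Equiv.prodPUnit _) fun p => ρ_ (M.X p.1)

instance Mat_.instMonoidal : MonoidalCategory (Mat_ C) := MonoidalCategory.ofTensorHom
  (id_tensorHom_id := fun M N => by
    change Mat_.tens (𝟙 M) (𝟙 N) = 𝟙 _
    rw [Mat_.id_eq_mono, Mat_.id_eq_mono, Mat_.tens_mono, Mat_.id_eq_mono]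
    congr 1
    ext p
    exact MonoidalCategory.id_tensorHom_id _ _)
  (id_tensorHom := fun _ _ _ _ => rfl)
  (tensorHom_id := fun _ _ => rfl)
  (tensorHom_comp_tensorHom := by
    intro M₁ N₁ P₁ M₂ N₂ P₂ f₁ f₂ g₁ g₂
    ext p q
    change ∑ r : N₁.ι × N₂.ι, (f₁ p.1 r.1 ⊗ₘ f₂ p.2 r.2) ≫ (g₁ r.1 q.1 ⊗ₘ g₂ r.2 q.2) =
      (∑ j, f₁ p.1 j ≫ g₁ j q.1) ⊗ₘ (∑ j, f₂ p.2 j ≫ g₂ j q.2)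
    rw [sum_tensor, Fintype.sum_prod_type]
    refine Finset.sum_congr rfl fun j _ => ?_
    rw [tensor_sum]
    refine Finset.sum_congr rfl fun j' _ => ?_
    rw [MonoidalCategory.tensorHom_comp_tensorHom])
  (associator_naturality := by
    intro M₁ M₂ M₃ N₁ N₂ N₃ f₁ f₂ f₃
    ext p q
    obtain ⟨q, rfl⟩ := (Equiv.prodAssoc N₁.ι N₂.ι N₃.ι).surjective q
    refine (Mat_.comp_mono_apply _ (Equiv.injective _) _ _ _ _).trans ?_
    refine Eq.trans ?_ (Mat_.mono_comp_apply _ _ _ _ _).symm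
    exact MonoidalCategory.associator_naturality _ _ _)
  (leftUnitor_naturality := by
    intro M N f
    ext p q
    obtain ⟨q, rfl⟩ := (Equiv.punitProd N.ι).surjective q
    refine (Mat_.comp_mono_apply _ (Equiv.injective _) _ _ _ _).trans ?_
    refine Eq.trans ?_ (Mat_.mono_comp_apply _ _ _ _ _).symm
    change ((𝟙 (𝟙_ (Mat_ C)) : Mat_.Hom _ _) p.1 q.1 ⊗ₘ f p.2 q.2) ≫ _ = _
    have h : (𝟙 (𝟙_ (Mat_ C)) : Mat_.Hom _ _) p.1 q.1 = 𝟙 (𝟙_ C) :=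
      Mat_.id_apply_self (𝟙_ (Mat_ C)) PUnit.unit
    have h' := MonoidalCategory.leftUnitor_naturality (f p.2 q.2)
    rw [← MonoidalCategory.id_tensorHom] at h'
    exact (congrArg (fun t => (t ⊗ₘ f p.2 q.2) ≫ (λ_ (N.X q.2)).hom) h).trans h')
  (rightUnitor_naturality := by
    intro M N f
    ext p q
    obtain ⟨q, rfl⟩ := (Equiv.prodPUnit N.ι).surjective q
    refine (Mat_.comp_mono_apply _ (Equiv.injective _) _ _ _ _).trans ?_
    refine Eq.trans ?_ (Mat_.mono_comp_apply _ _ _ _ _).symm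
    change (f p.1 q.1 ⊗ₘ (𝟙 (𝟙_ (Mat_ C)) : Mat_.Hom _ _) p.2 q.2) ≫ _ = _
    have h : (𝟙 (𝟙_ (Mat_ C)) : Mat_.Hom _ _) p.2 q.2 = 𝟙 (𝟙_ C) :=
      Mat_.id_apply_self (𝟙_ (Mat_ C)) PUnit.unit
    have h' := MonoidalCategory.rightUnitor_naturality (f p.1 q.1)
    rw [← MonoidalCategory.tensorHom_id] at h'
    exact (congrArg (fun t => (f p.1 q.1 ⊗ₘ t) ≫ (ρ_ (N.X q.1)).hom) h).trans h')
  (pentagon := by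
    intro M N P Q
    change Mat_.tens (Mat_.mono _ _) (𝟙 Q) ≫ Mat_.mono _ _ ≫ Mat_.tens (𝟙 M) (Mat_.mono _ _) =
      Mat_.mono _ _ ≫ Mat_.mono _ _
    rw [Mat_.id_eq_mono Q, Mat_.id_eq_mono M, Mat_.tens_mono, Mat_.tens_mono]
    refine ((congrArg _ (Mat_.mono_comp_mono _ _ _ _)).trans (Mat_.mono_comp_mono _ _ _ _)).trans
      (Eq.trans ?_ (Mat_.mono_comp_mono _ _ _ _).symm)
    refine congrArg (Mat_.mono _) (funext fun p => ?_)
    have := MonoidalCategory.pentagon (M.X p.1.1.1) (N.X p.1.1.2) (P.X p.1.2) (Q.X p.2)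
    rw [← MonoidalCategory.id_tensorHom, ← MonoidalCategory.tensorHom_id] at this
    exact this)
  (triangle := by
    intro M N
    change Mat_.mono _ _ ≫ Mat_.tens (𝟙 M) (Mat_.mono _ _) = Mat_.tens (Mat_.mono _ _) (𝟙 N)
    rw [Mat_.id_eq_mono N, Mat_.id_eq_mono M, Mat_.tens_mono, Mat_.tens_mono]
    refine (Mat_.mono_comp_mono _ _ _ _).trans ?_
    refine congrArg (Mat_.mono _) (funext fun p => ?_)
    have := MonoidalCategory.triangle (M.X p.1.1) (N.X p.2)
    rw [← MonoidalCategory.id_tensorHom, ← MonoidalCategory.tensorHom_id] at this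
    exact this)

end Mat

section KaroubiMonoidal

open Idempotents

variable {C : Type*} [Category C] [MonoidalCategory C]

/-- The tensor product of morphisms in the Karoubi envelope. -/
def karoubiTens {P Q R S : Karoubi C} (f : P ⟶ R) (g : Q ⟶ S) :
    (⟨P.X ⊗ Q.X, P.p ⊗ₘ Q.p, by rw [tensorHom_comp_tensorHom, P.idem, Q.idem]⟩ : Karoubi C) ⟶
      ⟨R.X ⊗ S.X, R.p ⊗ₘ S.p, by rw [tensorHom_comp_tensorHom, R.idem, S.idem]⟩ :=
  ⟨f.f ⊗ₘ g.f, by simp only [tensorHom_comp_tensorHom, f.comm, g.comm]⟩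

/-- An isomorphism of the underlying objects compatible with the idempotents. -/
def karoubiIso {P Q : Karoubi C} (e : P.X ≅ Q.X) (h : P.p ≫ e.hom = e.hom ≫ Q.p) : P ≅ Q where
  hom := ⟨P.p ≫ e.hom, by rw [Category.assoc, ← h, P.idem_assoc, P.idem_assoc]⟩
  inv := ⟨Q.p ≫ e.inv, by
    have h' : e.inv ≫ P.p = Q.p ≫ e.inv := by
      rw [Iso.inv_comp_eq, ← Category.assoc, ← h, Category.assoc, e.hom_inv_id, Category.comp_id]
    rw [Category.assoc, h', Q.idem_assoc, Q.idem_assoc]⟩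
  hom_inv_id := by
    ext
    change (P.p ≫ e.hom) ≫ Q.p ≫ e.inv = P.p
    rw [Category.assoc, ← Category.assoc e.hom, ← h]
    simp
  inv_hom_id := by
    ext
    change (Q.p ≫ e.inv) ≫ P.p ≫ e.hom = Q.p
    rw [h]
    simp

instance karoubiMonoidalStruct : MonoidalCategoryStruct (Karoubi C) where
  tensorObj P Q := ⟨P.X ⊗ Q.X, P.p ⊗ₘ Q.p, by rw [tensorHom_comp_tensorHom, P.idem, Q.idem]⟩
  tensorHom f g := karoubiTens f g
  whiskerLeft P _ _ f := karoubiTens (𝟙 P) f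
  whiskerRight f Q := karoubiTens f (𝟙 Q)
  tensorUnit := ⟨𝟙_ C, 𝟙 _, Category.id_comp _⟩
  associator P Q R := karoubiIso (α_ P.X Q.X R.X) (MonoidalCategory.associator_naturality _ _ _)
  leftUnitor P := karoubiIso (λ_ P.X) (by
    have h := MonoidalCategory.leftUnitor_naturality P.p
    rw [← MonoidalCategory.id_tensorHom] at h
    exact h)
  rightUnitor P := karoubiIso (ρ_ P.X) (by
    have h := MonoidalCategory.rightUnitor_naturality P.p
    rw [← MonoidalCategory.tensorHom_id] at h
    exact h)

instance karoubiMonoidal : MonoidalCategory (Karoubi C) := MonoidalCategory.ofTensorHom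
  (id_tensorHom_id := fun _ _ => rfl)
  (id_tensorHom := fun _ _ _ _ => rfl)
  (tensorHom_id := fun _ _ => rfl)
  (tensorHom_comp_tensorHom := by
    intros
    ext
    exact MonoidalCategory.tensorHom_comp_tensorHom _ _ _ _)
  (associator_naturality := by
    intro P₁ P₂ P₃ Q₁ Q₂ Q₃ f₁ f₂ f₃
    ext
    change ((f₁.f ⊗ₘ f₂.f) ⊗ₘ f₃.f) ≫ ((Q₁.p ⊗ₘ Q₂.p) ⊗ₘ Q₃.p) ≫ (α_ Q₁.X Q₂.X Q₃.X).hom =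
      (((P₁.p ⊗ₘ P₂.p) ⊗ₘ P₃.p) ≫ (α_ P₁.X P₂.X P₃.X).hom) ≫ (f₁.f ⊗ₘ (f₂.f ⊗ₘ f₃.f))
    rw [Category.assoc, ← MonoidalCategory.associator_naturality f₁.f]
    simp only [← Category.assoc, tensorHom_comp_tensorHom, Karoubi.p_comp, Karoubi.comp_p])
  (leftUnitor_naturality := by
    intro P Q f
    ext
    change (𝟙 (𝟙_ C) ⊗ₘ f.f) ≫ (𝟙 (𝟙_ C) ⊗ₘ Q.p) ≫ (λ_ Q.X).hom =
      ((𝟙 (𝟙_ C) ⊗ₘ P.p) ≫ (λ_ P.X).hom) ≫ f.f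
    simp only [MonoidalCategory.id_tensorHom, MonoidalCategory.leftUnitor_naturality,
      Category.assoc, MonoidalCategory.leftUnitor_naturality_assoc, Karoubi.p_comp, Karoubi.comp_p])
  (rightUnitor_naturality := by
    intro P Q f
    ext
    change (f.f ⊗ₘ 𝟙 (𝟙_ C)) ≫ (Q.p ⊗ₘ 𝟙 (𝟙_ C)) ≫ (ρ_ Q.X).hom =
      ((P.p ⊗ₘ 𝟙 (𝟙_ C)) ≫ (ρ_ P.X).hom) ≫ f.f
    simp only [MonoidalCategory.tensorHom_id, MonoidalCategory.rightUnitor_naturality,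
      Category.assoc, MonoidalCategory.rightUnitor_naturality_assoc, Karoubi.p_comp,
      Karoubi.comp_p])
  (pentagon := by
    intro P Q R S
    ext
    change ((((P.p ⊗ₘ Q.p) ⊗ₘ R.p) ≫ (α_ P.X Q.X R.X).hom) ⊗ₘ S.p) ≫
      (((P.p ⊗ₘ (Q.p ⊗ₘ R.p)) ⊗ₘ S.p) ≫ (α_ P.X (Q.X ⊗ R.X) S.X).hom) ≫
        (P.p ⊗ₘ (((Q.p ⊗ₘ R.p) ⊗ₘ S.p) ≫ (α_ Q.X R.X S.X).hom)) =
      ((((P.p ⊗ₘ Q.p) ⊗ₘ R.p) ⊗ₘ S.p) ≫ (α_ (P.X ⊗ Q.X) R.X S.X).hom) ≫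
        ((P.p ⊗ₘ Q.p) ⊗ₘ (R.p ⊗ₘ S.p)) ≫ (α_ P.X Q.X (R.X ⊗ S.X)).hom
    have e₁ : (((P.p ⊗ₘ Q.p) ⊗ₘ R.p) ≫ (α_ P.X Q.X R.X).hom) ⊗ₘ S.p =
        (α_ P.X Q.X R.X).hom ▷ S.X ≫ ((P.p ⊗ₘ (Q.p ⊗ₘ R.p)) ⊗ₘ S.p) := by
      rw [MonoidalCategory.associator_naturality, ← MonoidalCategory.tensorHom_id,
        tensorHom_comp_tensorHom, Category.id_comp]
    have e₂ : P.p ⊗ₘ (((Q.p ⊗ₘ R.p) ⊗ₘ S.p) ≫ (α_ Q.X R.X S.X).hom) =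
        P.X ◁ (α_ Q.X R.X S.X).hom ≫ (P.p ⊗ₘ (Q.p ⊗ₘ (R.p ⊗ₘ S.p))) := by
      rw [MonoidalCategory.associator_naturality, ← MonoidalCategory.id_tensorHom,
        tensorHom_comp_tensorHom, Category.id_comp]
    have e₃ : P.p ⊗ₘ (((Q.p ⊗ₘ R.p) ⊗ₘ S.p) ≫ (α_ Q.X R.X S.X).hom) =
        (P.p ⊗ₘ ((Q.p ⊗ₘ R.p) ⊗ₘ S.p)) ≫ P.X ◁ (α_ Q.X R.X S.X).hom := by
      rw [← MonoidalCategory.id_tensorHom, tensorHom_comp_tensorHom, Category.comp_id]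
    have i₁ : ((P.p ⊗ₘ (Q.p ⊗ₘ R.p)) ⊗ₘ S.p) ≫ ((P.p ⊗ₘ (Q.p ⊗ₘ R.p)) ⊗ₘ S.p) =
        (P.p ⊗ₘ (Q.p ⊗ₘ R.p)) ⊗ₘ S.p := by
      simp only [tensorHom_comp_tensorHom, Karoubi.idem]
    have i₂ : (P.p ⊗ₘ ((Q.p ⊗ₘ R.p) ⊗ₘ S.p)) ≫ (P.p ⊗ₘ ((Q.p ⊗ₘ R.p) ⊗ₘ S.p)) =
        P.p ⊗ₘ ((Q.p ⊗ₘ R.p) ⊗ₘ S.p) := by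
      simp only [tensorHom_comp_tensorHom, Karoubi.idem]
    have i₃ : ((P.p ⊗ₘ Q.p) ⊗ₘ (R.p ⊗ₘ S.p)) ≫ ((P.p ⊗ₘ Q.p) ⊗ₘ (R.p ⊗ₘ S.p)) =
        (P.p ⊗ₘ Q.p) ⊗ₘ (R.p ⊗ₘ S.p) := by
      simp only [tensorHom_comp_tensorHom, Karoubi.idem]
    rw [e₁, e₃]
    simp only [Category.assoc]
    rw [reassoc_of% i₁, MonoidalCategory.associator_naturality_assoc, reassoc_of% i₂, ← e₃, e₂,
      MonoidalCategory.associator_naturality_assoc (P.p ⊗ₘ Q.p) R.p S.p, reassoc_of% i₃,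
      MonoidalCategory.associator_naturality, ← MonoidalCategory.pentagon_assoc])
  (triangle := by
    intro P Q
    ext
    change (((P.p ⊗ₘ 𝟙 (𝟙_ C)) ⊗ₘ Q.p) ≫ (α_ P.X (𝟙_ C) Q.X).hom) ≫
      (P.p ⊗ₘ ((𝟙 (𝟙_ C) ⊗ₘ Q.p) ≫ (λ_ Q.X).hom)) = ((P.p ⊗ₘ 𝟙 (𝟙_ C)) ≫ (ρ_ P.X).hom) ⊗ₘ Q.p
    have e₁ : (𝟙 (𝟙_ C) ⊗ₘ Q.p) ≫ (λ_ Q.X).hom = (λ_ Q.X).hom ≫ Q.p := by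
      rw [MonoidalCategory.id_tensorHom, MonoidalCategory.leftUnitor_naturality]
    have e₂ : (P.p ⊗ₘ 𝟙 (𝟙_ C)) ≫ (ρ_ P.X).hom = (ρ_ P.X).hom ≫ P.p := by
      rw [MonoidalCategory.tensorHom_id, MonoidalCategory.rightUnitor_naturality]
    have e₃ : ((ρ_ P.X).hom ≫ P.p) ⊗ₘ Q.p =
        ((P.p ⊗ₘ 𝟙 (𝟙_ C)) ⊗ₘ Q.p) ≫ (ρ_ P.X).hom ▷ Q.X := by
      rw [← e₂, ← MonoidalCategory.tensorHom_id (ρ_ P.X).hom, tensorHom_comp_tensorHom,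
        Category.comp_id]
    have e₄ : P.p ⊗ₘ ((𝟙 (𝟙_ C) ⊗ₘ Q.p) ≫ (λ_ Q.X).hom) =
        (P.p ⊗ₘ (𝟙 (𝟙_ C) ⊗ₘ Q.p)) ≫ P.X ◁ (λ_ Q.X).hom := by
      rw [← MonoidalCategory.id_tensorHom P.X, tensorHom_comp_tensorHom, Category.comp_id]
    have i₁ : (P.p ⊗ₘ (𝟙 (𝟙_ C) ⊗ₘ Q.p)) ≫ (P.p ⊗ₘ (𝟙 (𝟙_ C) ⊗ₘ Q.p)) =
        P.p ⊗ₘ (𝟙 (𝟙_ C) ⊗ₘ Q.p) := by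
      simp only [tensorHom_comp_tensorHom, Karoubi.idem, Category.comp_id]
    rw [e₂, e₃, e₄, MonoidalCategory.associator_naturality, Category.assoc, reassoc_of% i₁,
      ← MonoidalCategory.associator_naturality_assoc, MonoidalCategory.triangle])

end KaroubiMonoidal

/-- The category `𝒞`: the Karoubi envelope of the completion under finite products of the
`ℚ`-linearization of `CPrime`. -/
abbrev CatC := Idempotents.Karoubi (Mat_ (QLin CPrime))

/-- The canonical functor from `CPrime` to `𝒞` on objects. -/
def CatC.of (X : CPrime) : CatC :=
  (Idempotents.toKaroubi (Mat_ (QLin CPrime))).obj ((Mat_.embedding (QLin CPrime)).obj ⟨X⟩)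

/-- The generating object of `𝒞`. -/
def CatC.F : CatC := CatC.of CPrime.F

/-! ### Crystals -/

/-- The iterates of a partial map, given as a map `B → B ⊔ {0}`. -/
def partialIter {B : Type*} (g : B → Option B) : ℕ → B → Option B
  | 0, b => some b
  | k + 1, b => (partialIter g k b).bind g

theorem partialIter_val {B : Type*} {g : B → Option B} {ε : B → ℤ}
    (hs : ∀ b b', g b = some b' → ε b' = ε b - 1) (k : ℕ) (b b' : B)
    (h : partialIter g k b = some b') : ε b' = ε b - k := by
  induction k generalizing b' with
  | zero => simp only [partialIter, Option.some.injEq] at h; subst h; simp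
  | succ k ih =>
    simp only [partialIter, Option.bind_eq_some_iff] at h
    obtain ⟨c, hc, hb⟩ := h
    rw [hs _ _ hb, ih c hc]
    push_cast
    ring

theorem partialIter_isGreatest {B : Type*} {g : B → Option B} {ε : B → ℤ} (h0 : ∀ b, 0 ≤ ε b)
    (hs : ∀ b b', g b = some b' → ε b' = ε b - 1) (hn : ∀ b, g b = none → ε b = 0) (b : B) :
    IsGreatest {n : ℤ | ∃ k : ℕ, n = k ∧ partialIter g k b ≠ none} (ε b) := by
  have key : ∀ k : ℕ, (k : ℤ) ≤ ε b → partialIter g k b ≠ none := by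
    intro k
    induction k with
    | zero => simp [partialIter]
    | succ k ih =>
      intro hk
      push_cast at hk
      obtain ⟨c, hc⟩ := Option.ne_none_iff_exists'.mp (ih (by omega))
      have := partialIter_val hs k b c hc
      simp only [partialIter, hc, Option.bind_some]
      intro h
      have := hn c h
      omega
  constructor
  · refine ⟨(ε b).toNat, ?_, key _ ?_⟩ <;> have := h0 b <;> omega
  · rintro _ ⟨k, rfl, hk⟩
    obtain ⟨c, hc⟩ := Option.ne_none_iff_exists'.mp hk
    have := partialIter_val hs k b c hc
    have := h0 c
    omega

/-- A finite normal `𝔰𝔩₂`-crystal. Maps `B → B ⊔ {0}` are encoded with `Option`, `none` being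
the extra element `0`. -/
structure Crystal where
  carrier : Type
  finite : Finite carrier
  wt : carrier → ℤ
  ε : carrier → ℤ
  φ : carrier → ℤ
  e : carrier → Option carrier
  f : carrier → Option carrier
  φ_eq : ∀ b, φ b = ε b + wt b
  e_spec : ∀ b b', e b = some b' → wt b' = wt b + 2 ∧ ε b' = ε b - 1 ∧ φ b' = φ b + 1
  f_spec : ∀ b b', f b = some b' → wt b' = wt b - 2 ∧ ε b' = ε b + 1 ∧ φ b' = φ b - 1
  e_iff_f : ∀ b b', e b' = some b ↔ f b = some b'
  ε_max : ∀ b, IsGreatest {n : ℤ | ∃ k : ℕ, n = k ∧ partialIter e k b ≠ none} (ε b)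
  φ_max : ∀ b, IsGreatest {n : ℤ | ∃ k : ℕ, n = k ∧ partialIter f k b ≠ none} (φ b)

namespace Crystal

theorem partialIter_none {B : Type*} {g : B → Option B} {b : B} (h : g b = none) (k : ℕ) :
    partialIter g (k + 1) b = none := by
  induction k with
  | zero => simp [partialIter, h]
  | succ k ih => rw [partialIter, ih]; rfl

theorem ε_nonneg (B : Crystal) (b : B.carrier) : 0 ≤ B.ε b :=
  (B.ε_max b).2 ⟨0, by simp, by simp [partialIter]⟩

theorem φ_nonneg (B : Crystal) (b : B.carrier) : 0 ≤ B.φ b :=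
  (B.φ_max b).2 ⟨0, by simp, by simp [partialIter]⟩

theorem ε_eq_zero (B : Crystal) (b : B.carrier) (h : B.e b = none) : B.ε b = 0 := by
  obtain ⟨k, hk, hk'⟩ := (B.ε_max b).1
  cases k with
  | zero => simpa using hk
  | succ k => exact absurd (partialIter_none h k) hk'

theorem φ_eq_zero (B : Crystal) (b : B.carrier) (h : B.f b = none) : B.φ b = 0 := by
  obtain ⟨k, hk, hk'⟩ := (B.φ_max b).1
  cases k with
  | zero => simpa using hk
  | succ k => exact absurd (partialIter_none h k) hk'

theorem e_none (B : Crystal) (b : B.carrier) (h : B.ε b = 0) : B.e b = none := by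
  rcases hb : B.e b with _ | b'
  · rfl
  · have := (B.e_spec b b' hb).2.1
    have := B.ε_nonneg b'
    omega

theorem f_none (B : Crystal) (b : B.carrier) (h : B.φ b = 0) : B.f b = none := by
  rcases hb : B.f b with _ | b'
  · rfl
  · have := (B.f_spec b b' hb).2.2
    have := B.φ_nonneg b'
    omega

/-- Morphisms of crystals: maps `A → B ⊔ {0}` compatible with the structure. -/
@[ext]
structure Hom (A B : Crystal) where
  toFun : A.carrier → Option B.carrier
  wt : ∀ a b, toFun a = some b → B.wt b = A.wt a
  ε : ∀ a b, toFun a = some b → B.ε b = A.ε a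
  φ : ∀ a b, toFun a = some b → B.φ b = A.φ a
  e : ∀ a, (A.e a).bind toFun = (toFun a).bind B.e
  f : ∀ a, (A.f a).bind toFun = (toFun a).bind B.f

instance instCat : Category Crystal where
  Hom := Hom
  id A :=
    { toFun := some
      wt := by rintro a b ⟨⟩; rfl
      ε := by rintro a b ⟨⟩; rfl
      φ := by rintro a b ⟨⟩; rfl
      e := by simp
      f := by simp }
  comp α β :=
    { toFun := fun a => (α.toFun a).bind β.toFun
      wt := by
        intro a c h
        obtain ⟨b, hb, hc⟩ := Option.bind_eq_some_iff.mp h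
        rw [β.wt b c hc, α.wt a b hb]
      ε := by
        intro a c h
        obtain ⟨b, hb, hc⟩ := Option.bind_eq_some_iff.mp h
        rw [β.ε b c hc, α.ε a b hb]
      φ := by
        intro a c h
        obtain ⟨b, hb, hc⟩ := Option.bind_eq_some_iff.mp h
        rw [β.φ b c hc, α.φ a b hb]
      e := by
        intro a
        change (_ : Option _).bind (fun a => (α.toFun a).bind β.toFun) = _
        rw [← Option.bind_assoc, α.e, Option.bind_assoc, Option.bind_assoc]
        exact congrArg _ (funext fun b => β.e b)
      f := by
        intro a
        change (_ : Option _).bind (fun a => (α.toFun a).bind β.toFun) = _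
        rw [← Option.bind_assoc, α.f, Option.bind_assoc, Option.bind_assoc]
        exact congrArg _ (funext fun b => β.f b) }
  id_comp α := by ext1; rfl
  comp_id α := by ext1; funext a; exact Option.bind_fun_some _
  assoc α β γ := by ext1; funext a; exact Option.bind_assoc _ _ _

theorem hom_ext {A B : Crystal} {α β : A ⟶ B} (h : ∀ a, α.toFun a = β.toFun a) : α = β :=
  Hom.ext (funext h)

theorem comp_toFun {A B D : Crystal} (α : A ⟶ B) (β : B ⟶ D) (a : A.carrier) :
    (α ≫ β).toFun a = (α.toFun a).bind β.toFun := rfl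

theorem id_toFun {A : Crystal} (a : A.carrier) : (𝟙 A : A ⟶ A).toFun a = some a := rfl

instance instZeroMorphisms : HasZeroMorphisms Crystal where
  zero A B := ⟨{
    toFun := fun _ => none
    wt := by simp
    ε := by simp
    φ := by simp
    e := by simp
    f := by simp }⟩
  comp_zero α D := hom_ext fun a => by
    change (α.toFun a).bind (fun _ => none) = none
    simp
  zero_comp _ _ _ _ := rfl

theorem zero_toFun {A B : Crystal} (a : A.carrier) : (0 : A ⟶ B).toFun a = none := rfl

/-- The isomorphism of crystals given by a bijection preserving the structure. -/
def isoOfEquiv {A B : Crystal} (σ : A.carrier ≃ B.carrier) (hwt : ∀ a, B.wt (σ a) = A.wt a)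
    (hε : ∀ a, B.ε (σ a) = A.ε a) (he : ∀ a, B.e (σ a) = (A.e a).map σ)
    (hf : ∀ a, B.f (σ a) = (A.f a).map σ) : A ≅ B where
  hom :=
    { toFun := fun a => some (σ a)
      wt := by rintro a b ⟨⟩; exact hwt a
      ε := by rintro a b ⟨⟩; exact hε a
      φ := by rintro a b ⟨⟩; rw [B.φ_eq, A.φ_eq, hwt, hε]
      e := by intro a; simp only [Option.bind_some, he]; rw [Option.map_eq_bind]; rfl
      f := by intro a; simp only [Option.bind_some, hf]; rw [Option.map_eq_bind]; rfl }
  inv :=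
    { toFun := fun b => some (σ.symm b)
      wt := by rintro b a ⟨⟩; rw [← hwt, σ.apply_symm_apply]
      ε := by rintro b a ⟨⟩; rw [← hε, σ.apply_symm_apply]
      φ := by rintro b a ⟨⟩; rw [B.φ_eq, A.φ_eq, ← hwt, ← hε, σ.apply_symm_apply]
      e := by
        intro b
        obtain ⟨a, rfl⟩ := σ.surjective b
        rw [he, Option.bind_some, σ.symm_apply_apply, Option.bind_map]
        simp
      f := by
        intro b
        obtain ⟨a, rfl⟩ := σ.surjective b
        rw [hf, Option.bind_some, σ.symm_apply_apply, Option.bind_map]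
        simp }
  hom_inv_id := hom_ext fun a => congrArg some (σ.symm_apply_apply a)
  inv_hom_id := hom_ext fun b => congrArg some (σ.apply_symm_apply b)

/-- The crystal `𝔹(n)`; the index `j : Fin (n + 1)` stands for the element `v_{n-2j}`. -/
def BB (n : ℕ) : Crystal where
  carrier := Fin (n + 1)
  finite := inferInstance
  wt j := n - 2 * (j : ℕ)
  ε j := (j : ℕ)
  φ j := n - (j : ℕ)
  e j := if (j : ℕ) = 0 then none else some ⟨j - 1, by omega⟩
  f j := if h : (j : ℕ) + 1 < n + 1 then some ⟨j + 1, h⟩ else none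
  φ_eq j := by ring
  e_spec := by
    intro j j' h
    split_ifs at h with h0
    simp only [Option.some.injEq] at h
    subst h
    simp only
    omega
  f_spec := by
    intro j j' h
    split_ifs at h with h0
    simp only [Option.some.injEq] at h
    subst h
    simp only
    omega
  e_iff_f := by
    intro j j'
    split_ifs <;> simp [Fin.ext_iff] <;> omega
  ε_max := by
    refine partialIter_isGreatest (fun j => by omega) ?_ ?_
    · intro j j' h
      split_ifs at h with h0
      simp only [Option.some.injEq] at h
      subst h
      simp only
      omega
    · intro j h
      split_ifs at h with h0
      omega
  φ_max := by
    refine partialIter_isGreatest (fun j => by omega) ?_ ?_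
    · intro j j' h
      split_ifs at h with h0
      simp only [Option.some.injEq] at h
      subst h
      simp only
      omega
    · intro j h
      split_ifs at h with h0
      omega

/-- The operator `e` of the tensor product. -/
def tensE (A B : Crystal) (p : A.carrier × B.carrier) : Option (A.carrier × B.carrier) :=
  if B.φ p.2 < A.ε p.1 then (A.e p.1).map (fun a => (a, p.2)) else (B.e p.2).map (fun b => (p.1, b))

/-- The operator `f` of the tensor product. -/
def tensF (A B : Crystal) (p : A.carrier × B.carrier) : Option (A.carrier × B.carrier) :=
  if B.φ p.2 ≤ A.ε p.1 then (A.f p.1).map (fun a => (a, p.2)) else (B.f p.2).map (fun b => (p.1, b))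

theorem tensE_some {A B : Crystal} {p q : A.carrier × B.carrier} :
    tensE A B p = some q ↔ (B.φ p.2 < A.ε p.1 ∧ A.e p.1 = some q.1 ∧ q.2 = p.2) ∨
      (A.ε p.1 ≤ B.φ p.2 ∧ q.1 = p.1 ∧ B.e p.2 = some q.2) := by
  obtain ⟨a, b⟩ := p
  obtain ⟨a', b'⟩ := q
  unfold tensE
  split_ifs with h
  · simp [h, not_le.mpr h, eq_comm]
  · simp [h, not_lt.mp h, eq_comm]
    tauto

theorem tensF_some {A B : Crystal} {p q : A.carrier × B.carrier} :
    tensF A B p = some q ↔ (B.φ p.2 ≤ A.ε p.1 ∧ A.f p.1 = some q.1 ∧ q.2 = p.2) ∨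
      (A.ε p.1 < B.φ p.2 ∧ q.1 = p.1 ∧ B.f p.2 = some q.2) := by
  obtain ⟨a, b⟩ := p
  obtain ⟨a', b'⟩ := q
  unfold tensF
  split_ifs with h
  · simp [h, not_lt.mpr h, eq_comm]
  · simp [h, not_le.mp h, eq_comm]
    tauto

/-- The tensor product of crystals. -/
def tens (A B : Crystal) : Crystal where
  carrier := A.carrier × B.carrier
  finite := by
    have := A.finite
    have := B.finite
    infer_instance
  wt p := A.wt p.1 + B.wt p.2
  ε p := max (B.ε p.2) (A.ε p.1 - B.wt p.2)
  φ p := max (A.φ p.1) (B.φ p.2 + A.wt p.1)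
  e := tensE A B
  f := tensF A B
  φ_eq p := by
    have := A.φ_eq p.1
    have := B.φ_eq p.2
    omega
  e_spec p q h := by
    have := A.φ_eq p.1
    have := B.φ_eq p.2
    rcases tensE_some.mp h with ⟨h1, h2, h3⟩ | ⟨h1, h2, h3⟩
    · have := A.e_spec _ _ h2
      rw [h3]
      omega
    · have := B.e_spec _ _ h3
      rw [h2]
      omega
  f_spec p q h := by
    have := A.φ_eq p.1
    have := B.φ_eq p.2
    rcases tensF_some.mp h with ⟨h1, h2, h3⟩ | ⟨h1, h2, h3⟩
    · have := A.f_spec _ _ h2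
      rw [h3]
      omega
    · have := B.f_spec _ _ h3
      rw [h2]
      omega
  e_iff_f p q := by
    rw [tensE_some, tensF_some, A.e_iff_f, B.e_iff_f]
    constructor
    · rintro (⟨h1, h2, h3⟩ | ⟨h1, h2, h3⟩)
      · have := A.f_spec _ _ h2
        exact Or.inl ⟨by rw [h3]; omega, h2, h3.symm⟩
      · have := B.f_spec _ _ h3
        exact Or.inr ⟨by rw [h2]; omega, h2.symm, h3⟩
    · rintro (⟨h1, h2, h3⟩ | ⟨h1, h2, h3⟩)
      · have := A.f_spec _ _ h2
        exact Or.inl ⟨by rw [h3]; omega, h2, h3.symm⟩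
      · have := B.f_spec _ _ h3
        exact Or.inr ⟨by rw [h2]; omega, h2.symm, h3⟩
  ε_max := by
    refine partialIter_isGreatest (fun p => ?_) ?_ ?_
    · have := B.ε_nonneg p.2
      omega
    · intro p q h
      have := A.φ_eq p.1
      have := B.φ_eq p.2
      rcases tensE_some.mp h with ⟨h1, h2, h3⟩ | ⟨h1, h2, h3⟩
      · have := A.e_spec _ _ h2
        rw [h3]
        omega
      · have := B.e_spec _ _ h3
        rw [h2]
        omega
    · intro p h
      have := B.φ_eq p.2
      have := B.φ_nonneg p.2
      unfold tensE at h
      split_ifs at h with h'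
      · have := A.ε_eq_zero _ (Option.map_eq_none_iff.mp h)
        omega
      · have := B.ε_eq_zero _ (Option.map_eq_none_iff.mp h)
        omega
  φ_max := by
    refine partialIter_isGreatest (fun p => ?_) ?_ ?_
    · have := A.φ_nonneg p.1
      omega
    · intro p q h
      have := A.φ_eq p.1
      have := B.φ_eq p.2
      rcases tensF_some.mp h with ⟨h1, h2, h3⟩ | ⟨h1, h2, h3⟩
      · have := A.f_spec _ _ h2
        rw [h3]
        omega
      · have := B.f_spec _ _ h3
        rw [h2]
        omega
    · intro p h
      have := A.φ_eq p.1
      have := A.ε_nonneg p.1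
      unfold tensF at h
      split_ifs at h with h'
      · have := A.φ_eq_zero _ (Option.map_eq_none_iff.mp h)
        omega
      · have := B.φ_eq_zero _ (Option.map_eq_none_iff.mp h)
        omega

/-- The map underlying the tensor product of two morphisms. -/
def tensFun {A B A' B' : Crystal} (α : A ⟶ A') (β : B ⟶ B') (p : A.carrier × B.carrier) :
    Option (A'.carrier × B'.carrier) :=
  (α.toFun p.1).bind fun a => (β.toFun p.2).map fun b => (a, b)

theorem tensFun_some {A B A' B' : Crystal} {α : A ⟶ A'} {β : B ⟶ B'} {p : A.carrier × B.carrier}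
    {q : A'.carrier × B'.carrier} :
    tensFun α β p = some q ↔ α.toFun p.1 = some q.1 ∧ β.toFun p.2 = some q.2 := by
  obtain ⟨a', b'⟩ := q
  simp [tensFun, Option.bind_eq_some_iff]

/-- The tensor product of two morphisms. -/
def tensMap {A B A' B' : Crystal} (α : A ⟶ A') (β : B ⟶ B') : tens A B ⟶ tens A' B' where
  toFun := tensFun α β
  wt p q h := by
    obtain ⟨h1, h2⟩ := tensFun_some.mp h
    change _ + _ = _ + _
    rw [α.wt _ _ h1, β.wt _ _ h2]
  ε p q h := by
    obtain ⟨h1, h2⟩ := tensFun_some.mp h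
    change max _ _ = max _ _
    rw [α.ε _ _ h1, β.ε _ _ h2, β.wt _ _ h2]
  φ p q h := by
    obtain ⟨h1, h2⟩ := tensFun_some.mp h
    change max _ _ = max _ _
    rw [α.φ _ _ h1, β.φ _ _ h2, α.wt _ _ h1]
  e p := by
    obtain ⟨a, b⟩ := p
    have h1 := α.e a
    have h2 := β.e b
    change (tensE A B (a, b)).bind (tensFun α β) = (tensFun α β (a, b)).bind (tensE A' B')
    rcases ha : α.toFun a with _ | a'
    · rw [ha] at h1
      unfold tensE tensFun
      split_ifs with h
      · rcases hx : A.e a with _ | x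
        · simp [ha]
        · rw [hx] at h1
          simp only [Option.bind_some, Option.bind_none] at h1
          simp [ha, h1]
      · simp [ha]
    rcases hb : β.toFun b with _ | b'
    · rw [hb] at h2
      unfold tensE tensFun
      split_ifs with h
      · simp [hb]
      · rcases hx : B.e b with _ | x
        · simp [hb]
        · rw [hx] at h2
          simp only [Option.bind_some, Option.bind_none] at h2
          simp [hb, h2]
    rw [ha, Option.bind_some] at h1
    rw [hb, Option.bind_some] at h2
    unfold tensE tensFun
    simp only [ha, hb, Option.bind_some, Option.map_some, α.ε _ _ ha, β.φ _ _ hb, ← h1, ← h2]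
    split_ifs with h
    · rcases hx : A.e a with _ | x
      · simp
      · simp only [Option.map_some, Option.bind_some, hb]
        rw [Option.map_eq_bind]
        rfl
    · rcases hx : B.e b with _ | x
      · simp
      · simp [ha]
  f p := by
    obtain ⟨a, b⟩ := p
    have h1 := α.f a
    have h2 := β.f b
    change (tensF A B (a, b)).bind (tensFun α β) = (tensFun α β (a, b)).bind (tensF A' B')
    rcases ha : α.toFun a with _ | a'
    · rw [ha] at h1
      unfold tensF tensFun
      split_ifs with h
      · rcases hx : A.f a with _ | x
        · simp [ha]
        · rw [hx] at h1
          simp only [Option.bind_some, Option.bind_none] at h1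
          simp [ha, h1]
      · simp [ha]
    rcases hb : β.toFun b with _ | b'
    · rw [hb] at h2
      unfold tensF tensFun
      split_ifs with h
      · simp [hb]
      · rcases hx : B.f b with _ | x
        · simp [hb]
        · rw [hx] at h2
          simp only [Option.bind_some, Option.bind_none] at h2
          simp [hb, h2]
    rw [ha, Option.bind_some] at h1
    rw [hb, Option.bind_some] at h2
    unfold tensF tensFun
    simp only [ha, hb, Option.bind_some, Option.map_some, α.ε _ _ ha, β.φ _ _ hb, ← h1, ← h2]
    split_ifs with h
    · rcases hx : A.f a with _ | x
      · simp
      · simp only [Option.map_some, Option.bind_some, hb]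
        rw [Option.map_eq_bind]
        rfl
    · rcases hx : B.f b with _ | x
      · simp
      · simp [ha]

/-- The associativity isomorphism. -/
def assocIso (A B D : Crystal) : tens (tens A B) D ≅ tens A (tens B D) :=
  isoOfEquiv (Equiv.prodAssoc _ _ _)
    (by rintro ⟨⟨a, b⟩, d⟩; exact (add_assoc _ _ _).symm)
    (by
      rintro ⟨⟨a, b⟩, d⟩
      change max (max (D.ε d) (B.ε b - D.wt d)) (A.ε a - (B.wt b + D.wt d)) =
        max (D.ε d) (max (B.ε b) (A.ε a - B.wt b) - D.wt d)
      omega)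
    (by
      rintro ⟨⟨a, b⟩, d⟩
      have := B.φ_eq b
      have := D.φ_eq d
      have := D.ε_nonneg d
      change tensE A (tens B D) (a, (b, d)) = (tensE (tens A B) D ((a, b), d)).map _
      change (if max (B.φ b) (D.φ d + B.wt b) < A.ε a then (A.e a).map (fun a => (a, (b, d)))
          else ((if D.φ d < B.ε b then (B.e b).map (fun b => (b, d))
            else (D.e d).map (fun d => (b, d)))).map (fun q => (a, q))) =
        (if D.φ d < max (B.ε b) (A.ε a - B.wt b) then
          (if B.φ b < A.ε a then (A.e a).map (fun a => (a, b))
            else (B.e b).map (fun b => (a, b))).map (fun q => (q, d))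
          else (D.e d).map (fun d => ((a, b), d))).map (Equiv.prodAssoc _ _ _)
      split_ifs <;> first | omega | (simp [Function.comp_def]))
    (by
      rintro ⟨⟨a, b⟩, d⟩
      have := B.φ_eq b
      have := D.φ_eq d
      have := D.ε_nonneg d
      change tensF A (tens B D) (a, (b, d)) = (tensF (tens A B) D ((a, b), d)).map _
      change (if max (B.φ b) (D.φ d + B.wt b) ≤ A.ε a then (A.f a).map (fun a => (a, (b, d)))
          else ((if D.φ d ≤ B.ε b then (B.f b).map (fun b => (b, d))
            else (D.f d).map (fun d => (b, d)))).map (fun q => (a, q))) =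
        (if D.φ d ≤ max (B.ε b) (A.ε a - B.wt b) then
          (if B.φ b ≤ A.ε a then (A.f a).map (fun a => (a, b))
            else (B.f b).map (fun b => (a, b))).map (fun q => (q, d))
          else (D.f d).map (fun d => ((a, b), d))).map (Equiv.prodAssoc _ _ _)
      split_ifs <;> first | omega | (simp [Function.comp_def]))

/-- `𝔹(0) ⊗ A ≅ A`. -/
def leftIso (A : Crystal) : tens (BB 0) A ≅ A :=
  isoOfEquiv (Equiv.uniqueProd A.carrier (Fin 1))
    (by
      rintro ⟨i, a⟩
      obtain rfl : i = (0 : Fin 1) := Subsingleton.elim (α := Fin 1) _ _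
      change A.wt a = (0 : ℕ) - 2 * (0 : ℕ) + A.wt a
      simp)
    (by
      rintro ⟨i, a⟩
      obtain rfl : i = (0 : Fin 1) := Subsingleton.elim (α := Fin 1) _ _
      have := A.φ_eq a
      have := A.φ_nonneg a
      change A.ε a = max (A.ε a) ((0 : ℕ) - A.wt a)
      omega)
    (by
      rintro ⟨i, a⟩
      obtain rfl : i = (0 : Fin 1) := Subsingleton.elim (α := Fin 1) _ _
      have h : ¬ A.φ a < ((0 : ℕ) : ℤ) := by have := A.φ_nonneg a; omega
      change A.e a = (if A.φ a < ((0 : ℕ) : ℤ) then _ else (A.e a).map (fun b => _)).map _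
      refine Eq.trans ?_ (congrArg _ (if_neg h).symm)
      rcases A.e a with _ | x <;> rfl)
    (by
      rintro ⟨i, a⟩
      obtain rfl : i = (0 : Fin 1) := Subsingleton.elim (α := Fin 1) _ _
      change A.f a = (if A.φ a ≤ ((0 : ℕ) : ℤ) then ((none : Option (Fin 1)).map _)
        else (A.f a).map (fun b => _)).map _
      split_ifs with h
      · rw [A.f_none a (by have := A.φ_nonneg a; omega)]
        rfl
      · rcases A.f a with _ | x <;> rfl)

/-- `A ⊗ 𝔹(0) ≅ A`. -/
def rightIso (A : Crystal) : tens A (BB 0) ≅ A :=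
  isoOfEquiv (Equiv.prodUnique A.carrier (Fin 1))
    (by
      rintro ⟨a, i⟩
      obtain rfl : i = (0 : Fin 1) := Subsingleton.elim (α := Fin 1) _ _
      change A.wt a = A.wt a + ((0 : ℕ) - 2 * (0 : ℕ))
      simp)
    (by
      rintro ⟨a, i⟩
      obtain rfl : i = (0 : Fin 1) := Subsingleton.elim (α := Fin 1) _ _
      have := A.ε_nonneg a
      change A.ε a = max ((0 : ℕ) : ℤ) (A.ε a - ((0 : ℕ) - 2 * (0 : ℕ)))
      omega)
    (by
      rintro ⟨a, i⟩
      obtain rfl : i = (0 : Fin 1) := Subsingleton.elim (α := Fin 1) _ _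
      change A.e a = (if ((0 : ℕ) : ℤ) - (0 : ℕ) < A.ε a then (A.e a).map (fun b => _)
        else (none : Option (Fin 1)).map _).map _
      split_ifs with h
      · rcases A.e a with _ | x <;> rfl
      · rw [A.e_none a (by have := A.ε_nonneg a; omega)]
        rfl)
    (by
      rintro ⟨a, i⟩
      obtain rfl : i = (0 : Fin 1) := Subsingleton.elim (α := Fin 1) _ _
      have h : ((0 : ℕ) : ℤ) - (0 : ℕ) ≤ A.ε a := by have := A.ε_nonneg a; omega
      change A.f a = (if ((0 : ℕ) : ℤ) - (0 : ℕ) ≤ A.ε a then (A.f a).map (fun b => _)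
        else _).map _
      refine Eq.trans ?_ (congrArg _ (if_pos h).symm)
      rcases A.f a with _ | x <;> rfl)

instance instMonoidalStruct : MonoidalCategoryStruct Crystal where
  tensorObj := tens
  tensorHom f g := tensMap f g
  whiskerLeft A _ _ f := tensMap (𝟙 A) f
  whiskerRight f B := tensMap f (𝟙 B)
  tensorUnit := BB 0
  associator := assocIso
  leftUnitor := leftIso
  rightUnitor := rightIso

instance instMonoidal : MonoidalCategory Crystal := MonoidalCategory.ofTensorHom
  (id_tensorHom_id := fun _ _ => rfl)
  (id_tensorHom := fun _ _ _ _ => rfl)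
  (tensorHom_id := fun _ _ => rfl)
  (tensorHom_comp_tensorHom := by
    intro A₁ B₁ D₁ A₂ B₂ D₂ f₁ f₂ g₁ g₂
    refine hom_ext ?_
    rintro ⟨a, b⟩
    change (tensFun f₁ f₂ (a, b)).bind (tensFun g₁ g₂) = tensFun (f₁ ≫ g₁) (f₂ ≫ g₂) (a, b)
    unfold tensFun
    rw [comp_toFun, comp_toFun]
    rcases f₁.toFun a with _ | a' <;> rcases f₂.toFun b with _ | b' <;> simp)
  (associator_naturality := by
    intro A₁ A₂ A₃ B₁ B₂ B₃ f₁ f₂ f₃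
    refine hom_ext ?_
    rintro ⟨⟨a, b⟩, d⟩
    change (tensFun (tensMap f₁ f₂) f₃ ((a, b), d)).bind (fun q => some (q.1.1, (q.1.2, q.2))) =
      tensFun f₁ (tensMap f₂ f₃) (a, (b, d))
    change (((f₁.toFun a).bind fun a' => (f₂.toFun b).map fun b' => (a', b')).bind fun q =>
      (f₃.toFun d).map fun d' => (q, d')).bind (fun q => some (q.1.1, (q.1.2, q.2))) =
      (f₁.toFun a).bind fun a' => ((f₂.toFun b).bind fun b' =>
        (f₃.toFun d).map fun d' => (b', d')).map fun q => (a', q)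
    rcases f₁.toFun a with _ | a' <;> rcases f₂.toFun b with _ | b' <;>
      rcases f₃.toFun d with _ | d' <;> rfl)
  (leftUnitor_naturality := by
    intro A B f
    refine hom_ext ?_
    rintro ⟨i, a⟩
    change ((f.toFun a).map fun b => (i, b)).bind (fun q => some q.2) = f.toFun a
    rcases f.toFun a with _ | b <;> rfl)
  (rightUnitor_naturality := by
    intro A B f
    refine hom_ext ?_
    rintro ⟨a, i⟩
    change ((f.toFun a).bind fun b => some (b, i)).bind (fun q => some q.1) = f.toFun a
    rcases f.toFun a with _ | b <;> rfl)
  (pentagon := fun _ _ _ _ => rfl)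
  (triangle := by
    intro A B
    refine hom_ext ?_
    rintro ⟨⟨a, i⟩, b⟩
    rfl)

/-! #### Decomposition into the crystals `𝔹(n)` -/

theorem toFun_of_f {A B : Crystal} (α : A ⟶ B) {a a' : A.carrier} (h : A.f a = some a') :
    α.toFun a' = (α.toFun a).bind B.f := by
  have h1 := α.f a
  rw [h] at h1
  exact h1

theorem toFun_of_e {A B : Crystal} (α : A ⟶ B) {a a' : A.carrier} (h : A.e a = some a') :
    α.toFun a' = (α.toFun a).bind B.e := by
  have h1 := α.e a
  rw [h] at h1
  exact h1

theorem comp_some {A B D : Crystal} {α : A ⟶ B} {β : B ⟶ D} {a : A.carrier} {b : B.carrier}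
    {d : D.carrier} (h : α.toFun a = some b) (h' : β.toFun b = some d) :
    (α ≫ β).toFun a = some d :=
  Option.bind_eq_some_iff.mpr ⟨b, h, h'⟩

theorem whiskerRight_some {A B D : Crystal} {α : A ⟶ B} {a : A.carrier} {b : B.carrier}
    (h : α.toFun a = some b) (d : D.carrier) :
    (α ▷ D).toFun ((a, d) : A.carrier × D.carrier) = some ((b, d) : B.carrier × D.carrier) :=
  tensFun_some.mpr ⟨h, rfl⟩

theorem whiskerLeft_some {A B D : Crystal} {α : A ⟶ B} {a : A.carrier} {b : B.carrier}
    (h : α.toFun a = some b) (d : D.carrier) :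
    (D ◁ α).toFun ((d, a) : D.carrier × A.carrier) = some ((d, b) : D.carrier × B.carrier) :=
  (tensFun_some (α := 𝟙 D) (β := α) (p := (d, a)) (q := (d, b))).mpr ⟨rfl, h⟩

theorem hom_eq_aux {n : ℕ} {B : Crystal} (α β : BB n ⟶ B) :
    ∀ (i j : Fin (n + 1)), α.toFun i = β.toFun i → α.toFun j = β.toFun j := by
  have up : ∀ (i : ℕ) (hi : i < n + 1) (hi' : i + 1 < n + 1),
      α.toFun (⟨i, hi⟩ : Fin (n + 1)) = β.toFun (⟨i, hi⟩ : Fin (n + 1)) ↔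
        α.toFun (⟨i + 1, hi'⟩ : Fin (n + 1)) = β.toFun (⟨i + 1, hi'⟩ : Fin (n + 1)) := by
    intro i hi hi'
    have hf : (BB n).f (⟨i, hi⟩ : Fin (n + 1)) = some (⟨i + 1, hi'⟩ : Fin (n + 1)) := dif_pos hi'
    have he : (BB n).e (⟨i + 1, hi'⟩ : Fin (n + 1)) = some (⟨i, hi⟩ : Fin (n + 1)) :=
      ((BB n).e_iff_f _ _).mpr hf
    have h1 := toFun_of_f α hf
    have h2 := toFun_of_f β hf
    have h3 := toFun_of_e α he
    have h4 := toFun_of_e β he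
    exact ⟨fun h => by rw [h1, h2, h], fun h => by rw [h3, h4, h]⟩
  have zero : ∀ (i : ℕ) (hi : i < n + 1),
      α.toFun (⟨i, hi⟩ : Fin (n + 1)) = β.toFun (⟨i, hi⟩ : Fin (n + 1)) ↔
        α.toFun (⟨0, by omega⟩ : Fin (n + 1)) = β.toFun (⟨0, by omega⟩ : Fin (n + 1)) := by
    intro i
    induction i with
    | zero => intro hi; exact Iff.rfl
    | succ i ih => intro hi; rw [← up i (by omega) hi, ih]
  rintro ⟨i, hi⟩ ⟨j, hj⟩ h
  exact (zero j hj).mpr ((zero i hi).mp h)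

/-- Two morphisms out of `𝔹(n)` agreeing at one element are equal. -/
theorem hom_eq_of {n : ℕ} {B : Crystal} {α β : BB n ⟶ B} (i : Fin (n + 1))
    (h : α.toFun i = β.toFun i) : α = β :=
  hom_ext fun j => hom_eq_aux α β i j h

theorem ne_zero_of {n : ℕ} {B : Crystal} {α : BB n ⟶ B} {i : Fin (n + 1)} {b : B.carrier}
    (h : α.toFun i = some b) : α ≠ 0 := by
  rintro rfl
  cases h

theorem exists_some {n : ℕ} {B : Crystal} {α : BB n ⟶ B} (h : α ≠ 0) (i : Fin (n + 1)) :
    ∃ b, α.toFun i = some b := by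
  rcases hb : α.toFun i with _ | b
  · exact absurd (hom_eq_of (β := 0) i hb) h
  · exact ⟨b, rfl⟩

/-- Every element of a crystal lies in the image of exactly one pair `(n, 𝔹(n) ⟶ B)`:
uniqueness. -/
theorem image_unique {B : Crystal} {n n' : ℕ} {α : BB n ⟶ B} {α' : BB n' ⟶ B} {i : Fin (n + 1)}
    {i' : Fin (n' + 1)} {b : B.carrier} (h : α.toFun i = some b) (h' : α'.toFun i' = some b) :
    (⟨n, α, i⟩ : Σ n, (BB n ⟶ B) × Fin (n + 1)) = ⟨n', α', i'⟩ := by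
  have h1 : B.ε b = ((i : ℕ) : ℤ) := α.ε _ _ h
  have h2 : B.φ b = (n : ℤ) - (i : ℕ) := α.φ _ _ h
  have h3 : B.ε b = ((i' : ℕ) : ℤ) := α'.ε _ _ h'
  have h4 : B.φ b = (n' : ℤ) - (i' : ℕ) := α'.φ _ _ h'
  obtain rfl : n = n' := by omega
  obtain rfl : i = i' := Fin.ext (by omega)
  obtain rfl : α = α' := hom_eq_of i (h.trans h'.symm)
  rfl

theorem string_some (B : Crystal) (b : B.carrier) (k : ℕ) (hk : (k : ℤ) ≤ B.φ b) :
    ∃ c, partialIter B.f k b = some c ∧ B.φ c = B.φ b - k ∧ B.ε c = B.ε b + k ∧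
      B.wt c = B.wt b - 2 * k := by
  induction k with
  | zero => exact ⟨b, rfl, by simp, by simp, by simp⟩
  | succ k ih =>
    push_cast at hk
    obtain ⟨c, hc, h1, h2, h3⟩ := ih (by omega)
    rcases hd : B.f c with _ | d
    · have := B.φ_eq_zero c hd
      omega
    · have := B.f_spec c d hd
      exact ⟨d, by rw [partialIter, hc]; exact hd, by push_cast; omega, by push_cast; omega,
        by push_cast; omega⟩

/-- The morphism `𝔹(n) ⟶ B` given by a highest weight element. -/
theorem exists_of_highest (B : Crystal) (b : B.carrier) (hb : B.e b = none) :
    ∃ (n : ℕ) (α : BB n ⟶ B), α.toFun (0 : Fin (n + 1)) = some b := by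
  have hε := B.ε_eq_zero b hb
  have hφ := B.φ_eq b
  have hφ' := B.φ_nonneg b
  obtain ⟨n, hn⟩ : ∃ n : ℕ, B.φ b = n := ⟨(B.φ b).toNat, by omega⟩
  have key := fun (j : Fin (n + 1)) => B.string_some b j (by have := j.2; omega)
  refine ⟨n, ⟨fun j : Fin (n + 1) => partialIter B.f j b, ?_, ?_, ?_, ?_, ?_⟩, rfl⟩
  · intro (j : Fin (n + 1)) c hc
    obtain ⟨c', h, h1, h2, h3⟩ := key j
    obtain rfl : c' = c := Option.some.inj (h.symm.trans hc)
    change _ = (n : ℤ) - 2 * (j : ℕ)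
    omega
  · intro (j : Fin (n + 1)) c hc
    obtain ⟨c', h, h1, h2, h3⟩ := key j
    obtain rfl : c' = c := Option.some.inj (h.symm.trans hc)
    change _ = ((j : ℕ) : ℤ)
    omega
  · intro (j : Fin (n + 1)) c hc
    obtain ⟨c', h, h1, h2, h3⟩ := key j
    obtain rfl : c' = c := Option.some.inj (h.symm.trans hc)
    change _ = (n : ℤ) - (j : ℕ)
    omega
  · rintro ⟨j, hj⟩
    change Option.bind (if j = 0 then none else some (⟨j - 1, by omega⟩ : Fin (n + 1))) _ = _
    cases j with
    | zero => simp [partialIter, hb]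
    | succ j =>
      obtain ⟨c, h, -⟩ := B.string_some b j (by omega)
      obtain ⟨c', h', -⟩ := B.string_some b (j + 1) (by push_cast; omega)
      have h'' : B.f c = some c' := by rw [partialIter, h] at h'; exact h'
      rw [if_neg (by omega)]
      change partialIter B.f j b = (partialIter B.f (j + 1) b).bind B.e
      rw [h, h', Option.bind_some, (B.e_iff_f c c').mpr h'']
  · rintro ⟨j, hj⟩
    change Option.bind (if h : j + 1 < n + 1 then some (⟨j + 1, h⟩ : Fin (n + 1)) else none) _ = _
    split_ifs with h
    · rfl
    · obtain ⟨c, hc, h1, -⟩ := B.string_some b j (by omega)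
      change none = (partialIter B.f j b).bind B.f
      rw [hc, Option.bind_some, B.f_none c (by omega)]

/-- Every element of a crystal lies in the image of some morphism `𝔹(n) ⟶ B`. -/
theorem exists_image (B : Crystal) (b : B.carrier) :
    ∃ (n : ℕ) (α : BB n ⟶ B) (i : Fin (n + 1)), α.toFun i = some b := by
  obtain ⟨k, hk⟩ : ∃ k : ℕ, B.ε b = k := ⟨(B.ε b).toNat, by have := B.ε_nonneg b; omega⟩
  induction k generalizing b with
  | zero =>
    obtain ⟨n, α, h⟩ := B.exists_of_highest b (B.e_none b (by simpa using hk))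
    exact ⟨n, α, 0, h⟩
  | succ k ih =>
    rcases he : B.e b with _ | b'
    · have := B.ε_eq_zero b he
      omega
    · have h1 := (B.e_spec b b' he).2.1
      obtain ⟨n, α, i, hi⟩ := ih b' (by push_cast at hk; omega)
      have hf : B.f b' = some b := (B.e_iff_f b' b).mp he
      have h2 := α.f i
      rw [hi, Option.bind_some, hf] at h2
      obtain ⟨j, -, hj⟩ := Option.bind_eq_some_iff.mp h2
      exact ⟨n, α, j, hj⟩

/-- The set of non-zero morphisms `𝔹(n) ⟶ B`. -/
abbrev mult (n : ℕ) (B : Crystal) : Type := {α : BB n ⟶ B // α ≠ 0}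

theorem mult_finite (B : Crystal) : Finite (Σ n, mult n B) := by
  have := B.finite
  refine Finite.of_injective
    (fun x : Σ n, mult n B => x.2.1.toFun (0 : Fin (x.1 + 1))) ?_
  rintro ⟨n, α, hα⟩ ⟨n', α', hα'⟩ h
  obtain ⟨b, hb⟩ := exists_some hα 0
  have := image_unique hb (((show α.toFun (0 : Fin (n + 1)) = α'.toFun (0 : Fin (n' + 1)) from h).symm).trans hb)
  cases this
  rfl

/-- The map `(f, g) ↦ (f ⊗ 𝟙) ∘ g`. -/
def leftComp (A D : Crystal) (l : ℕ) (x : Σ α, mult α A × mult l (BB α ⊗ D)) : mult l (A ⊗ D) :=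
  ⟨x.2.2.1 ≫ x.2.1.1 ▷ D, by
    obtain ⟨⟨p, q⟩, hg⟩ := exists_some x.2.2.2 0
    obtain ⟨a, ha⟩ := exists_some x.2.1.2 p
    refine ne_zero_of (i := 0) (b := ((a, q) : A.carrier × D.carrier)) ?_
    exact comp_some hg (whiskerRight_some ha q)⟩

/-- The map `(g, f) ↦ (𝟙 ⊗ f) ∘ g`. -/
def rightComp (D A : Crystal) (l : ℕ) (x : Σ β, mult l (D ⊗ BB β) × mult β A) : mult l (D ⊗ A) :=
  ⟨x.2.1.1 ≫ D ◁ x.2.2.1, by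
    obtain ⟨⟨p, q⟩, hg⟩ := exists_some x.2.1.2 0
    obtain ⟨a, ha⟩ := exists_some x.2.2.2 q
    refine ne_zero_of (i := 0) (b := ((p, a) : D.carrier × A.carrier)) ?_
    exact comp_some hg (whiskerLeft_some ha p)⟩

theorem leftComp_bijective (A D : Crystal) (l : ℕ) : Function.Bijective (leftComp A D l) := by
  constructor
  · rintro ⟨n, ⟨f, hf⟩, ⟨g, hg⟩⟩ ⟨n', ⟨f', hf'⟩, ⟨g', hg'⟩⟩ h
    obtain ⟨⟨p, q⟩, hpq⟩ := exists_some hg 0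
    obtain ⟨⟨p', q'⟩, hpq'⟩ := exists_some hg' 0
    obtain ⟨a, ha⟩ := exists_some hf p
    obtain ⟨a', ha'⟩ := exists_some hf' p'
    have h1 : (g ≫ f ▷ D).toFun (0 : Fin (l + 1)) = some ((a, q) : A.carrier × D.carrier) := by
      exact comp_some hpq (whiskerRight_some ha _)
    have h2 : (g' ≫ f' ▷ D).toFun (0 : Fin (l + 1)) = some ((a', q') : A.carrier × D.carrier) := by
      exact comp_some hpq' (whiskerRight_some ha' _)
    have h3 : g ≫ f ▷ D = g' ≫ f' ▷ D := congrArg Subtype.val h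
    rw [h3, h2] at h1
    cases h1
    have h4 := image_unique ha ha'
    cases h4
    obtain rfl : g = g' := hom_eq_of 0 (hpq.trans hpq'.symm)
    rfl
  · rintro ⟨x, hx⟩
    obtain ⟨⟨a, q⟩, haq⟩ := exists_some hx 0
    obtain ⟨n, f, p, hp⟩ := A.exists_image a
    obtain ⟨m, g, r, hr⟩ := (BB n ⊗ D).exists_image ((p, q) : (BB n).carrier × D.carrier)
    have h1 : (g ≫ f ▷ D).toFun r = some ((a, q) : A.carrier × D.carrier) := by
      exact comp_some hr (whiskerRight_some hp _)
    have h2 := image_unique h1 haq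
    cases h2
    exact ⟨⟨n, ⟨f, ne_zero_of hp⟩, ⟨g, ne_zero_of hr⟩⟩, rfl⟩

theorem rightComp_bijective (D A : Crystal) (l : ℕ) : Function.Bijective (rightComp D A l) := by
  constructor
  · rintro ⟨n, ⟨g, hg⟩, ⟨f, hf⟩⟩ ⟨n', ⟨g', hg'⟩, ⟨f', hf'⟩⟩ h
    obtain ⟨⟨q, p⟩, hpq⟩ := exists_some hg 0
    obtain ⟨⟨q', p'⟩, hpq'⟩ := exists_some hg' 0
    obtain ⟨a, ha⟩ := exists_some hf p
    obtain ⟨a', ha'⟩ := exists_some hf' p'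
    have h1 : (g ≫ D ◁ f).toFun (0 : Fin (l + 1)) = some ((q, a) : D.carrier × A.carrier) := by
      exact comp_some hpq (whiskerLeft_some ha _)
    have h2 : (g' ≫ D ◁ f').toFun (0 : Fin (l + 1)) = some ((q', a') : D.carrier × A.carrier) := by
      exact comp_some hpq' (whiskerLeft_some ha' _)
    have h3 : g ≫ D ◁ f = g' ≫ D ◁ f' := congrArg Subtype.val h
    rw [h3, h2] at h1
    cases h1
    have h4 := image_unique ha ha'
    cases h4
    obtain rfl : g = g' := hom_eq_of 0 (hpq.trans hpq'.symm)
    rfl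
  · rintro ⟨x, hx⟩
    obtain ⟨⟨q, a⟩, haq⟩ := exists_some hx 0
    obtain ⟨n, f, p, hp⟩ := A.exists_image a
    obtain ⟨m, g, r, hr⟩ := (D ⊗ BB n).exists_image ((q, p) : D.carrier × (BB n).carrier)
    have h1 : (g ≫ D ◁ f).toFun r = some ((q, a) : D.carrier × A.carrier) := by
      exact comp_some hr (whiskerLeft_some hp _)
    have h2 := image_unique h1 haq
    cases h2
    exact ⟨⟨n, ⟨g, ne_zero_of hr⟩, ⟨f, ne_zero_of hp⟩⟩, rfl⟩

/-- Composition with an isomorphism of crystals. -/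
def multIso {A B : Crystal} (σ : A ≅ B) (n : ℕ) : mult n A ≃ mult n B where
  toFun α := ⟨α.1 ≫ σ.hom, fun h => α.2 (by
    rw [← Category.comp_id α.1, ← σ.hom_inv_id, ← Category.assoc, h, zero_comp])⟩
  invFun α := ⟨α.1 ≫ σ.inv, fun h => α.2 (by
    rw [← Category.comp_id α.1, ← σ.inv_hom_id, ← Category.assoc, h, zero_comp])⟩
  left_inv α := Subtype.ext (by simp)
  right_inv α := Subtype.ext (by simp)

/-- The set `V_{ij}^k` of the decomposition `𝔹(i) ⊗ 𝔹(j) = ⨁ₖ 𝔹(k) ⊠ V_{ij}^k`. -/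
abbrev VV (i j k : ℕ) : Type := mult k (BB i ⊗ BB j)

/-- The bijection `⨆_α V_{ij}^α × V_{αk}^l ≃ ⨆_β V_{iβ}^l × V_{jk}^β` given by the associativity
of the tensor product of crystals: both sides are identified with the set of non-zero morphisms
from `𝔹(l)` to `(𝔹(i) ⊗ 𝔹(j)) ⊗ 𝔹(k) ≅ 𝔹(i) ⊗ (𝔹(j) ⊗ 𝔹(k))`. -/
def assocEquiv (i j k l : ℕ) :
    (Σ α, VV i j α × VV α k l) ≃ (Σ β, VV i β l × VV j k β) :=
  ((Equiv.ofBijective _ (leftComp_bijective (BB i ⊗ BB j) (BB k) l)).trans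
    (multIso (α_ (BB i) (BB j) (BB k)) l)).trans
    (Equiv.ofBijective _ (rightComp_bijective (BB i) (BB j ⊗ BB k) l)).symm

theorem assocEquiv_spec (i j k l : ℕ) (x : Σ α, VV i j α × VV α k l) :
    (assocEquiv i j k l x).2.1.1 ≫ BB i ◁ (assocEquiv i j k l x).2.2.1 =
      x.2.2.1 ≫ x.2.1.1 ▷ BB k ≫ (α_ (BB i) (BB j) (BB k)).hom := by
  have h := Equiv.apply_symm_apply
    (Equiv.ofBijective _ (rightComp_bijective (BB i) (BB j ⊗ BB k) l))
    (multIso (α_ (BB i) (BB j) (BB k)) l (leftComp (BB i ⊗ BB j) (BB k) l x))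
  have h' := congrArg Subtype.val h
  refine Eq.trans h' ?_
  exact Category.assoc _ _ _

theorem assocEquiv_eq {i j k l : ℕ} {x : Σ α, VV i j α × VV α k l}
    {y : Σ β, VV i β l × VV j k β}
    (h : y.2.1.1 ≫ BB i ◁ y.2.2.1 = x.2.2.1 ≫ x.2.1.1 ▷ BB k ≫ (α_ (BB i) (BB j) (BB k)).hom) :
    assocEquiv i j k l x = y :=
  (rightComp_bijective (BB i) (BB j ⊗ BB k) l).1
    (Subtype.ext ((assocEquiv_spec i j k l x).trans h.symm))

theorem exists_assoc {i j k l a : ℕ} (f : VV i j a) (g : VV a k l) :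
    ∃ (b : ℕ) (p : VV i b l) (q : VV j k b),
      p.1 ≫ BB i ◁ q.1 = g.1 ≫ f.1 ▷ BB k ≫ (α_ (BB i) (BB j) (BB k)).hom :=
  ⟨_, _, _, assocEquiv_spec i j k l ⟨a, f, g⟩⟩

theorem right_unique {i j k l n b b' c c' : ℕ} {p : VV i b n} {q : VV j c b} {r : VV k l c}
    {p' : VV i b' n} {q' : VV j c' b'} {r' : VV k l c'}
    (h : p.1 ≫ BB i ◁ (q.1 ≫ BB j ◁ r.1) = p'.1 ≫ BB i ◁ (q'.1 ≫ BB j ◁ r'.1)) :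
    (⟨b, c, p, q, r⟩ : Σ b c, VV i b n × VV j c b × VV k l c) = ⟨b', c', p', q', r'⟩ := by
  have h1 := @(rightComp_bijective (BB i) (BB j ⊗ (BB k ⊗ BB l)) n).1
    ⟨b, p, rightComp (BB j) (BB k ⊗ BB l) b ⟨c, q, r⟩⟩
    ⟨b', p', rightComp (BB j) (BB k ⊗ BB l) b' ⟨c', q', r'⟩⟩ (Subtype.ext h)
  obtain rfl : b = b' := congrArg Sigma.fst h1
  have h2 := eq_of_heq (Sigma.mk.inj h1).2
  obtain rfl : p = p' := congrArg Prod.fst h2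
  have h3 := (rightComp_bijective (BB j) (BB k ⊗ BB l) b).1 (congrArg Prod.snd h2)
  cases h3
  rfl

theorem mult_BB {k j : ℕ} (m : mult k (BB j)) :
    (⟨k, m.1⟩ : Σ n, (BB n ⟶ BB j)) = ⟨j, 𝟙 (BB j)⟩ := by
  obtain ⟨b, hb⟩ := exists_some m.2 0
  have h := image_unique hb (id_toFun b)
  exact congrArg (fun x : Σ n, (BB n ⟶ BB j) × Fin (n + 1) =>
    (⟨x.1, x.2.1⟩ : Σ n, (BB n ⟶ BB j))) h

end Crystal

/-! ### The category `Crystals_ℚ` -/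

/-- Objects `⨁ₙ 𝔹(n) ⊠ Vₙ` with finite sets `Vₙ`, all but finitely many of them empty. -/
structure CrystalsQ where
  V : ℕ → Type
  finite : Finite (Σ n, V n)

namespace CrystalsQ

open Crystal

/-- Morphisms are families of linear maps `ℚ-span Vₙ → ℚ-span Wₙ`. -/
@[ext]
structure Hom (X Y : CrystalsQ) where
  app : ∀ n, (X.V n →₀ ℚ) →ₗ[ℚ] (Y.V n →₀ ℚ)

instance instCat : Category CrystalsQ where
  Hom := Hom
  id X := ⟨fun _ => LinearMap.id⟩
  comp S T := ⟨fun n => (T.app n).comp (S.app n)⟩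

theorem hom_ext {X Y : CrystalsQ} {S T : X ⟶ Y} (h : ∀ n v, S.app n v = T.app n v) : S = T :=
  Hom.ext (funext fun n => LinearMap.ext (h n))

theorem hom_ext_single {X Y : CrystalsQ} {S T : X ⟶ Y}
    (h : ∀ n v, S.app n (Finsupp.single v 1) = T.app n (Finsupp.single v 1)) : S = T :=
  Hom.ext (funext fun n => Finsupp.lhom_ext' fun v => LinearMap.ext_ring (h n v))

theorem comp_app {X Y Z : CrystalsQ} (S : X ⟶ Y) (T : Y ⟶ Z) (n : ℕ) (v : X.V n →₀ ℚ) :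
    (S ≫ T).app n v = T.app n (S.app n v) := rfl

theorem id_app {X : CrystalsQ} (n : ℕ) (v : X.V n →₀ ℚ) : Hom.app (𝟙 X) n v = v := rfl

/-- A morphism of `Crystals_ℚ` is a family of linear maps. -/
def homEquiv (X Y : CrystalsQ) : (X ⟶ Y) ≃ (∀ n, (X.V n →₀ ℚ) →ₗ[ℚ] (Y.V n →₀ ℚ)) where
  toFun S := S.app
  invFun S := ⟨S⟩

instance instHomGroup (X Y : CrystalsQ) : AddCommGroup (X ⟶ Y) := (homEquiv X Y).addCommGroup

instance instPreadditive : Preadditive CrystalsQ where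
  add_comp _ _ _ S S' T := hom_ext fun n v => map_add (T.app n) (S.app n v) (S'.app n v)
  comp_add _ _ _ _ _ _ := rfl

/-- The morphism given by maps of sets `Vₙ → Wₙ`. -/
def ofMap {X Y : CrystalsQ} (σ : ∀ n, X.V n → Y.V n) : X ⟶ Y :=
  ⟨fun n => Finsupp.lmapDomain ℚ ℚ (σ n)⟩

theorem ofMap_single {X Y : CrystalsQ} (σ : ∀ n, X.V n → Y.V n) (n : ℕ) (v : X.V n) (c : ℚ) :
    (ofMap σ).app n (Finsupp.single v c) = Finsupp.single (σ n v) c :=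
  Finsupp.mapDomain_single

theorem ofMap_comp {X Y Z : CrystalsQ} (σ : ∀ n, X.V n → Y.V n) (τ : ∀ n, Y.V n → Z.V n) :
    ofMap σ ≫ ofMap τ = ofMap fun n v => τ n (σ n v) :=
  hom_ext_single fun n v => by rw [comp_app, ofMap_single, ofMap_single, ofMap_single]

theorem id_eq_ofMap (X : CrystalsQ) : 𝟙 X = ofMap fun _ v => v :=
  hom_ext_single fun n v => by rw [ofMap_single]; rfl

/-- The isomorphism given by bijections `Vₙ ≃ Wₙ`. -/
def ofEquiv {X Y : CrystalsQ} (σ : ∀ n, X.V n ≃ Y.V n) : X ≅ Y where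
  hom := ofMap fun n => σ n
  inv := ofMap fun n => (σ n).symm
  hom_inv_id := by rw [ofMap_comp, id_eq_ofMap]; simp
  inv_hom_id := by rw [ofMap_comp, id_eq_ofMap]; simp

/-- The object `𝔹(m)`. -/
def simple (m : ℕ) : CrystalsQ where
  V n := PLift (n = m)
  finite := Finite.of_injective (β := Unit) (fun _ => ()) (by rintro ⟨n, ⟨rfl⟩⟩ ⟨n', ⟨rfl⟩⟩ _; rfl)

/-- The `k`-th set of the tensor product: from `𝔹(i) ⊗ 𝔹(j) = ⨁ₖ 𝔹(k) ⊠ V_{ij}^k` one gets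
`⨆_{i, j} Xᵢ × Yⱼ × V_{ij}^k`. -/
abbrev TV (X Y : CrystalsQ) (k : ℕ) : Type :=
  Σ p : ℕ × ℕ, X.V p.1 × Y.V p.2 × VV p.1 p.2 k

/-- The tensor product of objects. -/
def tens (X Y : CrystalsQ) : CrystalsQ where
  V := TV X Y
  finite := by
    have := X.finite
    have := Y.finite
    have := fun i j : ℕ => mult_finite (BB i ⊗ BB j)
    refine Finite.of_injective (β := Σ q : (Σ i, X.V i) × (Σ j, Y.V j),
      Σ k, mult k (BB q.1.1 ⊗ BB q.2.1))
      (fun x => ⟨(⟨x.2.1.1, x.2.2.1⟩, ⟨x.2.1.2, x.2.2.2.1⟩), ⟨x.1, x.2.2.2.2⟩⟩) ?_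
    rintro ⟨k, ⟨⟨i, j⟩, v, w, m⟩⟩ ⟨k', ⟨⟨i', j'⟩, v', w', m'⟩⟩ h
    cases h
    rfl

/-- The element `(v, w, m)` of the tensor product. -/
def elt {X Y : CrystalsQ} {i j k : ℕ} (v : X.V i) (w : Y.V j) (m : VV i j k) : (tens X Y).V k :=
  ⟨(i, j), v, w, m⟩

theorem eq_elt {X Y : CrystalsQ} {k : ℕ} (b : (tens X Y).V k) :
    ∃ (i j : ℕ) (v : X.V i) (w : Y.V j) (m : VV i j k), b = elt v w m :=
  ⟨b.1.1, b.1.2, b.2.1, b.2.2.1, b.2.2.2, rfl⟩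

/-- The bilinear map `(x, y) ↦ x ⊗ y ⊗ m` for a basis element `m` of the span of `V_{ij}^k`. -/
def incl {X Y : CrystalsQ} {i j k : ℕ} (m : VV i j k) :
    (X.V i →₀ ℚ) →ₗ[ℚ] (Y.V j →₀ ℚ) →ₗ[ℚ] ((tens X Y).V k →₀ ℚ) :=
  Finsupp.linearCombination ℚ fun v => Finsupp.lmapDomain ℚ ℚ fun w => elt v w m

theorem incl_single {X Y : CrystalsQ} {i j k : ℕ} (m : VV i j k) (v : X.V i) (w : Y.V j) :
    incl m (Finsupp.single v 1) (Finsupp.single w 1) = Finsupp.single (elt v w m) 1 := by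
  rw [incl, Finsupp.linearCombination_single, one_smul]
  exact Finsupp.mapDomain_single

/-- The tensor product of morphisms: `v ⊗ w ⊗ m ↦ S(v) ⊗ T(w) ⊗ m`. -/
def tensMap {X Y X' Y' : CrystalsQ} (S : X ⟶ X') (T : Y ⟶ Y') : tens X Y ⟶ tens X' Y' :=
  ⟨fun k => Finsupp.linearCombination ℚ fun b : TV X Y k =>
    incl b.2.2.2 (S.app b.1.1 (Finsupp.single b.2.1 1)) (T.app b.1.2 (Finsupp.single b.2.2.1 1))⟩

theorem tensMap_single {X Y X' Y' : CrystalsQ} (S : X ⟶ X') (T : Y ⟶ Y') {i j k : ℕ}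
    (m : VV i j k) (v : X.V i) (w : Y.V j) :
    (tensMap S T).app k (Finsupp.single (elt v w m) 1) =
      incl m (S.app i (Finsupp.single v 1)) (T.app j (Finsupp.single w 1)) :=
  (Finsupp.linearCombination_single ℚ _ _).trans (one_smul _ _)

theorem bilin_ext {A B : Type*} {M : Type*} [AddCommGroup M] [Module ℚ M]
    {f g : (A →₀ ℚ) →ₗ[ℚ] (B →₀ ℚ) →ₗ[ℚ] M}
    (h : ∀ a b, f (Finsupp.single a 1) (Finsupp.single b 1) =
      g (Finsupp.single a 1) (Finsupp.single b 1)) : f = g :=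
  Finsupp.lhom_ext' fun a => LinearMap.ext_ring <|
    Finsupp.lhom_ext' fun b => LinearMap.ext_ring (h a b)

theorem tensMap_incl {X Y X' Y' : CrystalsQ} (S : X ⟶ X') (T : Y ⟶ Y') {i j k : ℕ}
    (m : VV i j k) (x : X.V i →₀ ℚ) (y : Y.V j →₀ ℚ) :
    (tensMap S T).app k (incl m x y) = incl m (S.app i x) (T.app j y) := by
  have h : (incl m).compr₂ ((tensMap S T).app k) = (incl m).compl₁₂ (S.app i) (T.app j) :=
    bilin_ext fun v w => by
      rw [LinearMap.compr₂_apply, LinearMap.compl₁₂_apply, incl_single, tensMap_single]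
  exact LinearMap.congr_fun₂ h x y

theorem tens_induction {X Y : CrystalsQ} {k : ℕ} {P : ((tens X Y).V k →₀ ℚ) → Prop}
    (zero : P 0) (add : ∀ s t, P s → P t → P (s + t))
    (incl : ∀ (i j : ℕ) (m : VV i j k) x y, P (incl m x y)) (t : (tens X Y).V k →₀ ℚ) : P t := by
  induction t using Finsupp.induction_linear with
  | zero => exact zero
  | add s t hs ht => exact add s t hs ht
  | single b c =>
    obtain ⟨i, j, v, w, m, rfl⟩ := eq_elt b
    have h := incl i j m (c • Finsupp.single v 1) (Finsupp.single w 1)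
    rw [map_smul, LinearMap.smul_apply, incl_single, Finsupp.smul_single, smul_eq_mul, mul_one] at h
    exact h

theorem tens_hom_ext {X Y Z : CrystalsQ} {S T : tens X Y ⟶ Z}
    (h : ∀ (i j k : ℕ) (m : VV i j k) x y, S.app k (incl m x y) = T.app k (incl m x y)) : S = T :=
  hom_ext fun k t => by
    induction t using tens_induction with
    | zero => rw [map_zero, map_zero]
    | add s t hs ht => rw [map_add, map_add, hs, ht]
    | incl i j m x y => exact h i j k m x y

theorem tensMap_id (X Y : CrystalsQ) : tensMap (𝟙 X) (𝟙 Y) = 𝟙 (tens X Y) :=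
  tens_hom_ext fun _ _ _ m x y => tensMap_incl _ _ m x y

theorem tensMap_comp {X Y X' Y' X'' Y'' : CrystalsQ} (S : X ⟶ X') (T : Y ⟶ Y') (S' : X' ⟶ X'')
    (T' : Y' ⟶ Y'') : tensMap S T ≫ tensMap S' T' = tensMap (S ≫ S') (T ≫ T') :=
  tens_hom_ext fun i j k m x y => by
    rw [comp_app, tensMap_incl, tensMap_incl, tensMap_incl, comp_app, comp_app]

/-- The associativity bijections. -/
def assocV (X Y Z : CrystalsQ) (l : ℕ) : TV (tens X Y) Z l ≃ TV X (tens Y Z) l where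
  toFun b :=
    let r := assocEquiv b.2.1.1.1 b.2.1.1.2 b.1.2 l ⟨b.1.1, b.2.1.2.2.2, b.2.2.2⟩
    ⟨(b.2.1.1.1, r.1), b.2.1.2.1, ⟨(b.2.1.1.2, b.1.2), b.2.1.2.2.1, b.2.2.1, r.2.2⟩, r.2.1⟩
  invFun b :=
    let r := (assocEquiv b.1.1 b.2.2.1.1.1 b.2.2.1.1.2 l).symm ⟨b.1.2, b.2.2.2, b.2.2.1.2.2.2⟩
    ⟨(r.1, b.2.2.1.1.2), ⟨(b.1.1, b.2.2.1.1.1), b.2.1, b.2.2.1.2.1, r.2.1⟩, b.2.2.1.2.2.1, r.2.2⟩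
  left_inv := by
    rintro ⟨⟨a, k⟩, ⟨⟨i, j⟩, v, w, f⟩, u, g⟩
    exact congrArg (fun r : Σ α, VV i j α × VV α k l =>
      (⟨(r.1, k), ⟨(i, j), v, w, r.2.1⟩, u, r.2.2⟩ : TV (tens X Y) Z l))
      ((assocEquiv i j k l).symm_apply_apply ⟨a, f, g⟩)
  right_inv := by
    rintro ⟨⟨i, b⟩, v, ⟨⟨j, k⟩, w, u, f⟩, g⟩
    exact congrArg (fun r : Σ β, VV i β l × VV j k β =>
      (⟨(i, r.1), v, ⟨(j, k), w, u, r.2.2⟩, r.2.1⟩ : TV X (tens Y Z) l))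
      ((assocEquiv i j k l).apply_symm_apply ⟨b, g, f⟩)

/-- The associativity constraint. -/
def assocIso (X Y Z : CrystalsQ) : tens (tens X Y) Z ≅ tens X (tens Y Z) := ofEquiv (assocV X Y Z)

theorem assoc_single {X Y Z : CrystalsQ} {i j k a b l : ℕ} {f : VV i j a} {g : VV a k l}
    {p : VV i b l} {q : VV j k b}
    (h : p.1 ≫ BB i ◁ q.1 = g.1 ≫ f.1 ▷ BB k ≫ (α_ (BB i) (BB j) (BB k)).hom)
    (v : X.V i) (w : Y.V j) (u : Z.V k) :
    (assocIso X Y Z).hom.app l (Finsupp.single (elt (elt v w f) u g) 1) =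
      Finsupp.single (elt v (elt w u q) p) 1 := by
  refine (ofMap_single (X := tens (tens X Y) Z) (Y := tens X (tens Y Z))
    (fun n => assocV X Y Z n) l _ 1).trans ?_
  refine congrArg (fun b => Finsupp.single b 1) ?_
  exact congrArg (fun r : Σ β, VV i β l × VV j k β =>
    (⟨(i, r.1), v, ⟨(j, k), w, u, r.2.2⟩, r.2.1⟩ : TV X (tens Y Z) l))
    (assocEquiv_eq (x := ⟨a, f, g⟩) (y := ⟨b, p, q⟩) h)

theorem assoc_incl {X Y Z : CrystalsQ} {i j k a b l : ℕ} {f : VV i j a} {g : VV a k l}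
    {p : VV i b l} {q : VV j k b}
    (h : p.1 ≫ BB i ◁ q.1 = g.1 ≫ f.1 ▷ BB k ≫ (α_ (BB i) (BB j) (BB k)).hom)
    (x : X.V i →₀ ℚ) (y : Y.V j →₀ ℚ) (z : Z.V k →₀ ℚ) :
    (assocIso X Y Z).hom.app l (incl g (incl f x y) z) = incl p x (incl q y z) := by
  induction x using Finsupp.induction_linear with
  | zero => simp
  | add x x' hx hx' => simp only [map_add, LinearMap.add_apply, hx, hx']
  | single v c =>
  induction y using Finsupp.induction_linear with
  | zero => simp
  | add x x' hx hx' => simp only [map_add, LinearMap.add_apply, hx, hx']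
  | single w d =>
  induction z using Finsupp.induction_linear with
  | zero => simp
  | add x x' hx hx' => simp only [map_add, hx, hx']
  | single u e =>
  have h1 : Finsupp.single v c = c • Finsupp.single v 1 := by simp
  have h2 : Finsupp.single w d = d • Finsupp.single w 1 := by simp
  have h3 : Finsupp.single u e = e • Finsupp.single u 1 := by simp
  rw [h1, h2, h3]
  simp only [map_smul, LinearMap.smul_apply, incl_single, assoc_single h]

/-- The basis element of the unit object. -/
def unitElt : (simple 0).V 0 →₀ ℚ := Finsupp.single ⟨rfl⟩ 1

/-- The inverse of the left unit constraint of crystals, as an element of `V_{0k}^k`. -/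
def leftMult (k : ℕ) : VV 0 k k :=
  ⟨(λ_ (BB k)).inv, fun h => by
    have h' := (λ_ (BB k)).inv_hom_id
    rw [h, zero_comp] at h'
    exact ne_zero_of (id_toFun (0 : Fin (k + 1))) h'.symm⟩

/-- The inverse of the right unit constraint of crystals, as an element of `V_{k0}^k`. -/
def rightMult (k : ℕ) : VV k 0 k :=
  ⟨(ρ_ (BB k)).inv, fun h => by
    have h' := (ρ_ (BB k)).inv_hom_id
    rw [h, zero_comp] at h'
    exact ne_zero_of (id_toFun (0 : Fin (k + 1))) h'.symm⟩

/-- The bijections for the left unit constraint. -/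
def leftInvV (X : CrystalsQ) (k : ℕ) (v : X.V k) : (tens (simple 0) X).V k :=
  elt (i := 0) ⟨rfl⟩ v (leftMult k)

/-- The bijections for the right unit constraint. -/
def rightInvV (X : CrystalsQ) (k : ℕ) (v : X.V k) : (tens X (simple 0)).V k :=
  elt (j := 0) v ⟨rfl⟩ (rightMult k)

theorem leftInvV_bijective (X : CrystalsQ) (k : ℕ) : Function.Bijective (leftInvV X k) := by
  constructor
  · intro v v' h
    have h' := eq_of_heq (Sigma.mk.inj h).2
    exact congrArg (fun q => q.2.1) h'
  · rintro ⟨⟨i, j⟩, ⟨hi⟩, v, m⟩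
    change i = 0 at hi
    subst hi
    have h := mult_BB (multIso (λ_ (BB j)) k m)
    obtain rfl : k = j := congrArg Sigma.fst h
    have h' : m.1 ≫ (λ_ (BB k)).hom = 𝟙 _ := eq_of_heq (Sigma.mk.inj h).2
    refine ⟨v, ?_⟩
    have h'' : m.1 = (λ_ (BB k)).inv := by rw [← Category.id_comp (λ_ (BB k)).inv, ← h']; simp
    obtain ⟨m, hm⟩ := m
    cases h''
    rfl

theorem rightInvV_bijective (X : CrystalsQ) (k : ℕ) : Function.Bijective (rightInvV X k) := by
  constructor
  · intro v v' h
    have h' := eq_of_heq (Sigma.mk.inj h).2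
    exact congrArg (fun q => q.1) h'
  · rintro ⟨⟨i, j⟩, v, ⟨hj⟩, m⟩
    change j = 0 at hj
    subst hj
    have h := mult_BB (multIso (ρ_ (BB i)) k m)
    obtain rfl : k = i := congrArg Sigma.fst h
    have h' : m.1 ≫ (ρ_ (BB k)).hom = 𝟙 _ := eq_of_heq (Sigma.mk.inj h).2
    refine ⟨v, ?_⟩
    have h'' : m.1 = (ρ_ (BB k)).inv := by rw [← Category.id_comp (ρ_ (BB k)).inv, ← h']; simp
    obtain ⟨m, hm⟩ := m
    cases h''
    rfl

/-- The left unit constraint. -/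
def leftIso (X : CrystalsQ) : tens (simple 0) X ≅ X :=
  (ofEquiv fun k => Equiv.ofBijective _ (leftInvV_bijective X k)).symm

/-- The right unit constraint. -/
def rightIso (X : CrystalsQ) : tens X (simple 0) ≅ X :=
  (ofEquiv fun k => Equiv.ofBijective _ (rightInvV_bijective X k)).symm

theorem leftIso_inv_app (X : CrystalsQ) (k : ℕ) (x : X.V k →₀ ℚ) :
    (leftIso X).inv.app k x = incl (leftMult k) unitElt x := by
  have h : (leftIso X).inv.app k = incl (leftMult k) unitElt :=
    Finsupp.lhom_ext' fun v => LinearMap.ext_ring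
      ((ofMap_single (fun k => leftInvV X k) k v 1).trans
        (incl_single (X := simple 0) (i := 0) (leftMult k) ⟨rfl⟩ v).symm)
  exact LinearMap.congr_fun h x

theorem rightIso_inv_app (X : CrystalsQ) (k : ℕ) (x : X.V k →₀ ℚ) :
    (rightIso X).inv.app k x = incl (rightMult k) x unitElt := by
  have h : (rightIso X).inv.app k = (incl (rightMult k)).flip unitElt :=
    Finsupp.lhom_ext' fun v => LinearMap.ext_ring
      ((ofMap_single (fun k => rightInvV X k) k v 1).trans
        (incl_single (Y := simple 0) (j := 0) (rightMult k) v ⟨rfl⟩).symm)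
  exact LinearMap.congr_fun h x

theorem assoc_naturality {X₁ X₂ X₃ Y₁ Y₂ Y₃ : CrystalsQ} (f₁ : X₁ ⟶ Y₁) (f₂ : X₂ ⟶ Y₂)
    (f₃ : X₃ ⟶ Y₃) : tensMap (tensMap f₁ f₂) f₃ ≫ (assocIso Y₁ Y₂ Y₃).hom =
      (assocIso X₁ X₂ X₃).hom ≫ tensMap f₁ (tensMap f₂ f₃) := by
  refine tens_hom_ext fun a k l g t z => ?_
  induction t using tens_induction with
  | zero => simp only [map_zero, LinearMap.zero_apply]
  | add s t hs ht => simp only [map_add, LinearMap.add_apply, hs, ht]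
  | incl i j f x y =>
    obtain ⟨b, p, q, h⟩ := exists_assoc f g
    rw [comp_app, comp_app, tensMap_incl, tensMap_incl, assoc_incl h, assoc_incl h, tensMap_incl,
      tensMap_incl]

theorem left_naturality {X Y : CrystalsQ} (f : X ⟶ Y) :
    tensMap (𝟙 (simple 0)) f ≫ (leftIso Y).hom = (leftIso X).hom ≫ f := by
  rw [← Iso.inv_comp_eq, ← Category.assoc, ← Iso.eq_comp_inv]
  refine hom_ext fun k x => ?_
  rw [comp_app, comp_app, leftIso_inv_app, leftIso_inv_app, tensMap_incl, id_app]

theorem right_naturality {X Y : CrystalsQ} (f : X ⟶ Y) :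
    tensMap f (𝟙 (simple 0)) ≫ (rightIso Y).hom = (rightIso X).hom ≫ f := by
  rw [← Iso.inv_comp_eq, ← Category.assoc, ← Iso.eq_comp_inv]
  refine hom_ext fun k x => ?_
  rw [comp_app, comp_app, rightIso_inv_app, rightIso_inv_app, tensMap_incl, id_app]

theorem triangle (X Y : CrystalsQ) : (assocIso X (simple 0) Y).hom ≫ tensMap (𝟙 X) (leftIso Y).hom =
    tensMap (rightIso X).hom (𝟙 Y) := by
  have key : tensMap (rightIso X).inv (𝟙 Y) ≫ (assocIso X (simple 0) Y).hom =
      tensMap (𝟙 X) (leftIso Y).inv := by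
    refine tens_hom_ext fun i j k m x y => ?_
    have h : m.1 ≫ BB i ◁ (leftMult j).1 =
        m.1 ≫ (rightMult i).1 ▷ BB j ≫ (α_ (BB i) (BB 0) (BB j)).hom := by
      refine congrArg (m.1 ≫ ·) ?_
      change BB i ◁ (λ_ (BB j)).inv = (ρ_ (BB i)).inv ▷ BB j ≫ (α_ (BB i) (𝟙_ _) (BB j)).hom
      simp
    rw [comp_app, tensMap_incl, tensMap_incl, id_app, id_app, leftIso_inv_app, rightIso_inv_app,
      assoc_incl h]
  have h1 : tensMap (rightIso X).hom (𝟙 Y) ≫ tensMap (rightIso X).inv (𝟙 Y) = 𝟙 _ := by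
    rw [tensMap_comp, Iso.hom_inv_id, Category.comp_id, tensMap_id]
  have h2 : tensMap (𝟙 X) (leftIso Y).inv ≫ tensMap (𝟙 X) (leftIso Y).hom = 𝟙 _ := by
    rw [tensMap_comp, Iso.inv_hom_id, Category.comp_id, tensMap_id]
  rw [← Category.id_comp (assocIso X (simple 0) Y).hom, ← h1, Category.assoc, Category.assoc,
    ← Category.assoc (tensMap (rightIso X).inv (𝟙 Y)), key, h2, Category.comp_id]

theorem pentagon_aux {i j k l a b c n d e o c' : ℕ} {f : VV i j a} {g : VV a k b} {h : VV b l n}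
    {p₁ : VV i c b} {q₁ : VV j k c} {p₂ : VV i d n} {q₂ : VV c l d} {p₃ : VV j e d} {q₃ : VV k l e}
    {p₄ : VV a o n} {q₄ : VV k l o} {p₅ : VV i c' n} {q₅ : VV j o c'}
    (h₁ : p₁.1 ≫ BB i ◁ q₁.1 = g.1 ≫ f.1 ▷ BB k ≫ (α_ (BB i) (BB j) (BB k)).hom)
    (h₂ : p₂.1 ≫ BB i ◁ q₂.1 = h.1 ≫ p₁.1 ▷ BB l ≫ (α_ (BB i) (BB c) (BB l)).hom)
    (h₃ : p₃.1 ≫ BB j ◁ q₃.1 = q₂.1 ≫ q₁.1 ▷ BB l ≫ (α_ (BB j) (BB k) (BB l)).hom)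
    (h₄ : p₄.1 ≫ BB a ◁ q₄.1 = h.1 ≫ g.1 ▷ BB l ≫ (α_ (BB a) (BB k) (BB l)).hom)
    (h₅ : p₅.1 ≫ BB i ◁ q₅.1 = p₄.1 ≫ f.1 ▷ BB o ≫ (α_ (BB i) (BB j) (BB o)).hom) :
    p₂.1 ≫ BB i ◁ (p₃.1 ≫ BB j ◁ q₃.1) = p₅.1 ≫ BB i ◁ (q₅.1 ≫ BB j ◁ q₄.1) := by
  have e₁ : p₂.1 ≫ BB i ◁ (p₃.1 ≫ BB j ◁ q₃.1) =
      h.1 ≫ (g.1 ≫ f.1 ▷ BB k ≫ (α_ (BB i) (BB j) (BB k)).hom) ▷ BB l ≫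
        (α_ (BB i) (BB j ⊗ BB k) (BB l)).hom ≫ BB i ◁ (α_ (BB j) (BB k) (BB l)).hom := by
    rw [h₃, ← h₁, MonoidalCategory.whiskerLeft_comp, reassoc_of% h₂]
    simp
  have e₂ : p₅.1 ≫ BB i ◁ (q₅.1 ≫ BB j ◁ q₄.1) =
      h.1 ≫ g.1 ▷ BB l ≫ (f.1 ▷ BB k) ▷ BB l ≫ (α_ (BB i ⊗ BB j) (BB k) (BB l)).hom ≫
        (α_ (BB i) (BB j) (BB k ⊗ BB l)).hom := by
    rw [MonoidalCategory.whiskerLeft_comp, reassoc_of% h₅, ← associator_naturality_right,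
      ← whisker_exchange_assoc, reassoc_of% h₄]
    simp
  rw [e₁, e₂]
  simp

theorem pentagon (W X Y Z : CrystalsQ) :
    tensMap (assocIso W X Y).hom (𝟙 Z) ≫ (assocIso W (tens X Y) Z).hom ≫
      tensMap (𝟙 W) (assocIso X Y Z).hom =
    (assocIso (tens W X) Y Z).hom ≫ (assocIso W X (tens Y Z)).hom := by
  refine tens_hom_ext fun b l n h s z => ?_
  induction s using tens_induction with
  | zero => simp only [map_zero, LinearMap.zero_apply]
  | add s t hs ht => simp only [map_add, LinearMap.add_apply, hs, ht]
  | incl a k g s y =>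
  induction s using tens_induction with
  | zero => simp only [map_zero, LinearMap.zero_apply]
  | add s t hs ht => simp only [map_add, LinearMap.add_apply, hs, ht]
  | incl i j f w x =>
    obtain ⟨c, p₁, q₁, h₁⟩ := exists_assoc f g
    obtain ⟨d, p₂, q₂, h₂⟩ := exists_assoc p₁ h
    obtain ⟨e, p₃, q₃, h₃⟩ := exists_assoc q₁ q₂
    obtain ⟨o, p₄, q₄, h₄⟩ := exists_assoc g h
    obtain ⟨c', p₅, q₅, h₅⟩ := exists_assoc f p₄
    rw [comp_app, comp_app, comp_app, tensMap_incl, assoc_incl h₁, id_app, assoc_incl h₂,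
      tensMap_incl, id_app, assoc_incl h₃, assoc_incl h₄, assoc_incl h₅]
    cases right_unique (pentagon_aux h₁ h₂ h₃ h₄ h₅)
    rfl

instance instMonoidalStruct : MonoidalCategoryStruct CrystalsQ where
  tensorObj := tens
  tensorHom S T := tensMap S T
  whiskerLeft X _ _ T := tensMap (𝟙 X) T
  whiskerRight S Y := tensMap S (𝟙 Y)
  tensorUnit := simple 0
  associator := assocIso
  leftUnitor := leftIso
  rightUnitor := rightIso

instance instMonoidal : MonoidalCategory CrystalsQ := MonoidalCategory.ofTensorHom
  (id_tensorHom_id := tensMap_id)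
  (id_tensorHom := fun _ _ _ _ => rfl)
  (tensorHom_id := fun _ _ => rfl)
  (tensorHom_comp_tensorHom := fun f₁ f₂ g₁ g₂ => tensMap_comp f₁ f₂ g₁ g₂)
  (associator_naturality := assoc_naturality)
  (leftUnitor_naturality := left_naturality)
  (rightUnitor_naturality := right_naturality)
  (pentagon := pentagon)
  (triangle := triangle)

end CrystalsQ

/-- The functor from crystals to `Crystals_ℚ`: the crystal `B ≅ ⨁ₙ 𝔹(n) ⊠ Vₙ`, where `Vₙ` is the
set of non-zero morphisms `𝔹(n) ⟶ B`, is sent to the family of the `Vₙ`. -/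
def Crystal.toQ : Crystal ⥤ CrystalsQ where
  obj B := ⟨fun n => Crystal.mult n B, Crystal.mult_finite B⟩
  map {A B} β := ⟨fun n => Finsupp.linearCombination ℚ fun α : Crystal.mult n A =>
    open Classical in if h : α.1 ≫ β = 0 then 0 else Finsupp.single ⟨α.1 ≫ β, h⟩ 1⟩
  map_id A := CrystalsQ.hom_ext_single fun n α => by
    refine (Finsupp.linearCombination_single ℚ _ _).trans ((one_smul _ _).trans ?_)
    refine (dif_neg (by rw [Category.comp_id]; exact α.2)).trans ?_
    refine congrArg (fun b : Crystal.mult n A => Finsupp.single b (1 : ℚ)) ?_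
    exact Subtype.ext (Category.comp_id _)
  map_comp {A B D} β γ := CrystalsQ.hom_ext_single fun n α => by
    refine (Finsupp.linearCombination_single ℚ _ _).trans ((one_smul _ _).trans ?_)
    refine Eq.symm ((congrArg (Finsupp.linearCombination ℚ _)
      ((Finsupp.linearCombination_single ℚ _ _).trans (one_smul _ _))).trans ?_)
    by_cases h : α.1 ≫ β = 0
    · have h' : α.1 ≫ β ≫ γ = 0 := by rw [← Category.assoc, h, zero_comp]
      rw [dif_pos h, dif_pos h', map_zero]
    · rw [dif_neg h]
      refine (Finsupp.linearCombination_single ℚ _ _).trans ((one_smul _ _).trans ?_)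
      have e : (α.1 ≫ β) ≫ γ = α.1 ≫ β ≫ γ := Category.assoc _ _ _
      by_cases h' : α.1 ≫ β ≫ γ = 0
      · rw [dif_pos h', dif_pos (e.trans h')]
      · rw [dif_neg h', dif_neg (by rw [e]; exact h')]
        exact congrArg (fun b : Crystal.mult n D => Finsupp.single b (1 : ℚ)) (Subtype.ext e)

/-! ### The graded category `𝒪` -/

/-- Finite dimensional graded vector spaces over `ℂ`. -/
structure VectZ where
  V : ℤ → Type
  [grp : ∀ i, AddCommGroup (V i)]
  [mod : ∀ i, Module ℂ (V i)]
  finite : ∀ i, Module.Finite ℂ (V i)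
  bounded : {i | Nontrivial (V i)}.Finite

namespace VectZ

attribute [instance] VectZ.grp VectZ.mod

/-- Linear maps of degree zero. -/
@[ext]
structure Hom (V W : VectZ) where
  app : ∀ i, V.V i →ₗ[ℂ] W.V i

instance instCat : Category VectZ where
  Hom := Hom
  id V := ⟨fun _ => LinearMap.id⟩
  comp f g := ⟨fun i => (g.app i).comp (f.app i)⟩

theorem hom_ext {V W : VectZ} {f g : V ⟶ W} (h : ∀ i v, f.app i v = g.app i v) : f = g :=
  Hom.ext (funext fun i => LinearMap.ext (h i))

theorem comp_app {V W U : VectZ} (f : V ⟶ W) (g : W ⟶ U) (i : ℤ) (v : V.V i) :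
    (f ≫ g).app i v = g.app i (f.app i v) := rfl

theorem id_app {V : VectZ} (i : ℤ) (v : V.V i) : Hom.app (𝟙 V) i v = v := rfl

/-- A morphism is a family of linear maps. -/
def homEquiv (V W : VectZ) : (V ⟶ W) ≃ (∀ i, V.V i →ₗ[ℂ] W.V i) where
  toFun f := f.app
  invFun f := ⟨f⟩

instance instHomGroup (V W : VectZ) : AddCommGroup (V ⟶ W) := (homEquiv V W).addCommGroup

theorem add_app {V W : VectZ} (f g : V ⟶ W) (i : ℤ) (v : V.V i) :
    (f + g).app i v = f.app i v + g.app i v := rfl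

theorem zero_app {V W : VectZ} (i : ℤ) (v : V.V i) : (0 : V ⟶ W).app i v = 0 := rfl

instance instPreadditive : Preadditive VectZ where
  add_comp _ _ _ f f' g := hom_ext fun i v => map_add (g.app i) (f.app i v) (f'.app i v)
  comp_add _ _ _ _ _ _ := rfl

/-- The shift `V ↦ V⟨n⟩`, where `V⟨n⟩ᵢ = V_{i-n}`. -/
def shift (n : ℤ) : VectZ ⥤ VectZ where
  obj V :=
    { V := fun i => V.V (i - n)
      finite := fun i => V.finite (i - n)
      bounded := V.bounded.preimage (f := fun i => i - n) (fun i _ j _ h => by simpa using h) }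
  map f := ⟨fun i => f.app (i - n)⟩

theorem shift_map_add (n : ℤ) {V W : VectZ} (f g : V ⟶ W) :
    (shift n).map (f + g) = (shift n).map f + (shift n).map g := rfl

theorem shift_map_zero (n : ℤ) (V W : VectZ) : (shift n).map (0 : V ⟶ W) = 0 := rfl

/-- The identification of the components of equal degree. -/
def cast (V : VectZ) {i j : ℤ} (h : i = j) : V.V i →ₗ[ℂ] V.V j := h ▸ LinearMap.id

theorem cast_app {V W : VectZ} (f : V ⟶ W) {i j : ℤ} (h : i = j) (v : V.V i) :
    f.app j (V.cast h v) = W.cast h (f.app i v) := by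
  subst h
  rfl

/-- The direct sum of graded vector spaces. -/
def sum (V W : VectZ) : VectZ where
  V i := V.V i × W.V i
  finite i := by
    have := V.finite i
    have := W.finite i
    infer_instance
  bounded := (V.bounded.union W.bounded).subset fun i hi => by
    by_contra h
    simp only [Set.mem_union, Set.mem_ofPred_eq, not_or, not_nontrivial_iff_subsingleton] at h hi
    have := h.1
    have := h.2
    exact not_subsingleton_iff_nontrivial.mpr hi inferInstance

/-- The direct sum of morphisms. -/
def sumMap {V W V' W' : VectZ} (f : V ⟶ V') (g : W ⟶ W') : sum V W ⟶ sum V' W' :=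
  ⟨fun i => (f.app i).prodMap (g.app i)⟩

end VectZ

/-- The objects of `𝒪₀`: tuples `(Ψ, Φ, var : Φ ⟶ Ψ⟨-1⟩, can : Ψ ⟶ Φ⟨-1⟩)` with
`var ∘ can = 0`. -/
structure OZero where
  Ψ : VectZ
  Φ : VectZ
  var : Φ ⟶ (VectZ.shift (-1)).obj Ψ
  can : Ψ ⟶ (VectZ.shift (-1)).obj Φ
  var_can : can ≫ (VectZ.shift (-1)).map var = 0

namespace OZero

open VectZ

/-- Morphisms of tuples. -/
@[ext]
structure Hom (X Y : OZero) where
  ψ : X.Ψ ⟶ Y.Ψ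
  φ : X.Φ ⟶ Y.Φ
  var : X.var ≫ (shift (-1)).map ψ = φ ≫ Y.var
  can : X.can ≫ (shift (-1)).map φ = ψ ≫ Y.can

instance instCat : Category OZero where
  Hom := Hom
  id X := ⟨𝟙 _, 𝟙 _, by simp, by simp⟩
  comp f g := ⟨f.ψ ≫ g.ψ, f.φ ≫ g.φ,
    by rw [Functor.map_comp, ← Category.assoc, f.var, Category.assoc, g.var, Category.assoc],
    by rw [Functor.map_comp, ← Category.assoc, f.can, Category.assoc, g.can, Category.assoc]⟩

theorem hom_ext {X Y : OZero} {f g : X ⟶ Y} (h : f.ψ = g.ψ) (h' : f.φ = g.φ) : f = g :=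
  Hom.ext h h'

/-- The group of pairs of maps commuting with the structure. -/
def homs (X Y : OZero) : AddSubgroup ((X.Ψ ⟶ Y.Ψ) × (X.Φ ⟶ Y.Φ)) where
  carrier := {p | X.var ≫ (shift (-1)).map p.1 = p.2 ≫ Y.var ∧
    X.can ≫ (shift (-1)).map p.2 = p.1 ≫ Y.can}
  zero_mem' := by
    constructor
    · exact (comp_zero (f := X.var)).trans (zero_comp (f := Y.var)).symm
    · exact (comp_zero (f := X.can)).trans (zero_comp (f := Y.can)).symm
  add_mem' := by
    rintro p q ⟨h1, h2⟩ ⟨h3, h4⟩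
    constructor
    · rw [Prod.fst_add, Prod.snd_add, shift_map_add, Preadditive.comp_add, h1, h3,
        Preadditive.add_comp]
    · rw [Prod.fst_add, Prod.snd_add, shift_map_add, Preadditive.comp_add, h2, h4,
        Preadditive.add_comp]
  neg_mem' := by
    rintro p ⟨h1, h2⟩
    constructor
    · exact (Preadditive.comp_neg _ _).trans ((congrArg Neg.neg h1).trans
        (Preadditive.neg_comp _ _).symm)
    · exact (Preadditive.comp_neg _ _).trans ((congrArg Neg.neg h2).trans
        (Preadditive.neg_comp _ _).symm)

/-- A morphism is a pair of maps commuting with the structure. -/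
def homEquiv (X Y : OZero) : (X ⟶ Y) ≃ homs X Y where
  toFun f := ⟨(f.ψ, f.φ), f.var, f.can⟩
  invFun p := ⟨p.1.1, p.1.2, p.2.1, p.2.2⟩

instance instHomGroup (X Y : OZero) : AddCommGroup (X ⟶ Y) := (homEquiv X Y).addCommGroup

theorem add_ψ {X Y : OZero} (f g : X ⟶ Y) : (f + g).ψ = f.ψ + g.ψ := rfl

theorem add_φ {X Y : OZero} (f g : X ⟶ Y) : (f + g).φ = f.φ + g.φ := rfl

instance instPreadditive : Preadditive OZero where
  add_comp _ _ _ f f' g := hom_ext (Preadditive.add_comp _ _ _ f.ψ f'.ψ g.ψ)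
    (Preadditive.add_comp _ _ _ f.φ f'.φ g.φ)
  comp_add _ _ _ f g g' := hom_ext (Preadditive.comp_add _ _ _ f.ψ g.ψ g'.ψ)
    (Preadditive.comp_add _ _ _ f.φ g.φ g'.φ)

/-- The zero tuples. -/
def IsTrivial (X : OZero) : Prop := (∀ i, Subsingleton (X.Ψ.V i)) ∧ ∀ i, Subsingleton (X.Φ.V i)

/-- The direct sum. -/
def sum (X Y : OZero) : OZero where
  Ψ := X.Ψ.sum Y.Ψ
  Φ := X.Φ.sum Y.Φ
  var := ⟨fun i => (X.var.app i).prodMap (Y.var.app i)⟩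
  can := ⟨fun i => (X.can.app i).prodMap (Y.can.app i)⟩
  var_can := VectZ.hom_ext fun i v => by
    have h1 := LinearMap.congr_fun (congrArg (fun f => VectZ.Hom.app f i) X.var_can) v.1
    have h2 := LinearMap.congr_fun (congrArg (fun f => VectZ.Hom.app f i) Y.var_can) v.2
    exact Prod.ext h1 h2

theorem IsTrivial.sum {X Y : OZero} (hX : X.IsTrivial) (hY : Y.IsTrivial) :
    (X.sum Y).IsTrivial := by
  constructor
  · intro i
    have := hX.1 i
    have := hY.1 i
    exact inferInstanceAs (Subsingleton (X.Ψ.V i × Y.Ψ.V i))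
  · intro i
    have := hX.2 i
    have := hY.2 i
    exact inferInstanceAs (Subsingleton (X.Φ.V i × Y.Φ.V i))

/-- The direct sum of morphisms. -/
def sumMap {X Y X' Y' : OZero} (f : X ⟶ X') (g : Y ⟶ Y') : X.sum Y ⟶ X'.sum Y' where
  ψ := VectZ.sumMap f.ψ g.ψ
  φ := VectZ.sumMap f.φ g.φ
  var := VectZ.hom_ext fun i v => by
    have h1 := LinearMap.congr_fun (congrArg (fun f => VectZ.Hom.app f i) f.var) v.1
    have h2 := LinearMap.congr_fun (congrArg (fun f => VectZ.Hom.app f i) g.var) v.2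
    exact Prod.ext h1 h2
  can := VectZ.hom_ext fun i v => by
    have h1 := LinearMap.congr_fun (congrArg (fun f => VectZ.Hom.app f i) f.can) v.1
    have h2 := LinearMap.congr_fun (congrArg (fun f => VectZ.Hom.app f i) g.can) v.2
    exact Prod.ext h1 h2

end OZero

/-- The functor `π^* V = (V⟨1⟩, V⟨2⟩ ⊕ V, (0 id), (id 0)ᵗ)`. -/
def piUpper : VectZ ⥤ OZero where
  obj V :=
    { Ψ := (VectZ.shift 1).obj V
      Φ := ((VectZ.shift 2).obj V).sum V
      var := ⟨fun i => (V.cast (show i = i - -1 - 1 by ring)).comp (LinearMap.snd ℂ _ _)⟩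
      can := ⟨fun i => (LinearMap.inl ℂ _ _).comp (V.cast (show i - 1 = i - -1 - 2 by ring))⟩
      var_can := VectZ.hom_ext fun i v => map_zero (V.cast (show i - -1 = i - -1 - -1 - 1 by ring)) }
  map {V W} f :=
    { ψ := (VectZ.shift 1).map f
      φ := VectZ.sumMap ((VectZ.shift 2).map f) f
      var := VectZ.hom_ext fun i v => VectZ.cast_app f (show i = i - -1 - 1 by ring) v.2
      can := VectZ.hom_ext fun i v => Prod.ext
        (VectZ.cast_app f (show i - 1 = i - -1 - 2 by ring) v) (map_zero (f.app (i - -1))) }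

/-- The functor `π_* (Ψ, Φ, var, can) = Φ`. -/
def piLower : OZero ⥤ VectZ where
  obj X := X.Φ
  map f := f.φ

/-- The category `𝒪^ℤ = Vect^ℤ ⊕ ⨁_{k ≥ 0} 𝒪₀^ℤ`: the component `sing` is the block `-1`, and
`reg k` is the block `k`; only finitely many components are non-zero. -/
structure OZ where
  sing : VectZ
  reg : ℕ → OZero
  finite : {k | ¬ (reg k).IsTrivial}.Finite

namespace OZ

/-- Morphisms of `𝒪^ℤ`. -/
@[ext]
structure Hom (X Y : OZ) where
  sing : X.sing ⟶ Y.sing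
  reg : ∀ k, X.reg k ⟶ Y.reg k

instance instCat : Category OZ where
  Hom := Hom
  id X := ⟨𝟙 _, fun _ => 𝟙 _⟩
  comp f g := ⟨f.sing ≫ g.sing, fun k => f.reg k ≫ g.reg k⟩

theorem hom_ext {X Y : OZ} {f g : X ⟶ Y} (h : f.sing = g.sing) (h' : ∀ k, f.reg k = g.reg k) :
    f = g :=
  Hom.ext h (funext h')

/-- A morphism is a family of morphisms of the components. -/
def homEquiv (X Y : OZ) : (X ⟶ Y) ≃ (X.sing ⟶ Y.sing) × (∀ k, X.reg k ⟶ Y.reg k) where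
  toFun f := (f.sing, f.reg)
  invFun p := ⟨p.1, p.2⟩

instance instHomGroup (X Y : OZ) : AddCommGroup (X ⟶ Y) := (homEquiv X Y).addCommGroup

theorem add_sing {X Y : OZ} (f g : X ⟶ Y) : (f + g).sing = f.sing + g.sing := rfl

theorem add_reg {X Y : OZ} (f g : X ⟶ Y) (k : ℕ) : (f + g).reg k = f.reg k + g.reg k := rfl

instance instPreadditive : Preadditive OZ where
  add_comp _ _ _ f f' g := hom_ext (Preadditive.add_comp _ _ _ f.sing f'.sing g.sing)
    fun k => Preadditive.add_comp _ _ _ (f.reg k) (f'.reg k) (g.reg k)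
  comp_add _ _ _ f g g' := hom_ext (Preadditive.comp_add _ _ _ f.sing g.sing g'.sing)
    fun k => Preadditive.comp_add _ _ _ (f.reg k) (g.reg k) (g'.reg k)

/-- The blocks `k ≥ 0` of `F(X)`. -/
def fReg (X : OZ) : ℕ → OZero
  | 0 => (piUpper.obj X.sing).sum (X.reg 1)
  | k + 1 => (X.reg k).sum (X.reg (k + 2))

/-- The action of `F` on morphisms in the blocks `k ≥ 0`. -/
def fRegMap {X Y : OZ} (f : X ⟶ Y) : ∀ k, fReg X k ⟶ fReg Y k
  | 0 => OZero.sumMap (piUpper.map f.sing) (f.reg 1)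
  | k + 1 => OZero.sumMap (f.reg k) (f.reg (k + 2))

/-- The functor `F`: it sends `V` to
`i₀ π^* pr₋₁ V ⊕ i₋₁ π_* pr₀ V ⊕ i₁ pr₀ V ⊕ ⨁_{k ≥ 1} (i_{k-1} pr_k V ⊕ i_{k+1} pr_k V)`. Thus the
block `-1` of `F(V)` is `π_* pr₀ V`, the block `0` is `π^* pr₋₁ V ⊕ pr₁ V`, and the block `k ≥ 1` is
`pr_{k-1} V ⊕ pr_{k+1} V`. -/
def F : OZ ⥤ OZ where
  obj X :=
    { sing := piLower.obj (X.reg 0)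
      reg := fReg X
      finite := by
        refine (((X.finite.image (fun k => k + 1)).union (X.finite.image (fun k => k - 1))).union
          (Set.finite_singleton 0)).subset ?_
        intro k hk
        cases k with
        | zero => exact Or.inr rfl
        | succ k =>
          refine Or.inl ?_
          by_cases h : (X.reg k).IsTrivial
          · by_cases h' : (X.reg (k + 2)).IsTrivial
            · exact absurd (OZero.IsTrivial.sum h h') hk
            · exact Or.inr ⟨k + 2, h', rfl⟩
          · exact Or.inl ⟨k, h, rfl⟩ }
  map f := ⟨piLower.map (f.reg 0), fRegMap f⟩
  map_id X := hom_ext rfl fun k => by cases k <;> rfl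
  map_comp f g := hom_ext rfl fun k => by cases k <;> rfl

end OZ

/-- The category of endofunctors of `𝒪^ℤ` with the tensor product `G ⊗ H = G ∘ H`. (The monoidal
structure on endofunctors in the library is given by composition in the opposite order.) -/
abbrev EndOZ := (OZ ⥤ OZ)ᴹᵒᵖ

end

noncomputable section

/-! ### The universal property of `CPrime` -/

/-! Both functors out of `𝒞` come from one universal property. Since `CPrime` is free, a
`CPrime.Datum` in a monoidal category `V` with zero morphisms (an object with `cup` and `cap`, loop
equal to the identity, both zigzags zero) defines a zero-preserving monoidal functor. If `V` is
moreover `ℚ`-linear, additive, idempotent complete and has a bilinear tensor product, this functor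
extends to `𝒞`: linearly to `QLin`, and then by sending `(M, p)` to the image of the idempotent
matrix `F(p)` on the sum of the `F(Mᵢ)` (`Splitting`, `Extension`).

Two data are needed. For crystals, `𝔹(1) ⊗ 𝔹(1) = 𝔹(2) ⊔ 𝔹(0)`, the copy of `𝔹(0)` being `v₋₁ ⊗ v₁`.
On `𝒪^ℤ`, the functor `F` moves between neighbouring blocks, so `F²` is indexed by paths of two
steps; the paths "up, then down" yield the identity as a direct summand (in block `-1` it is the
summand `V` of `π_* π^* V = V⟨2⟩ ⊕ V`). In both cases the zigzags vanish because the middle one of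
three factors would have to play both roles at once. The second datum lives in the category `AddEnd
OZ` of additive endofunctors, where the tensor product is bilinear.

The equivalence is obtained from a degenerate Temperley–Lieb calculus, valid for any datum in an
idempotent complete category. There are objects `S 0 = 𝟙`, `S 1 = F` with `S (n + 1) ⊗ F ≅ S n ⊕ S
(n + 2)`; the recursion needs no denominators (`Step`). Iterating, `S n ⊗ X` decomposes into objects
`S k` for every word `X` in `F`, and a morphism built from `cup` and `cap` has scalar entries:
multiples of the identity for equal indices, zero otherwise (`Dec.scal_preMap`). In `𝒞` such
morphisms span all morphisms between words, hence `Hom(S k, S l)` consists of scalars.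

This is an upper bound for the morphisms of `𝒞`. The lower bound comes from the functor `E` to
`Crystals_ℚ`: comparison with `𝔹(n + 1) ⊗ 𝔹(1) ≅ 𝔹(n) ⊔ 𝔹(n + 2)` gives `E (S n) ≅ 𝔹(n)`
(`CatC.dim_S`), whose identity is non-zero. As every object of `𝒞` is a retract of a finite sum of
objects `S k`, the functor `E` is fully faithful. It is essentially surjective because objects of
`Crystals_ℚ` are classified by their multiplicities. The action of `Crystals_ℚ` is then the action
of `𝒞` composed with the inverse of `E`, and that of crystals is obtained from the monoidal functor
`Crystal.toQ`. -/

theorem MonoidalPreadditive.toZeroTensor (V : Type*) [Category V] [Preadditive V]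
    [MonoidalCategory V] [MonoidalPreadditive V] : ZeroTensor V where
  zero_tensor := MonoidalPreadditive.zero_tensor
  tensor_zero := MonoidalPreadditive.tensor_zero

namespace CPrime

/-- The data in a monoidal category with zero morphisms needed to define a functor from
`CPrime`. -/
structure Datum (V : Type*) [Category V] [MonoidalCategory V] [HasZeroMorphisms V] where
  F : V
  zero : V
  id_zero : 𝟙 zero = 0
  cup : 𝟙_ V ⟶ F ⊗ F
  cap : F ⊗ F ⟶ 𝟙_ V
  cup_cap : cup ≫ cap = 𝟙 _
  zigzag_left : (λ_ F).inv ≫ cup ▷ F ≫ (α_ F F F).hom ≫ F ◁ cap ≫ (ρ_ F).hom = 0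
  zigzag_right : (ρ_ F).inv ≫ F ◁ cup ≫ (α_ F F F).inv ≫ cap ▷ F ≫ (λ_ F).hom = 0

namespace Datum

variable {V : Type*} [Category V] [MonoidalCategory V] [HasZeroMorphisms V] (d : Datum V)

/-- The functor from `CPrime` on objects. -/
def obj : CPrime → V
  | .F => d.F
  | .zero => d.zero
  | .unit => 𝟙_ V
  | .tensor X Y => obj X ⊗ obj Y

/-- The value of the functor from `CPrime` on formal morphisms. -/
def preMap : ∀ {X Y : CPrime}, Pre X Y → (d.obj X ⟶ d.obj Y)
  | _, _, .cup => d.cup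
  | _, _, .cap => d.cap
  | _, _, .zeroHom _ _ => 0
  | _, _, .id _ => 𝟙 _
  | _, _, .comp f g => preMap f ≫ preMap g
  | _, _, .tensorHom f g => preMap f ⊗ₘ preMap g
  | _, _, .assocHom X Y Z => (α_ (d.obj X) (d.obj Y) (d.obj Z)).hom
  | _, _, .assocInv X Y Z => (α_ (d.obj X) (d.obj Y) (d.obj Z)).inv
  | _, _, .leftHom X => (λ_ (d.obj X)).hom
  | _, _, .leftInv X => (λ_ (d.obj X)).inv
  | _, _, .rightHom X => (ρ_ (d.obj X)).hom
  | _, _, .rightInv X => (ρ_ (d.obj X)).inv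

variable [ZeroTensor V]

/-- The universal property of `CPrime` rests on this. Each generating relation is an axiom of
monoidal categories, the compatibility of `⊗` with zero morphisms, or an equation recorded in the
datum. -/
theorem preMap_eq {X Y : CPrime} {f g : Pre X Y} (h : Rel f g) : d.preMap f = d.preMap g := by
  induction h with
  | refl => rfl
  | symm _ ih => exact ih.symm
  | trans _ _ ih ih' => exact ih.trans ih'
  | comp _ _ ih ih' => exact congrArg₂ (· ≫ ·) ih ih'
  | tensorHom _ _ ih ih' => exact congrArg₂ (· ⊗ₘ ·) ih ih'
  | id_comp f => exact Category.id_comp _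
  | comp_id f => exact Category.comp_id _
  | assoc f g h => exact Category.assoc _ _ _
  | tensor_id X Y => exact MonoidalCategory.id_tensorHom_id _ _
  | tensor_comp f₁ f₂ g₁ g₂ => exact MonoidalCategory.tensorHom_comp_tensorHom _ _ _ _
  | assoc_hom_inv X Y Z => exact Iso.hom_inv_id _
  | assoc_inv_hom X Y Z => exact Iso.inv_hom_id _
  | assoc_nat f₁ f₂ f₃ => exact MonoidalCategory.associator_naturality _ _ _
  | left_hom_inv X => exact Iso.hom_inv_id _
  | left_inv_hom X => exact Iso.inv_hom_id _
  | left_nat f =>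
    simp only [preMap, obj, MonoidalCategory.id_tensorHom, leftUnitor_naturality]
  | right_hom_inv X => exact Iso.hom_inv_id _
  | right_inv_hom X => exact Iso.inv_hom_id _
  | right_nat f =>
    simp only [preMap, obj, MonoidalCategory.tensorHom_id, rightUnitor_naturality]
  | pentagon W X Y Z =>
    simp only [preMap, obj, MonoidalCategory.tensorHom_id, MonoidalCategory.id_tensorHom,
      MonoidalCategory.pentagon]
  | triangle X Y =>
    simp only [preMap, obj, MonoidalCategory.tensorHom_id, MonoidalCategory.id_tensorHom,
      MonoidalCategory.triangle]
  | zero_comp f => exact Limits.zero_comp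
  | comp_zero f => exact Limits.comp_zero
  | zero_tensor f => exact ZeroTensor.zero_tensor _
  | tensor_zero f => exact ZeroTensor.tensor_zero _
  | id_zero => exact d.id_zero
  | cup_cap => exact d.cup_cap
  | zigzag_left =>
    -- The datum states the zigzags with whiskerings, the congruence with tensor products by
    -- identity morphisms.
    have h := d.zigzag_left
    rw [← MonoidalCategory.tensorHom_id, ← MonoidalCategory.id_tensorHom] at h
    exact h
  | zigzag_right =>
    have h := d.zigzag_right
    rw [← MonoidalCategory.tensorHom_id, ← MonoidalCategory.id_tensorHom] at h
    exact h

/-- The functor from `CPrime`. -/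
def lift : CPrime ⥤ V where
  obj := d.obj
  map := Quotient.lift d.preMap fun _ _ => d.preMap_eq
  map_comp := by rintro X Y Z ⟨f⟩ ⟨g⟩; rfl

/-- The functor is strictly monoidal: `d.obj` commutes with units and tensor products by definition,
so all constraints are identities. -/
instance liftMonoidal : d.lift.Monoidal := Functor.CoreMonoidal.toMonoidal
  { εIso := Iso.refl _
    μIso := fun X Y => Iso.refl (d.obj X ⊗ d.obj Y)
    μIso_hom_natural_left := by
      rintro X Y ⟨f⟩ X'
      refine (Category.comp_id _).trans (Eq.trans ?_ (Category.id_comp _).symm)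
      exact (MonoidalCategory.tensorHom_id _ _).symm
    μIso_hom_natural_right := by
      rintro X Y X' ⟨f⟩
      refine (Category.comp_id _).trans (Eq.trans ?_ (Category.id_comp _).symm)
      exact (MonoidalCategory.id_tensorHom _ _).symm
    associativity := fun X Y Z => by
      change 𝟙 (d.obj X ⊗ d.obj Y) ▷ d.obj Z ≫ 𝟙 ((d.obj X ⊗ d.obj Y) ⊗ d.obj Z) ≫
        (α_ (d.obj X) (d.obj Y) (d.obj Z)).hom = (α_ (d.obj X) (d.obj Y) (d.obj Z)).hom ≫
          d.obj X ◁ 𝟙 (d.obj Y ⊗ d.obj Z) ≫ 𝟙 (d.obj X ⊗ (d.obj Y ⊗ d.obj Z))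
      simp
    left_unitality := fun X => by
      change (λ_ (d.obj X)).hom = 𝟙 (𝟙_ V) ▷ d.obj X ≫ 𝟙 (𝟙_ V ⊗ d.obj X) ≫ (λ_ (d.obj X)).hom
      simp
    right_unitality := fun X => by
      change (ρ_ (d.obj X)).hom = d.obj X ◁ 𝟙 (𝟙_ V) ≫ 𝟙 (d.obj X ⊗ 𝟙_ V) ≫ (ρ_ (d.obj X)).hom
      simp }

instance lift_preservesZeroMorphisms : d.lift.PreservesZeroMorphisms where
  map_zero _ _ := rfl

end Datum

end CPrime

/-! ### Extension of a functor to the linearization -/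

namespace QLin

open RedSpan

theorem hom_zero {C : Type*} [Category C] [HasZeroMorphisms C] {X Y : C} :
    hom (0 : X ⟶ Y) = 0 := RedSpan.δ_zero

variable {C V : Type*} [Category C] [HasZeroMorphisms C] [Category V] [Preadditive V] [Linear ℚ V]
  (G : C ⥤ V) [G.PreservesZeroMorphisms]

/-- The linear extension of a functor to morphisms of the linearization. -/
def extMap (X Y : QLin C) : (X ⟶ Y) →ₗ[ℚ] (G.obj X.as ⟶ G.obj Y.as) :=
  Finsupp.linearCombination ℚ fun a : {a : X.as ⟶ Y.as // a ≠ 0} => G.map a.1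

/-- The zero morphism is not a basis vector of the reduced span and has to be treated apart; this is
where preservation of zero morphisms enters. -/
theorem extMap_hom {X Y : C} (f : X ⟶ Y) : extMap G ⟨X⟩ ⟨Y⟩ (hom f) = G.map f := by
  by_cases h : f = 0
  · rw [h, hom_zero, map_zero, G.map_zero]
  · have h' : hom f = Finsupp.single (⟨f, h⟩ : {a : X ⟶ Y // a ≠ 0}) 1 := δ_ne ⟨f, h⟩
    rw [h']
    exact (Finsupp.linearCombination_single ℚ _ _).trans (one_smul _ _)

/-- The linear extension of a functor. -/
def ext : QLin C ⥤ V where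
  obj X := G.obj X.as
  map f := extMap G _ _ f
  map_id X := (extMap_hom G (𝟙 X.as)).trans (G.map_id _)
  map_comp {X Y Z} f g := by
    induction f using ind with
    | hadd x y hx hy => simp only [map_add, Preadditive.add_comp, hx, hy]
    | hs c x hx => simp only [map_smul, Linear.smul_comp, hx]
    | h0 f =>
    induction g using ind with
    | hadd x y hx hy => simp only [map_add, Preadditive.comp_add, hx, hy]
    | hs c x hx => simp only [map_smul, Linear.comp_smul, hx]
    | h0 g =>
    rw [hom_comp]
    exact (extMap_hom G _).trans ((G.map_comp _ _).trans
      (congrArg₂ (· ≫ ·) (extMap_hom G f) (extMap_hom G g)).symm)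

theorem ext_map_hom {X Y : C} (f : X ⟶ Y) : (ext G).map (hom f) = G.map f := extMap_hom G f

instance ext_additive : (ext G).Additive where
  map_add {X Y} f g := map_add (extMap G X Y) f g

instance ext_linear : (ext G).Linear ℚ where
  map_smul {X Y} f c := map_smul (extMap G X Y) c f

variable [MonoidalCategory C] [ZeroTensor C] [MonoidalCategory V] [MonoidalPreadditive V]
  [G.Monoidal]

theorem smul_whiskerRight {V : Type*} [Category V] [Preadditive V] [Linear ℚ V]
    [MonoidalCategory V] [MonoidalPreadditive V] {X Y : V} (c : ℚ) (f : X ⟶ Y) (Z : V) :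
    (c • f) ▷ Z = c • f ▷ Z :=
  (tensorRight Z).map_smul c f

theorem whiskerLeft_smul {V : Type*} [Category V] [Preadditive V] [Linear ℚ V]
    [MonoidalCategory V] [MonoidalPreadditive V] {X Y : V} (c : ℚ) (f : X ⟶ Y) (Z : V) :
    Z ◁ (c • f) = c • Z ◁ f :=
  (tensorLeft Z).map_smul c f

theorem hom_whiskerRight {X Y : C} (f : X ⟶ Y) (Z : C) :
    hom f ▷ (⟨Z⟩ : QLin C) = hom (f ▷ Z) :=
  (tens_hom f (𝟙 Z)).trans (congrArg hom (MonoidalCategory.tensorHom_id _ _))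

theorem hom_whiskerLeft {X Y : C} (f : X ⟶ Y) (Z : C) :
    (⟨Z⟩ : QLin C) ◁ hom f = hom (Z ◁ f) :=
  (tens_hom (𝟙 Z) f).trans (congrArg hom (MonoidalCategory.id_tensorHom _ _))

/-- The tensorator of the linear extension. -/
def extμIso (X Y : QLin C) : (ext G).obj X ⊗ (ext G).obj Y ≅ (ext G).obj (X ⊗ Y) :=
  Functor.Monoidal.μIso G X.as Y.as

/-- The constraints are those of `G`, the objects being the same. Naturality in a morphism is linear
in it and is checked on morphisms of `C`; the coherence diagrams contain only morphisms of `C` and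
hold for `G`. -/
instance extMonoidal : (ext G).Monoidal := Functor.CoreMonoidal.toMonoidal
  { εIso := Functor.Monoidal.εIso G
    μIso := extμIso G
    μIso_hom_natural_left := by
      intro X Y f X'
      induction f using ind with
      | hadd x y hx hy =>
        simp only [Functor.map_add, MonoidalPreadditive.add_whiskerRight, Preadditive.add_comp,
          Preadditive.comp_add, hx, hy]
      | hs c x hx =>
        simp only [Functor.map_smul, smul_whiskerRight, Linear.smul_comp, Linear.comp_smul, hx]
      | h0 f =>
      refine Eq.trans ?_ (congrArg (Functor.LaxMonoidal.μ G X.as X'.as ≫ ·)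
        ((congrArg (ext G).map (hom_whiskerRight f X'.as)).trans (ext_map_hom G _))).symm
      refine (congrArg (fun t => t ▷ G.obj X'.as ≫ _) (ext_map_hom G f)).trans ?_
      exact Functor.LaxMonoidal.μ_natural_left G f X'.as
    μIso_hom_natural_right := by
      intro X Y X' f
      induction f using ind with
      | hadd x y hx hy =>
        simp only [Functor.map_add, MonoidalPreadditive.whiskerLeft_add, Preadditive.add_comp,
          Preadditive.comp_add, hx, hy]
      | hs c x hx =>
        simp only [Functor.map_smul, whiskerLeft_smul, Linear.smul_comp, Linear.comp_smul, hx]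
      | h0 f =>
      refine Eq.trans ?_ (congrArg (Functor.LaxMonoidal.μ G X'.as X.as ≫ ·)
        ((congrArg (ext G).map (hom_whiskerLeft f X'.as)).trans (ext_map_hom G _))).symm
      refine (congrArg (fun t => G.obj X'.as ◁ t ≫ _) (ext_map_hom G f)).trans ?_
      exact Functor.LaxMonoidal.μ_natural_right G X'.as f
    associativity := fun X Y Z =>
      (congrArg (fun t => Functor.LaxMonoidal.μ G X.as Y.as ▷ G.obj Z.as ≫
        Functor.LaxMonoidal.μ G (X.as ⊗ Y.as) Z.as ≫ t) (ext_map_hom G _)).trans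
        (Functor.LaxMonoidal.associativity (F := G) X.as Y.as Z.as)
    left_unitality := fun X => (Functor.LaxMonoidal.left_unitality (F := G) X.as).trans
      (congrArg (fun t => Functor.LaxMonoidal.ε G ▷ G.obj X.as ≫
        Functor.LaxMonoidal.μ G (𝟙_ C) X.as ≫ t) (ext_map_hom G _).symm)
    right_unitality := fun X => (Functor.LaxMonoidal.right_unitality (F := G) X.as).trans
      (congrArg (fun t => G.obj X.as ◁ Functor.LaxMonoidal.ε G ≫
        Functor.LaxMonoidal.μ G X.as (𝟙_ C) ≫ t) (ext_map_hom G _).symm) }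

end QLin

/-! ### Extension of an additive functor to the Karoubi envelope of the additive completion -/

section KaroubiMat

open Idempotents

variable {C V : Type*} [Category C] [Preadditive C] [Category V] [Preadditive V]

/-- A value of the extension of `F` at an object of the Karoubi envelope of the additive
completion. -/
structure Splitting (F : C ⥤ V) (M : Karoubi (Mat_ C)) where
  pt : V
  ι : ∀ i : M.X.ι, F.obj (M.X.X i) ⟶ pt
  π : ∀ i : M.X.ι, pt ⟶ F.obj (M.X.X i)
  total : ∑ i, π i ≫ ι i = 𝟙 pt
  ι_π : ∀ i j, ι i ≫ π j = F.map (M.p i j)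

namespace Splitting

variable {F : C ⥤ V}

/-- The value at `(M, p)` has to be the image of `p`. By additivity the matrix `F(pᵢⱼ)` is an
idempotent of the biproduct of the `F(Mᵢ)`; a splitting of it provides `pt`, and `ι`, `π` are the
components of its projection and its inclusion. -/
theorem nonempty [F.Additive] [HasFiniteBiproducts V] [IsIdempotentComplete V]
    (M : Karoubi (Mat_ C)) : Nonempty (Splitting F M) := by
  classical
  let e : (⨁ fun i => F.obj (M.X.X i)) ⟶ ⨁ fun i => F.obj (M.X.X i) :=
    biproduct.matrix fun i j => F.map (M.p i j)
  have he : e ≫ e = e := by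
    refine biproduct.hom_ext' _ _ fun i => biproduct.hom_ext _ _ fun k => ?_
    have h := congrFun (congrFun M.idem i) k
    rw [Mat_.comp_apply] at h
    have h' := congrArg F.map h
    rw [F.map_sum] at h'
    simp only [e, Category.assoc, biproduct.matrix_π, biproduct.ι_matrix_assoc]
    rw [biproduct.lift_desc, biproduct.ι_desc]
    simpa using h'
  obtain ⟨Y, s, r, hsr, hrs⟩ := IsIdempotentComplete.idempotents_split _ e he
  refine ⟨⟨Y, fun i => biproduct.ι (fun i => F.obj (M.X.X i)) i ≫ r,
    fun i => s ≫ biproduct.π (fun i => F.obj (M.X.X i)) i, ?_, ?_⟩⟩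
  · have h : ∀ i, (s ≫ biproduct.π (fun i => F.obj (M.X.X i)) i) ≫
        biproduct.ι (fun i => F.obj (M.X.X i)) i ≫ r =
        s ≫ (biproduct.π (fun i => F.obj (M.X.X i)) i ≫
          biproduct.ι (fun i => F.obj (M.X.X i)) i) ≫ r := by
      intro i
      simp only [Category.assoc]
    rw [Finset.sum_congr rfl fun i _ => h i, ← Preadditive.comp_sum, ← Preadditive.sum_comp,
      biproduct.total, Category.id_comp, hsr]
  · intro i j
    rw [Category.assoc, reassoc_of% hrs]
    simp [e]

variable {M : Karoubi (Mat_ C)} (S : Splitting F M)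

/-- By `total` the `ι i` are jointly epimorphic, so identities between morphisms out of `pt` can be
checked entrywise. -/
theorem hom_ext {W : V} {f g : S.pt ⟶ W} (h : ∀ i, S.ι i ≫ f = S.ι i ≫ g) : f = g := by
  rw [← Category.id_comp f, ← Category.id_comp g, ← S.total, Preadditive.sum_comp,
    Preadditive.sum_comp]
  exact Finset.sum_congr rfl fun i _ => by rw [Category.assoc, Category.assoc, h]

theorem sum_p_ι (i : M.X.ι) : ∑ j, F.map (M.p i j) ≫ S.ι j = S.ι i := by
  calc ∑ j, F.map (M.p i j) ≫ S.ι j = ∑ j, S.ι i ≫ S.π j ≫ S.ι j :=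
        Finset.sum_congr rfl fun j _ => by rw [← S.ι_π, Category.assoc]
    _ = S.ι i := by rw [← Preadditive.comp_sum, S.total, Category.comp_id]

end Splitting

variable {F : C ⥤ V} [F.Additive] (S : ∀ M, Splitting F M)

namespace Splitting

/-- The extension on morphisms. -/
def extMap {M N : Karoubi (Mat_ C)} (f : M ⟶ N) : (S M).pt ⟶ (S N).pt :=
  ∑ i, ∑ j, (S M).π i ≫ F.map (f.f i j) ≫ (S N).ι j

/-- The idempotent produced by `ι ≫ π` is absorbed by `f`, since `p ≫ f = f` in the Karoubi
envelope. The formula characterizes `extMap`, and functoriality follows from it. -/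
theorem ι_extMap {M N : Karoubi (Mat_ C)} (f : M ⟶ N) (i : M.X.ι) :
    (S M).ι i ≫ extMap S f = ∑ j, F.map (f.f i j) ≫ (S N).ι j := by
  rw [extMap, Preadditive.comp_sum]
  simp only [Preadditive.comp_sum, reassoc_of% (S M).ι_π]
  rw [Finset.sum_comm]
  refine Finset.sum_congr rfl fun j _ => ?_
  have h := congrFun (congrFun (Karoubi.p_comp f) i) j
  rw [Mat_.comp_apply] at h
  rw [← h, F.map_sum, Preadditive.sum_comp]
  exact Finset.sum_congr rfl fun k _ => by rw [F.map_comp, Category.assoc]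

/-- The extension of an additive functor. -/
def ext : Karoubi (Mat_ C) ⥤ V where
  obj M := (S M).pt
  map f := extMap S f
  map_id M := (S M).hom_ext fun i => by
    rw [ι_extMap, Category.comp_id]
    -- The identity of `M` in the Karoubi envelope has underlying matrix `M.p`.
    exact (S M).sum_p_ι i
  map_comp {M N K} f g := (S M).hom_ext fun i => by
    rw [ι_extMap, ← Category.assoc, ι_extMap, Preadditive.sum_comp]
    simp only [Category.assoc, ι_extMap, Preadditive.comp_sum]
    rw [Finset.sum_comm]
    refine Finset.sum_congr rfl fun j _ => ?_
    rw [Karoubi.comp_f, Mat_.comp_apply, F.map_sum, Preadditive.sum_comp]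
    exact Finset.sum_congr rfl fun k _ => by rw [F.map_comp, Category.assoc]

end Splitting

/-- The data exhibiting a functor `E` as the extension of `F` to the Karoubi envelope of the
additive completion. -/
structure Extension (F : C ⥤ V) (E : Karoubi (Mat_ C) ⥤ V) where
  ι : ∀ (M : Karoubi (Mat_ C)) (i : M.X.ι), F.obj (M.X.X i) ⟶ E.obj M
  π : ∀ (M : Karoubi (Mat_ C)) (i : M.X.ι), E.obj M ⟶ F.obj (M.X.X i)
  total : ∀ M, ∑ i, π M i ≫ ι M i = 𝟙 (E.obj M)
  ι_π : ∀ M i j, ι M i ≫ π M j = F.map (M.p i j)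
  ι_map : ∀ {M N : Karoubi (Mat_ C)} (f : M ⟶ N) (i : M.X.ι),
    ι M i ≫ E.map f = ∑ j, F.map (f.f i j) ≫ ι N j

/-- The extension given by a choice of splittings. -/
def Splitting.extension : Extension F (Splitting.ext S) where
  ι M := (S M).ι
  π M := (S M).π
  total M := (S M).total
  ι_π M := (S M).ι_π
  ι_map f i := ι_extMap S f i

namespace Extension

variable {E : Karoubi (Mat_ C) ⥤ V} (D : Extension F E)

theorem hom_ext {M : Karoubi (Mat_ C)} {W : V} {f g : E.obj M ⟶ W}
    (h : ∀ i, D.ι M i ≫ f = D.ι M i ≫ g) : f = g := by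
  rw [← Category.id_comp f, ← Category.id_comp g, ← D.total, Preadditive.sum_comp,
    Preadditive.sum_comp]
  exact Finset.sum_congr rfl fun i _ => by rw [Category.assoc, Category.assoc, h]

theorem additive (D : Extension F E) : E.Additive where
  map_add {M N} f g := D.hom_ext fun i => by
    rw [Preadditive.comp_add, D.ι_map, D.ι_map, D.ι_map, ← Finset.sum_add_distrib]
    refine Finset.sum_congr rfl fun j _ => ?_
    rw [← Preadditive.add_comp, ← F.map_add]
    rfl

theorem sum_p_ι {M : Karoubi (Mat_ C)} (i : M.X.ι) :
    ∑ j, F.map (M.p i j) ≫ D.ι M j = D.ι M i := by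
  have h := D.ι_map (𝟙 M) i
  rw [E.map_id, Category.comp_id] at h
  exact h.symm

/-- The associator and the unitors of the Karoubi envelope are monomial matrices multiplied by an
idempotent. The idempotent disappears against `ι`, so on components they act through the constraints
of `C`. -/
theorem ι_map_mono {M N : Karoubi (Mat_ C)} (f : M ⟶ N) (e : M.X.ι → N.X.ι)
    (t : ∀ i, M.X.X i ⟶ N.X.X (e i)) (h : f.f = Mat_.mono e t ≫ N.p) (i : M.X.ι) :
    D.ι M i ≫ E.map f = F.map (t i) ≫ D.ι N (e i) := by
  rw [D.ι_map, h, ← D.sum_p_ι (e i), Preadditive.comp_sum]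
  refine Finset.sum_congr rfl fun j _ => ?_
  rw [Mat_.mono_comp_apply, F.map_comp, Category.assoc]

/-! ### Monoidal structure on the extension of a monoidal functor -/

section Monoidal

open Functor.LaxMonoidal Functor.OplaxMonoidal

variable [MonoidalCategory V] [MonoidalPreadditive V]

/-- Insert `∑ π ≫ ι = 𝟙` in both factors and expand by bilinearity of the tensor product. -/
theorem eq_sum_tensor {M N : Karoubi (Mat_ C)} {W : V} (k : E.obj M ⊗ E.obj N ⟶ W) :
    k = ∑ i, ∑ j, (D.π M i ⊗ₘ D.π N j) ≫ (D.ι M i ⊗ₘ D.ι N j) ≫ k := by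
  conv_lhs => rw [← Category.id_comp k, ← MonoidalCategory.id_tensorHom_id, ← D.total,
    ← D.total, sum_tensor, Preadditive.sum_comp]
  refine Finset.sum_congr rfl fun i _ => ?_
  rw [tensor_sum, Preadditive.sum_comp]
  refine Finset.sum_congr rfl fun j _ => ?_
  rw [← MonoidalCategory.tensorHom_comp_tensorHom, Category.assoc]

theorem tensor_hom_ext {M N : Karoubi (Mat_ C)} {W : V} {f g : E.obj M ⊗ E.obj N ⟶ W}
    (h : ∀ i j, (D.ι M i ⊗ₘ D.ι N j) ≫ f = (D.ι M i ⊗ₘ D.ι N j) ≫ g) : f = g := by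
  rw [D.eq_sum_tensor f, D.eq_sum_tensor g]
  simp only [h]

theorem tensor₃_hom_ext {M N K : Karoubi (Mat_ C)} {W : V}
    {f g : (E.obj M ⊗ E.obj N) ⊗ E.obj K ⟶ W}
    (h : ∀ i j k, ((D.ι M i ⊗ₘ D.ι N j) ⊗ₘ D.ι K k) ≫ f =
      ((D.ι M i ⊗ₘ D.ι N j) ⊗ₘ D.ι K k) ≫ g) : f = g := by
  have key : ∀ t : (E.obj M ⊗ E.obj N) ⊗ E.obj K ⟶ W, t = ∑ k, ∑ i, ∑ j,
      ((D.π M i ⊗ₘ D.π N j) ⊗ₘ D.π K k) ≫ ((D.ι M i ⊗ₘ D.ι N j) ⊗ₘ D.ι K k) ≫ t := by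
    intro t
    conv_lhs => rw [← Category.id_comp t, ← MonoidalCategory.id_tensorHom_id,
      ← MonoidalCategory.id_tensorHom_id, ← D.total M, ← D.total N, ← D.total K, tensor_sum,
      Preadditive.sum_comp]
    refine Finset.sum_congr rfl fun k _ => ?_
    rw [sum_tensor, sum_tensor, Preadditive.sum_comp]
    refine Finset.sum_congr rfl fun i _ => ?_
    rw [tensor_sum, sum_tensor, Preadditive.sum_comp]
    refine Finset.sum_congr rfl fun j _ => ?_
    rw [← MonoidalCategory.tensorHom_comp_tensorHom, ← MonoidalCategory.tensorHom_comp_tensorHom,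
      Category.assoc]
  rw [key f, key g]
  simp only [h]

variable [MonoidalCategory C] [MonoidalPreadditive C] [F.Monoidal]

/-- The component of the extension at an index of a tensor product. -/
def ι₂ (M N : Karoubi (Mat_ C)) (i : M.X.ι) (j : N.X.ι) :
    F.obj (M.X.X i ⊗ N.X.X j) ⟶ E.obj (M ⊗ N) := D.ι (M ⊗ N) (i, j)

/-- The projection of the extension at an index of a tensor product. -/
def π₂ (M N : Karoubi (Mat_ C)) (i : M.X.ι) (j : N.X.ι) :
    E.obj (M ⊗ N) ⟶ F.obj (M.X.X i ⊗ N.X.X j) := D.π (M ⊗ N) (i, j)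

theorem ι₂_π₂ (M N : Karoubi (Mat_ C)) (i k : M.X.ι) (j l : N.X.ι) :
    D.ι₂ M N i j ≫ D.π₂ M N k l = F.map (M.p i k ⊗ₘ N.p j l) := D.ι_π (M ⊗ N) (i, j) (k, l)

theorem hom_ext₂ {M N : Karoubi (Mat_ C)} {W : V} {f g : E.obj (M ⊗ N) ⟶ W}
    (h : ∀ i j, D.ι₂ M N i j ≫ f = D.ι₂ M N i j ≫ g) : f = g :=
  D.hom_ext fun ⟨i, j⟩ => h i j

theorem ι₂_map {M N M' N' : Karoubi (Mat_ C)} (f : M ⟶ M') (g : N ⟶ N') (i : M.X.ι)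
    (j : N.X.ι) : D.ι₂ M N i j ≫ E.map (f ⊗ₘ g) =
      ∑ k, ∑ l, F.map (f.f i k ⊗ₘ g.f j l) ≫ D.ι₂ M' N' k l :=
  (D.ι_map (f ⊗ₘ g) (i, j)).trans (Fintype.sum_prod_type (α₁ := M'.X.ι) (α₂ := N'.X.ι)
    (fun q => F.map ((f ⊗ₘ g).f (i, j) q) ≫ D.ι (M' ⊗ N') q))

theorem sum_p_ι₂ {M N : Karoubi (Mat_ C)} (i : M.X.ι) (j : N.X.ι) :
    ∑ k, ∑ l, F.map (M.p i k ⊗ₘ N.p j l) ≫ D.ι₂ M N k l = D.ι₂ M N i j := by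
  have h := D.ι₂_map (𝟙 M) (𝟙 N) i j
  rw [MonoidalCategory.id_tensorHom_id, E.map_id, Category.comp_id] at h
  exact h.symm

/-- The tensorator of the extension. -/
def tensorator (M N : Karoubi (Mat_ C)) : E.obj M ⊗ E.obj N ⟶ E.obj (M ⊗ N) :=
  ∑ i, ∑ j, (D.π M i ⊗ₘ D.π N j) ≫ μ F (M.X.X i) (N.X.X j) ≫ D.ι₂ M N i j

/-- The inverse of the tensorator of the extension. -/
def cotensorator (M N : Karoubi (Mat_ C)) : E.obj (M ⊗ N) ⟶ E.obj M ⊗ E.obj N :=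
  ∑ i, ∑ j, D.π₂ M N i j ≫ δ F (M.X.X i) (N.X.X j) ≫ (D.ι M i ⊗ₘ D.ι N j)

/-- The projectors coming from `ι ≫ π` pass through `μ F` by naturality and are absorbed by `ι₂`.
With its dual `ι_cotensorator`, this reduces the properties of the tensorator to those of `μ F`. -/
theorem ι_tensorator {M N : Karoubi (Mat_ C)} (i : M.X.ι) (j : N.X.ι) :
    (D.ι M i ⊗ₘ D.ι N j) ≫ D.tensorator M N = μ F (M.X.X i) (N.X.X j) ≫ D.ι₂ M N i j := by
  rw [tensorator, Preadditive.comp_sum]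
  simp only [Preadditive.comp_sum, MonoidalCategory.tensorHom_comp_tensorHom_assoc,
    ι_π, Functor.LaxMonoidal.μ_natural_assoc]
  rw [← sum_p_ι₂, Preadditive.comp_sum]
  simp only [Preadditive.comp_sum]

theorem ι_cotensorator {M N : Karoubi (Mat_ C)} (i : M.X.ι) (j : N.X.ι) :
    D.ι₂ M N i j ≫ D.cotensorator M N = δ F (M.X.X i) (N.X.X j) ≫ (D.ι M i ⊗ₘ D.ι N j) := by
  rw [cotensorator, Preadditive.comp_sum]
  simp only [Preadditive.comp_sum, reassoc_of% D.ι₂_π₂, ← Functor.OplaxMonoidal.δ_natural_assoc,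
    MonoidalCategory.tensorHom_comp_tensorHom]
  -- The double sum factors as a tensor product of two sums, each of which absorbs its projector.
  simp only [← Preadditive.comp_sum, ← tensor_sum, ← sum_tensor, sum_p_ι]

/-- The tensorator of the extension as an isomorphism. -/
def μIso (M N : Karoubi (Mat_ C)) : E.obj M ⊗ E.obj N ≅ E.obj (M ⊗ N) where
  hom := D.tensorator M N
  inv := D.cotensorator M N
  hom_inv_id := D.tensor_hom_ext fun i j => by
    rw [reassoc_of% D.ι_tensorator, ι_cotensorator, Functor.Monoidal.μ_δ_assoc, Category.comp_id]
  inv_hom_id := D.hom_ext₂ fun i j => by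
    rw [reassoc_of% D.ι_cotensorator, ι_tensorator, Functor.Monoidal.δ_μ_assoc, Category.comp_id]

/-- The component of the extension at the unit object. -/
def ιUnit : F.obj (𝟙_ C) ⟶ E.obj (𝟙_ (Karoubi (Mat_ C))) := D.ι (𝟙_ _) PUnit.unit

/-- The projection of the extension at the unit object. -/
def πUnit : E.obj (𝟙_ (Karoubi (Mat_ C))) ⟶ F.obj (𝟙_ C) := D.π (𝟙_ _) PUnit.unit

theorem ιUnit_πUnit : D.ιUnit ≫ D.πUnit = 𝟙 _ := by
  have h' : (𝟙_ (Karoubi (Mat_ C))).p PUnit.unit PUnit.unit = 𝟙 (𝟙_ C) :=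
    Mat_.id_apply_self (𝟙_ (Mat_ C)) PUnit.unit
  exact (D.ι_π (𝟙_ _) PUnit.unit PUnit.unit).trans ((congrArg F.map h').trans (F.map_id _))

theorem πUnit_ιUnit : D.πUnit ≫ D.ιUnit = 𝟙 _ :=
  (Fintype.sum_unique (ι := PUnit) (fun i => D.π (𝟙_ (Karoubi (Mat_ C))) i ≫
      D.ι (𝟙_ (Karoubi (Mat_ C))) i)).symm.trans (D.total (𝟙_ _))

/-- The unit constraint of the extension. -/
def εIso : 𝟙_ V ≅ E.obj (𝟙_ (Karoubi (Mat_ C))) where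
  hom := ε F ≫ D.ιUnit
  inv := D.πUnit ≫ η F
  hom_inv_id := by
    rw [Category.assoc, reassoc_of% D.ιUnit_πUnit, Functor.Monoidal.ε_η]
  inv_hom_id := by
    rw [Category.assoc, Functor.Monoidal.η_ε_assoc, πUnit_ιUnit]

theorem tensorator_natural {M N M' N' : Karoubi (Mat_ C)} (f : M ⟶ M') (g : N ⟶ N') :
    (E.map f ⊗ₘ E.map g) ≫ D.tensorator M' N' = D.tensorator M N ≫ E.map (f ⊗ₘ g) := by
  refine D.tensor_hom_ext fun i j => ?_
  rw [reassoc_of% D.ι_tensorator, ι₂_map, MonoidalCategory.tensorHom_comp_tensorHom_assoc, ι_map,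
    ι_map, sum_tensor, Preadditive.sum_comp, Preadditive.comp_sum]
  refine Finset.sum_congr rfl fun k _ => ?_
  rw [tensor_sum, Preadditive.sum_comp, Preadditive.comp_sum]
  refine Finset.sum_congr rfl fun l _ => ?_
  rw [← MonoidalCategory.tensorHom_comp_tensorHom, Category.assoc, ι_tensorator,
    Functor.LaxMonoidal.μ_natural_assoc]

/-- The component of the extension at an index of a triple tensor product. -/
def ι₃ (M N K : Karoubi (Mat_ C)) (i : M.X.ι) (j : N.X.ι) (k : K.X.ι) :
    F.obj ((M.X.X i ⊗ N.X.X j) ⊗ K.X.X k) ⟶ E.obj ((M ⊗ N) ⊗ K) :=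
  D.ι ((M ⊗ N) ⊗ K) ((i, j), k)

/-- The component of the extension at an index of a triple tensor product. -/
def ι₃' (M N K : Karoubi (Mat_ C)) (i : M.X.ι) (j : N.X.ι) (k : K.X.ι) :
    F.obj (M.X.X i ⊗ (N.X.X j ⊗ K.X.X k)) ⟶ E.obj (M ⊗ (N ⊗ K)) :=
  D.ι (M ⊗ (N ⊗ K)) (i, (j, k))

theorem ι₂_ι_tensorator {M N K : Karoubi (Mat_ C)} (i : M.X.ι) (j : N.X.ι) (k : K.X.ι) :
    (D.ι₂ M N i j ⊗ₘ D.ι K k) ≫ D.tensorator (M ⊗ N) K = μ F _ _ ≫ D.ι₃ M N K i j k :=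
  D.ι_tensorator (M := M ⊗ N) (i, j) k

theorem ι_ι₂_tensorator {M N K : Karoubi (Mat_ C)} (i : M.X.ι) (j : N.X.ι) (k : K.X.ι) :
    (D.ι M i ⊗ₘ D.ι₂ N K j k) ≫ D.tensorator M (N ⊗ K) = μ F _ _ ≫ D.ι₃' M N K i j k :=
  D.ι_tensorator (N := N ⊗ K) i (j, k)

theorem ι₃_map_associator {M N K : Karoubi (Mat_ C)} (i : M.X.ι) (j : N.X.ι) (k : K.X.ι) :
    D.ι₃ M N K i j k ≫ E.map (α_ M N K).hom =
      F.map (α_ (M.X.X i) (N.X.X j) (K.X.X k)).hom ≫ D.ι₃' M N K i j k :=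
  D.ι_map_mono (M := (M ⊗ N) ⊗ K) (N := M ⊗ (N ⊗ K)) (α_ M N K).hom (Equiv.prodAssoc M.X.ι N.X.ι K.X.ι)
    (fun p : (M.X.ι × N.X.ι) × K.X.ι => (α_ (M.X.X p.1.1) (N.X.X p.1.2) (K.X.X p.2)).hom)
    (MonoidalCategory.associator_naturality M.p N.p K.p) ((i, j), k)

theorem ι₂_map_leftUnitor {M : Karoubi (Mat_ C)} (i : M.X.ι) :
    D.ι₂ (𝟙_ _) M PUnit.unit i ≫ E.map (λ_ M).hom =
      F.map (λ_ (M.X.X i)).hom ≫ D.ι M i :=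
  D.ι_map_mono (M := 𝟙_ _ ⊗ M) (N := M) (λ_ M).hom (Equiv.punitProd M.X.ι) (fun p : PUnit × M.X.ι => (λ_ (M.X.X p.2)).hom)
    (by
      have h := MonoidalCategory.leftUnitor_naturality M.p
      rw [← MonoidalCategory.id_tensorHom] at h
      exact h) (PUnit.unit, i)

theorem ι₂_map_rightUnitor {M : Karoubi (Mat_ C)} (i : M.X.ι) :
    D.ι₂ M (𝟙_ _) i PUnit.unit ≫ E.map (ρ_ M).hom =
      F.map (ρ_ (M.X.X i)).hom ≫ D.ι M i :=
  D.ι_map_mono (M := M ⊗ 𝟙_ _) (N := M) (ρ_ M).hom (Equiv.prodPUnit M.X.ι) (fun p : M.X.ι × PUnit => (ρ_ (M.X.X p.1)).hom)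
    (by
      have h := MonoidalCategory.rightUnitor_naturality M.p
      rw [← MonoidalCategory.tensorHom_id] at h
      exact h) (i, PUnit.unit)

/-- The threefold components are jointly epimorphic, and on them the diagram is the associativity of
`μ F`. -/
theorem tensorator_associativity (M N K : Karoubi (Mat_ C)) :
    D.tensorator M N ▷ E.obj K ≫ D.tensorator (M ⊗ N) K ≫ E.map (α_ M N K).hom =
      (α_ (E.obj M) (E.obj N) (E.obj K)).hom ≫
        E.obj M ◁ D.tensorator N K ≫ D.tensorator M (N ⊗ K) := by
  refine D.tensor₃_hom_ext fun i j k => ?_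
  have e1 : ((D.ι M i ⊗ₘ D.ι N j) ⊗ₘ D.ι K k) ≫ D.tensorator M N ▷ E.obj K =
      μ F _ _ ▷ F.obj (K.X.X k) ≫ (D.ι₂ M N i j ⊗ₘ D.ι K k) := by
    rw [← MonoidalCategory.tensorHom_id, ← MonoidalCategory.tensorHom_id,
      MonoidalCategory.tensorHom_comp_tensorHom, MonoidalCategory.tensorHom_comp_tensorHom,
      ι_tensorator, Category.comp_id, Category.id_comp]
  have e2 : (D.ι M i ⊗ₘ (D.ι N j ⊗ₘ D.ι K k)) ≫ E.obj M ◁ D.tensorator N K =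
      F.obj (M.X.X i) ◁ μ F _ _ ≫ (D.ι M i ⊗ₘ D.ι₂ N K j k) := by
    rw [← MonoidalCategory.id_tensorHom, ← MonoidalCategory.id_tensorHom,
      MonoidalCategory.tensorHom_comp_tensorHom, MonoidalCategory.tensorHom_comp_tensorHom,
      ι_tensorator, Category.comp_id, Category.id_comp]
  rw [reassoc_of% e1, MonoidalCategory.associator_naturality_assoc, reassoc_of% e2,
    reassoc_of% D.ι₂_ι_tensorator, ι_ι₂_tensorator, ι₃_map_associator,
    Functor.LaxMonoidal.associativity_assoc]

theorem tensorator_left_unitality (M : Karoubi (Mat_ C)) :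
    (λ_ (E.obj M)).hom = (ε F ≫ D.ιUnit) ▷ E.obj M ≫ D.tensorator (𝟙_ _) M ≫
      E.map (λ_ M).hom := by
  -- Precomposing with the inverse unitor replaces the source `𝟙 ⊗ E(M)` by `E(M)`, where equality
  -- can be tested on the components `ι`.
  rw [← cancel_epi (λ_ _).inv, Iso.inv_hom_id]
  refine D.hom_ext fun i => ?_
  have h1 : (D.ιUnit ⊗ₘ D.ι M i) ≫ D.tensorator (𝟙_ _) M = μ F (𝟙_ C) _ ≫ D.ι₂ (𝟙_ _) M PUnit.unit i :=
    D.ι_tensorator (M := 𝟙_ _) PUnit.unit i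
  have h2 : 𝟙_ V ◁ D.ι M i ≫ (ε F ≫ D.ιUnit) ▷ E.obj M =
      ε F ▷ F.obj (M.X.X i) ≫ (D.ιUnit ⊗ₘ D.ι M i) := by
    rw [whisker_exchange, comp_whiskerRight, Category.assoc, MonoidalCategory.tensorHom_def]
  rw [leftUnitor_inv_naturality_assoc, reassoc_of% h2, reassoc_of% h1, ι₂_map_leftUnitor,
    Category.comp_id]
  have h3 := Functor.LaxMonoidal.left_unitality (F := F) (M.X.X i)
  rw [← Category.assoc (μ F _ _), ← Category.assoc (ε F ▷ _), ← h3, Iso.inv_hom_id_assoc]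

theorem tensorator_right_unitality (M : Karoubi (Mat_ C)) :
    (ρ_ (E.obj M)).hom = E.obj M ◁ (ε F ≫ D.ιUnit) ≫ D.tensorator M (𝟙_ _) ≫
      E.map (ρ_ M).hom := by
  rw [← cancel_epi (ρ_ _).inv, Iso.inv_hom_id]
  refine D.hom_ext fun i => ?_
  have h1 : (D.ι M i ⊗ₘ D.ιUnit) ≫ D.tensorator M (𝟙_ _) = μ F _ (𝟙_ C) ≫ D.ι₂ M (𝟙_ _) i PUnit.unit :=
    D.ι_tensorator (N := 𝟙_ _) i PUnit.unit
  have h2 : D.ι M i ▷ 𝟙_ V ≫ E.obj M ◁ (ε F ≫ D.ιUnit) =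
      F.obj (M.X.X i) ◁ ε F ≫ (D.ι M i ⊗ₘ D.ιUnit) := by
    rw [← whisker_exchange, MonoidalCategory.whiskerLeft_comp, Category.assoc,
      MonoidalCategory.tensorHom_def']
  rw [rightUnitor_inv_naturality_assoc, reassoc_of% h2, reassoc_of% h1, ι₂_map_rightUnitor,
    Category.comp_id]
  have h3 := Functor.LaxMonoidal.right_unitality (F := F) (M.X.X i)
  rw [← Category.assoc (μ F _ _), ← Category.assoc (_ ◁ ε F), ← h3, Iso.inv_hom_id_assoc]

/-- The monoidal structure of the extension of a monoidal functor. -/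
abbrev monoidal : E.Monoidal := Functor.CoreMonoidal.toMonoidal
  { εIso := D.εIso
    μIso := D.μIso
    μIso_hom_natural_left := fun f X' => by
      have h := D.tensorator_natural f (𝟙 X')
      rw [CategoryTheory.Functor.map_id, MonoidalCategory.tensorHom_id,
        MonoidalCategory.tensorHom_id] at h
      exact h
    μIso_hom_natural_right := fun X' f => by
      have h := D.tensorator_natural (𝟙 X') f
      rw [CategoryTheory.Functor.map_id, MonoidalCategory.id_tensorHom,
        MonoidalCategory.id_tensorHom] at h
      exact h
    associativity := D.tensorator_associativity
    left_unitality := D.tensorator_left_unitality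
    right_unitality := D.tensorator_right_unitality }

end Monoidal

end Extension

end KaroubiMat

/-! ### The embedding into the Karoubi envelope of the additive completion -/

section Embedding

open Idempotents

variable {C : Type*} [Category C] [Preadditive C]

instance Mat_.instLinear [Linear ℚ C] : Linear ℚ (Mat_ C) where
  homModule M N := inferInstanceAs (Module ℚ (∀ i j, M.X i ⟶ N.X j))
  smul_comp M N K c f g := by
    ext i k
    refine Eq.trans ?_ (Finset.smul_sum (r := c) (f := fun j => f i j ≫ g j k)).symm
    exact Finset.sum_congr rfl fun j _ => Linear.smul_comp _ _ _ _ _ _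
  comp_smul M N K f c g := by
    ext i k
    refine Eq.trans ?_ (Finset.smul_sum (r := c) (f := fun j => f i j ≫ g j k)).symm
    exact Finset.sum_congr rfl fun j _ => Linear.comp_smul _ _ _ _ _ _

instance Karoubi.instLinear [Linear ℚ C] : Linear ℚ (Karoubi C) where
  homModule P Q :=
    { smul := fun c f => ⟨c • f.f, by rw [Linear.smul_comp, Linear.comp_smul, f.comm]⟩
      one_smul := fun f => Karoubi.hom_ext _ _ (one_smul ℚ f.f)
      mul_smul := fun a b f => Karoubi.hom_ext _ _ (mul_smul a b f.f)
      smul_zero := fun a => Karoubi.hom_ext _ _ (smul_zero a)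
      smul_add := fun a f g => Karoubi.hom_ext _ _ (smul_add a f.f g.f)
      add_smul := fun a b f => Karoubi.hom_ext _ _ (add_smul a b f.f)
      zero_smul := fun f => Karoubi.hom_ext _ _ (zero_smul ℚ f.f) }
  smul_comp _ _ _ c f g := Karoubi.hom_ext _ _ (Linear.smul_comp _ _ _ c f.f g.f)
  comp_smul _ _ _ f c g := Karoubi.hom_ext _ _ (Linear.comp_smul _ _ _ f.f c g.f)

/-- In this form every map in the monoidality diagrams of the embedding is monomial, and composites
and tensor products are computed by `Mat_.mono_comp_mono` and `Mat_.tens_mono`. -/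
theorem Mat_.embedding_map_eq_mono {X Y : C} (f : X ⟶ Y) : (Mat_.embedding C).map f =
    Mat_.mono (M := (Mat_.embedding C).obj X) (N := (Mat_.embedding C).obj Y)
      (fun _ => PUnit.unit) (fun _ => f) := by
  ext i j
  exact (Mat_.mono_apply_self (M := (Mat_.embedding C).obj X) (N := (Mat_.embedding C).obj Y)
    (fun _ => PUnit.unit) (fun _ => f) j).symm

instance karoubi_monoidalPreadditive [MonoidalCategory C] [MonoidalPreadditive C] :
    MonoidalPreadditive (Karoubi C) where
  whiskerLeft_zero {X _ _} := Karoubi.hom_ext _ _ (MonoidalPreadditive.tensor_zero X.p)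
  zero_whiskerRight {X _ _} := Karoubi.hom_ext _ _ (MonoidalPreadditive.zero_tensor X.p)
  whiskerLeft_add {X _ _} f g :=
    Karoubi.hom_ext _ _ (MonoidalPreadditive.tensor_add X.p f.f g.f)
  add_whiskerRight {X _ _} f g :=
    Karoubi.hom_ext _ _ (MonoidalPreadditive.add_tensor f.f g.f X.p)

/-- The tensor product of `(X, 𝟙)` and `(Y, 𝟙)` carries the projector `𝟙 ⊗ 𝟙`, not literally `𝟙`;
the tensorator is the identity of `X ⊗ Y` viewed between these two presentations. -/
instance toKaroubiMonoidal [MonoidalCategory C] : (toKaroubi C).Monoidal :=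
  Functor.CoreMonoidal.toMonoidal
  { εIso := Iso.refl _
    μIso := fun X Y => karoubiIso (P := (toKaroubi C).obj X ⊗ (toKaroubi C).obj Y)
      (Q := (toKaroubi C).obj (X ⊗ Y)) (Iso.refl (X ⊗ Y))
      ((Category.comp_id _).trans ((MonoidalCategory.id_tensorHom_id _ _).trans
        (Category.comp_id _).symm))
    μIso_hom_natural_left := fun {X Y} f X' => Karoubi.hom_ext _ _ (by
      change (f ⊗ₘ 𝟙 X') ≫ (𝟙 Y ⊗ₘ 𝟙 X') ≫ 𝟙 _ = ((𝟙 X ⊗ₘ 𝟙 X') ≫ 𝟙 _) ≫ f ▷ X'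
      simp)
    μIso_hom_natural_right := fun {X Y} X' f => Karoubi.hom_ext _ _ (by
      change (𝟙 X' ⊗ₘ f) ≫ (𝟙 X' ⊗ₘ 𝟙 Y) ≫ 𝟙 _ = ((𝟙 X' ⊗ₘ 𝟙 X) ≫ 𝟙 _) ≫ X' ◁ f
      simp)
    associativity := fun X Y Z => Karoubi.hom_ext _ _ (by
      change (((𝟙 X ⊗ₘ 𝟙 Y) ≫ 𝟙 _) ⊗ₘ 𝟙 Z) ≫ ((𝟙 (X ⊗ Y) ⊗ₘ 𝟙 Z) ≫ 𝟙 _) ≫ (α_ X Y Z).hom =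
        (((𝟙 X ⊗ₘ 𝟙 Y) ⊗ₘ 𝟙 Z) ≫ (α_ X Y Z).hom) ≫ (𝟙 X ⊗ₘ (𝟙 Y ⊗ₘ 𝟙 Z) ≫ 𝟙 _) ≫
          (𝟙 X ⊗ₘ 𝟙 (Y ⊗ Z)) ≫ 𝟙 _
      simp)
    left_unitality := fun X => Karoubi.hom_ext _ _ (by
      change (𝟙 (𝟙_ C) ⊗ₘ 𝟙 X) ≫ (λ_ X).hom = (𝟙 (𝟙_ C) ⊗ₘ 𝟙 X) ≫
        ((𝟙 (𝟙_ C) ⊗ₘ 𝟙 X) ≫ 𝟙 _) ≫ (λ_ X).hom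
      simp)
    right_unitality := fun X => Karoubi.hom_ext _ _ (by
      change (𝟙 X ⊗ₘ 𝟙 (𝟙_ C)) ≫ (ρ_ X).hom = (𝟙 X ⊗ₘ 𝟙 (𝟙_ C)) ≫
        ((𝟙 X ⊗ₘ 𝟙 (𝟙_ C)) ≫ 𝟙 _) ≫ (ρ_ X).hom
      simp) }

section

variable [MonoidalCategory C] [MonoidalPreadditive C]

instance Mat_.instMonoidalPreadditive : MonoidalPreadditive (Mat_ C) where
  whiskerLeft_zero := by
    intros
    ext p q
    exact MonoidalPreadditive.tensor_zero _
  zero_whiskerRight := by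
    intros
    ext p q
    exact MonoidalPreadditive.zero_tensor _
  whiskerLeft_add f g := by
    ext p q
    exact MonoidalPreadditive.tensor_add _ (f p.2 q.2) (g p.2 q.2)
  add_whiskerRight f g := by
    ext p q
    exact MonoidalPreadditive.add_tensor (f p.1 q.1) (g p.1 q.1) _

/-- The tensorator of the embedding into the additive completion. -/
def Mat_.embeddingμIso (X Y : C) : (Mat_.embedding C).obj X ⊗ (Mat_.embedding C).obj Y ≅
    (Mat_.embedding C).obj (X ⊗ Y) :=
  Mat_.monoIso (M := (Mat_.embedding C).obj X ⊗ (Mat_.embedding C).obj Y)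
    (N := (Mat_.embedding C).obj (X ⊗ Y)) (Equiv.punitProd PUnit) fun _ => Iso.refl (X ⊗ Y)

instance Mat_.embeddingMonoidal : (Mat_.embedding C).Monoidal := Functor.CoreMonoidal.toMonoidal
  { εIso := Iso.refl _
    μIso := Mat_.embeddingμIso
    μIso_hom_natural_left := fun {X Y} f X' => by
      change Mat_.tens ((Mat_.embedding C).map f) (𝟙 _) ≫ Mat_.mono _ _ =
        Mat_.mono _ _ ≫ (Mat_.embedding C).map (f ▷ X')
      rw [Mat_.embedding_map_eq_mono, Mat_.embedding_map_eq_mono, Mat_.id_eq_mono]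
      refine (congrArg (· ≫ Mat_.mono _ _) (Mat_.tens_mono (M := (Mat_.embedding C).obj X) (P := (Mat_.embedding C).obj Y)
        (N := (Mat_.embedding C).obj X') (Q := (Mat_.embedding C).obj X') _ _ _ _)).trans
        (Eq.trans ?_ (Mat_.mono_comp_mono _ _ _ _).symm)
      refine (Mat_.mono_comp_mono _ _ _ _).trans ?_
      refine congrArg (Mat_.mono _) (funext fun p => ?_)
      change (f ⊗ₘ 𝟙 X') ≫ 𝟙 _ = 𝟙 _ ≫ f ▷ X'
      simp
    μIso_hom_natural_right := fun {X Y} X' f => by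
      change Mat_.tens (𝟙 _) ((Mat_.embedding C).map f) ≫ Mat_.mono _ _ =
        Mat_.mono _ _ ≫ (Mat_.embedding C).map (X' ◁ f)
      rw [Mat_.embedding_map_eq_mono, Mat_.embedding_map_eq_mono, Mat_.id_eq_mono]
      refine (congrArg (· ≫ Mat_.mono _ _) (Mat_.tens_mono (M := (Mat_.embedding C).obj X') (P := (Mat_.embedding C).obj X')
        (N := (Mat_.embedding C).obj X) (Q := (Mat_.embedding C).obj Y) _ _ _ _)).trans
        (Eq.trans ?_ (Mat_.mono_comp_mono _ _ _ _).symm)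
      refine (Mat_.mono_comp_mono _ _ _ _).trans ?_
      refine congrArg (Mat_.mono _) (funext fun p => ?_)
      change (𝟙 X' ⊗ₘ f) ≫ 𝟙 _ = 𝟙 _ ≫ X' ◁ f
      simp
    associativity := fun X Y Z => by
      change Mat_.tens (Mat_.mono _ _) (𝟙 _) ≫ Mat_.mono _ _ ≫ (Mat_.embedding C).map _ =
        Mat_.mono _ _ ≫ Mat_.tens (𝟙 _) (Mat_.mono _ _) ≫ Mat_.mono _ _
      rw [Mat_.embedding_map_eq_mono, Mat_.id_eq_mono, Mat_.id_eq_mono, Mat_.tens_mono,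
        Mat_.tens_mono]
      refine ((congrArg _ (Mat_.mono_comp_mono _ _ _ _)).trans (Mat_.mono_comp_mono _ _ _ _)).trans
        (Eq.trans ?_ ((congrArg _ (Mat_.mono_comp_mono _ _ _ _)).trans
          (Mat_.mono_comp_mono _ _ _ _)).symm)
      refine congrArg (Mat_.mono _) (funext fun p => ?_)
      change (𝟙 (X ⊗ Y) ⊗ₘ 𝟙 Z) ≫ 𝟙 _ ≫ (α_ X Y Z).hom =
        (α_ X Y Z).hom ≫ (𝟙 X ⊗ₘ 𝟙 (Y ⊗ Z)) ≫ 𝟙 _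
      simp
    left_unitality := fun X => by
      change Mat_.mono _ _ = Mat_.tens (𝟙 _) (𝟙 _) ≫ Mat_.mono _ _ ≫ (Mat_.embedding C).map _
      rw [Mat_.embedding_map_eq_mono, Mat_.id_eq_mono, Mat_.id_eq_mono, Mat_.tens_mono]
      refine Eq.trans ?_ ((congrArg _ (Mat_.mono_comp_mono _ _ _ _)).trans
        (Mat_.mono_comp_mono _ _ _ _)).symm
      refine congrArg (Mat_.mono _) (funext fun p => ?_)
      change (λ_ X).hom = (𝟙 (𝟙_ C) ⊗ₘ 𝟙 X) ≫ 𝟙 _ ≫ (λ_ X).hom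
      simp
    right_unitality := fun X => by
      change Mat_.mono _ _ = Mat_.tens (𝟙 _) (𝟙 _) ≫ Mat_.mono _ _ ≫ (Mat_.embedding C).map _
      rw [Mat_.embedding_map_eq_mono, Mat_.id_eq_mono, Mat_.id_eq_mono, Mat_.tens_mono]
      refine Eq.trans ?_ ((congrArg _ (Mat_.mono_comp_mono _ _ _ _)).trans
        (Mat_.mono_comp_mono _ _ _ _)).symm
      refine congrArg (Mat_.mono _) (funext fun p => ?_)
      change (ρ_ X).hom = (𝟙 X ⊗ₘ 𝟙 (𝟙_ C)) ≫ 𝟙 _ ≫ (ρ_ X).hom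
      simp }

end

theorem Mat_.sum_apply {M N : Mat_ C} {ι : Type*} (s : Finset ι) (f : ι → (M ⟶ N)) (i : M.ι)
    (j : N.ι) : (∑ k ∈ s, f k) i j = ∑ k ∈ s, f k i j :=
  map_sum (⟨⟨fun g : M ⟶ N => g i j, rfl⟩, fun _ _ => rfl⟩ : (M ⟶ N) →+ (M.X i ⟶ N.X j)) f s

/-- The canonical embedding into the Karoubi envelope of the additive completion. -/
abbrev karoubiMatEmbedding (C : Type*) [Category C] [Preadditive C] : C ⥤ Karoubi (Mat_ C) :=
  Mat_.embedding C ⋙ toKaroubi (Mat_ C)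

/-- The identity functor is the extension of the canonical embedding. -/
def idExtension (C : Type*) [Category C] [Preadditive C] :
    Extension (karoubiMatEmbedding C) (𝟭 (Karoubi (Mat_ C))) where
  -- The morphism `ι` is the `i`-th row of the idempotent and `π` its `i`-th column; `total` and
  -- `ι_π` both amount to `p ≫ p = p`.
  ι M i := ⟨fun _ j => M.p i j, by
    refine (Category.id_comp (X := (Mat_.embedding C).obj (M.X.X i)) _).trans ?_
    exact funext fun _ => congrFun M.idem i⟩
  π M i := ⟨fun j _ => M.p j i, by
    refine (congrArg (M.p ≫ ·) (Category.comp_id (Y := (Mat_.embedding C).obj (M.X.X i)) _)).trans ?_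
    exact funext fun j => funext fun _ => congrFun (congrFun M.idem j) i⟩
  total M := Karoubi.hom_ext _ _ (by
    rw [Karoubi.sum_hom]
    ext j k
    rw [Mat_.sum_apply]
    refine Eq.trans ?_ (congrFun (congrFun M.idem j) k)
    exact Finset.sum_congr rfl fun i _ =>
      Fintype.sum_unique (fun _ : PUnit => M.p j i ≫ M.p i k))
  ι_π M i j := Karoubi.hom_ext _ _
    (funext fun _ => funext fun _ => congrFun (congrFun M.idem i) j)
  ι_map {M N} f i := Karoubi.hom_ext _ _ (by
    rw [Karoubi.sum_hom]
    ext j k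
    rw [Mat_.sum_apply]
    refine (congrFun (congrFun (Karoubi.p_comp f) i) k).trans
      ((congrFun (congrFun (Karoubi.comp_p f) i) k).symm.trans ?_)
    exact Finset.sum_congr rfl fun l _ =>
      (Fintype.sum_unique (fun _ : PUnit => f.f i l ≫ N.p l k)).symm)

end Embedding

/-! ### The functor to the linearization -/

namespace QLin

variable {C : Type*} [Category C] [HasZeroMorphisms C]

/-- The canonical functor to the linearization. -/
def functor (C : Type*) [Category C] [HasZeroMorphisms C] : C ⥤ QLin C where
  obj X := ⟨X⟩
  map f := hom f
  map_id X := hom_id X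
  map_comp f g := (hom_comp f g).symm

instance functor_preservesZeroMorphisms : (functor C).PreservesZeroMorphisms where
  map_zero _ _ := hom_zero

instance functorMonoidal [MonoidalCategory C] [ZeroTensor C] : (functor C).Monoidal :=
  Functor.CoreMonoidal.toMonoidal
  { εIso := Iso.refl _
    μIso := fun X Y => Iso.refl (⟨X ⊗ Y⟩ : QLin C)
    μIso_hom_natural_left := fun f X' => (Category.comp_id _).trans
      ((hom_whiskerRight f X').trans (Category.id_comp _).symm)
    μIso_hom_natural_right := fun X' f => (Category.comp_id _).trans
      ((hom_whiskerLeft f X').trans (Category.id_comp _).symm)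
    associativity := fun X Y Z => by
      change 𝟙 ((⟨X⟩ : QLin C) ⊗ ⟨Y⟩) ▷ ⟨Z⟩ ≫ 𝟙 (((⟨X⟩ : QLin C) ⊗ ⟨Y⟩) ⊗ ⟨Z⟩) ≫
        (α_ (⟨X⟩ : QLin C) ⟨Y⟩ ⟨Z⟩).hom = (α_ (⟨X⟩ : QLin C) ⟨Y⟩ ⟨Z⟩).hom ≫
          (⟨X⟩ : QLin C) ◁ 𝟙 ((⟨Y⟩ : QLin C) ⊗ ⟨Z⟩) ≫ 𝟙 ((⟨X⟩ : QLin C) ⊗ (⟨Y⟩ ⊗ ⟨Z⟩))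
      simp
    left_unitality := fun X => by
      change (λ_ (⟨X⟩ : QLin C)).hom = 𝟙 (𝟙_ (QLin C)) ▷ (⟨X⟩ : QLin C) ≫
        𝟙 (𝟙_ (QLin C) ⊗ (⟨X⟩ : QLin C)) ≫ (λ_ (⟨X⟩ : QLin C)).hom
      simp
    right_unitality := fun X => by
      change (ρ_ (⟨X⟩ : QLin C)).hom = (⟨X⟩ : QLin C) ◁ 𝟙 (𝟙_ (QLin C)) ≫
        𝟙 ((⟨X⟩ : QLin C) ⊗ 𝟙_ (QLin C)) ≫ (ρ_ (⟨X⟩ : QLin C)).hom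
      simp }

end QLin

/-! ### `Crystals_ℚ` is `ℚ`-linear and pseudo-abelian -/

/-- A zero object and binary biproducts give finite products, which are biproducts in a preadditive
category. The criterion is applied to `Crystals_ℚ`, to `𝒪^ℤ` and to additive endofunctors. -/
theorem hasFiniteBiproducts_of_isZero_of_sum {C : Type*} [Category C] [Preadditive C] (Z : C)
    (hZ : 𝟙 Z = 0)
    (h : ∀ X Y : C, ∃ (P : C) (inl : X ⟶ P) (inr : Y ⟶ P) (fst : P ⟶ X) (snd : P ⟶ Y),
      inl ≫ fst = 𝟙 X ∧ inl ≫ snd = 0 ∧ inr ≫ fst = 0 ∧ inr ≫ snd = 𝟙 Y ∧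
        fst ≫ inl + snd ≫ inr = 𝟙 P) : HasFiniteBiproducts C := by
  have hZ' : IsZero Z := (IsZero.iff_id_eq_zero Z).mpr hZ
  have : HasTerminal C := hZ'.isTerminal.hasTerminal
  have : HasBinaryBiproducts C := ⟨fun X Y => by
    obtain ⟨P, inl, inr, fst, snd, h1, h2, h3, h4, h5⟩ := h X Y
    exact hasBinaryBiproduct_of_total
      { pt := P, fst := fst, snd := snd, inl := inl, inr := inr, inl_fst := h1, inl_snd := h2,
        inr_fst := h3, inr_snd := h4 } h5⟩
  have : HasFiniteProducts C := hasFiniteProducts_of_has_binary_and_terminal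
  exact HasFiniteBiproducts.of_hasFiniteProducts

theorem isIso_zsmul_id {C : Type*} [Category C] [Preadditive C] [Linear ℚ C] {n : ℤ} (hn : n ≠ 0)
    (X : C) : IsIso (n • 𝟙 X) := by
  have hn' : (n : ℚ) ≠ 0 := Int.cast_ne_zero.mpr hn
  have h : n • 𝟙 X = (n : ℚ) • 𝟙 X := (Int.cast_smul_eq_zsmul ℚ n (𝟙 X)).symm
  rw [h]
  exact ⟨(n : ℚ)⁻¹ • 𝟙 X, by simp [smul_smul, hn'], by simp [smul_smul, hn']⟩

namespace CrystalsQ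

open Crystal

theorem add_app {X Y : CrystalsQ} (S T : X ⟶ Y) (n : ℕ) (v : X.V n →₀ ℚ) :
    (S + T).app n v = S.app n v + T.app n v := rfl

theorem zero_app {X Y : CrystalsQ} (n : ℕ) (v : X.V n →₀ ℚ) : (0 : X ⟶ Y).app n v = 0 := rfl

instance instLinear : Linear ℚ CrystalsQ where
  homModule X Y := (homEquiv X Y).module ℚ
  smul_comp _ _ _ c S T := hom_ext fun n v => map_smul (T.app n) c (S.app n v)
  comp_smul _ _ _ _ _ _ := rfl

instance instMonoidalPreadditive : MonoidalPreadditive CrystalsQ where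
  whiskerLeft_zero := tens_hom_ext fun _ _ _ m x y =>
    (tensMap_incl _ _ m x y).trans (map_zero (incl m x))
  zero_whiskerRight := tens_hom_ext fun _ _ _ m x y => (tensMap_incl _ _ m x y).trans (by
    rw [zero_app, map_zero, LinearMap.zero_apply]
    rfl)
  whiskerLeft_add S T := tens_hom_ext fun i j k m x y => by
    rw [add_app]
    refine (tensMap_incl _ _ m x y).trans ?_
    refine Eq.trans ?_ (congrArg₂ (· + ·) (tensMap_incl _ S m x y) (tensMap_incl _ T m x y)).symm
    rw [add_app, map_add]
  add_whiskerRight S T := tens_hom_ext fun i j k m x y => by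
    rw [add_app]
    refine (tensMap_incl _ _ m x y).trans ?_
    refine Eq.trans ?_ (congrArg₂ (· + ·) (tensMap_incl S _ m x y) (tensMap_incl T _ m x y)).symm
    rw [add_app, map_add, LinearMap.add_apply]

/-- The zero object. -/
def zeroObj : CrystalsQ := ⟨fun _ => Empty, Finite.of_injective (β := Empty) (fun x => x.2) fun x => x.2.elim⟩

theorem id_zeroObj : 𝟙 zeroObj = 0 := hom_ext_single fun _ v => v.elim

/-- The direct sum. -/
def sum (X Y : CrystalsQ) : CrystalsQ where
  V n := X.V n ⊕ Y.V n
  finite := by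
    have := X.finite
    have := Y.finite
    exact Finite.of_equiv _ (Equiv.sigmaSumDistrib X.V Y.V).symm

theorem exists_sum (X Y : CrystalsQ) : ∃ (inl : X ⟶ sum X Y) (inr : Y ⟶ sum X Y)
    (fst : sum X Y ⟶ X) (snd : sum X Y ⟶ Y),
      inl ≫ fst = 𝟙 X ∧ inl ≫ snd = 0 ∧ inr ≫ fst = 0 ∧ inr ≫ snd = 𝟙 Y ∧
        fst ≫ inl + snd ≫ inr = 𝟙 (sum X Y) := by
  let e := fun n => Finsupp.sumFinsuppLEquivProdFinsupp ℚ (M := ℚ) (α := X.V n) (β := Y.V n)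
  refine ⟨⟨fun n => (e n).symm.toLinearMap ∘ₗ LinearMap.inl ℚ _ _⟩,
    ⟨fun n => (e n).symm.toLinearMap ∘ₗ LinearMap.inr ℚ _ _⟩,
    ⟨fun n => LinearMap.fst ℚ _ _ ∘ₗ (e n).toLinearMap⟩,
    ⟨fun n => LinearMap.snd ℚ _ _ ∘ₗ (e n).toLinearMap⟩, ?_, ?_, ?_, ?_, ?_⟩
  · exact hom_ext fun n v => congrArg Prod.fst ((e n).apply_symm_apply (v, 0))
  · exact hom_ext fun n v => congrArg Prod.snd ((e n).apply_symm_apply (v, 0))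
  · exact hom_ext fun n v => congrArg Prod.fst ((e n).apply_symm_apply (0, v))
  · exact hom_ext fun n v => congrArg Prod.snd ((e n).apply_symm_apply (0, v))
  · refine hom_ext fun n v => ?_
    refine ((map_add (e n).symm ((e n v).1, 0) (0, (e n v).2)).symm).trans ?_
    rw [Prod.mk_add_mk, add_zero, zero_add]
    exact (e n).symm_apply_apply v

instance instHasFiniteBiproducts : HasFiniteBiproducts CrystalsQ :=
  hasFiniteBiproducts_of_isZero_of_sum zeroObj id_zeroObj fun X Y =>
    let ⟨inl, inr, fst, snd, h⟩ := exists_sum X Y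
    ⟨sum X Y, inl, inr, fst, snd, h⟩

theorem finite_V (X : CrystalsQ) (n : ℕ) : Finite (X.V n) :=
  have := X.finite
  Finite.of_injective (Sigma.mk n) sigma_mk_injective

/-- Objects are families of sets rather than of vector spaces, so the image of `p` is represented in
each degree by the index set of a basis. -/
instance instIsIdempotentComplete : IsIdempotentComplete CrystalsQ where
  idempotents_split X p hp := by
    classical
    have := X.finite_V
    let W := fun n => LinearMap.range (p.app n)
    -- The bound on the ranks gives injections of the new index sets into those of `X`, hence the
    -- finiteness of their disjoint union over all `n`.
    have hW : ∀ n, Module.finrank ℚ (W n) ≤ Nat.card (X.V n) := fun n => by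
      have := Fintype.ofFinite (X.V n)
      refine (Submodule.finrank_le _).trans ?_
      rw [Module.finrank_finsupp_self, Nat.card_eq_fintype_card]
    have hemb : ∀ n, Nonempty (Fin (Module.finrank ℚ (W n)) ↪ X.V n) := fun n => by
      have := Fintype.ofFinite (X.V n)
      refine Function.Embedding.nonempty_of_card_le ?_
      rw [Fintype.card_fin, ← Nat.card_eq_fintype_card]
      exact hW n
    let b := fun n => (Module.finBasis ℚ (W n)).repr
    let Y : CrystalsQ := ⟨fun n => Fin (Module.finrank ℚ (W n)), by
      have := X.finite
      let f := fun n => (hemb n).some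
      exact Finite.of_injective (Sigma.map id fun n => f n)
        (Function.injective_id.sigma_map fun n => (f n).injective)⟩
    have hpp : ∀ n v, p.app n (p.app n v) = p.app n v := fun n v =>
      LinearMap.congr_fun (congrArg (fun q : X ⟶ X => Hom.app q n) hp) v
    refine ⟨Y, ⟨fun n => (W n).subtype ∘ₗ (b n).symm.toLinearMap⟩,
      ⟨fun n => (b n).toLinearMap ∘ₗ (p.app n).rangeRestrict⟩, ?_, ?_⟩
    · refine hom_ext fun n v => ?_
      change b n ((p.app n).rangeRestrict ((b n).symm v)) = v
      rw [← LinearEquiv.eq_symm_apply]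
      obtain ⟨x, hx⟩ := ((b n).symm v).2
      refine Subtype.ext ?_
      change p.app n ((b n).symm v) = _
      rw [← hx, hpp]
    · refine hom_ext fun n v => ?_
      change (((b n).symm (b n ((p.app n).rangeRestrict v)) : W n) : X.V n →₀ ℚ) = p.app n v
      rw [LinearEquiv.symm_apply_apply]
      rfl

/-- The multiplicity of `𝔹(n)`. -/
def dim (X : CrystalsQ) (n : ℕ) : ℕ := Nat.card (X.V n)

theorem finrank_eq_dim (X : CrystalsQ) (n : ℕ) : Module.finrank ℚ (X.V n →₀ ℚ) = X.dim n := by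
  have := X.finite_V n
  have := Fintype.ofFinite (X.V n)
  rw [Module.finrank_finsupp_self, dim, Nat.card_eq_fintype_card]

/-- The linear equivalences given by an isomorphism. -/
def appEquiv {X Y : CrystalsQ} (e : X ≅ Y) (n : ℕ) : (X.V n →₀ ℚ) ≃ₗ[ℚ] (Y.V n →₀ ℚ) :=
  LinearEquiv.ofLinearMap (e.hom.app n) (e.inv.app n)
    (congrArg (fun q : Y ⟶ Y => Hom.app q n) e.inv_hom_id)
    (congrArg (fun q : X ⟶ X => Hom.app q n) e.hom_inv_id)

theorem dim_eq_of_iso {X Y : CrystalsQ} (e : X ≅ Y) (n : ℕ) : X.dim n = Y.dim n := by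
  rw [← finrank_eq_dim, ← finrank_eq_dim, (appEquiv e n).finrank_eq]

/-- Together with `dim_eq_of_iso`, this makes `dim` a complete invariant and turns questions of
isomorphism into counting. -/
theorem nonempty_iso_of_dim_eq {X Y : CrystalsQ} (h : ∀ n, X.dim n = Y.dim n) :
    Nonempty (X ≅ Y) := by
  have := X.finite_V
  have := Y.finite_V
  exact ⟨ofEquiv fun n => (Finite.card_eq.mp (h n)).some⟩

theorem dim_sum (X Y : CrystalsQ) (n : ℕ) : (sum X Y).dim n = X.dim n + Y.dim n := by
  have := X.finite_V n
  have := Y.finite_V n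
  exact Nat.card_sum

theorem dim_simple (m n : ℕ) : (simple m).dim n = if n = m then 1 else 0 := by
  split_ifs with h
  · have : Unique ((simple m).V n) := ⟨⟨⟨h⟩⟩, fun ⟨_⟩ => rfl⟩
    exact Nat.card_unique
  · have : IsEmpty ((simple m).V n) := ⟨fun ⟨h'⟩ => h h'⟩
    exact Nat.card_of_isEmpty

end CrystalsQ

/-! ### From crystals to `Crystals_ℚ` -/

namespace Crystal

open RedSpan

instance instZeroTensor : ZeroTensor Crystal where
  zero_tensor _ := hom_ext fun _ => rfl
  tensor_zero f := hom_ext fun p => by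
    change (f.toFun p.1).bind (fun a => (none : Option _).map _) = none
    rcases f.toFun p.1 with _ | a <;> rfl

/-- The empty crystal. -/
def empty : Crystal where
  carrier := Empty
  finite := inferInstance
  wt := Empty.elim
  ε := Empty.elim
  φ := Empty.elim
  e := Empty.elim
  f := Empty.elim
  φ_eq b := b.elim
  e_spec b := b.elim
  f_spec b := b.elim
  e_iff_f b := b.elim
  ε_max b := b.elim
  φ_max b := b.elim

/-- The morphism `𝔹(0) ⟶ 𝔹(1) ⊗ 𝔹(1)` with image `v₋₁ ⊗ v₁`. -/
def cup : BB 0 ⟶ BB 1 ⊗ BB 1 where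
  toFun _ := some ((1, 0) : Fin 2 × Fin 2)
  wt := by
    intro (a : Fin 1) b h
    obtain rfl := Subsingleton.elim a 0
    cases h
    rfl
  ε := by
    intro (a : Fin 1) b h
    obtain rfl := Subsingleton.elim a 0
    cases h
    rfl
  φ := by
    intro (a : Fin 1) b h
    obtain rfl := Subsingleton.elim a 0
    cases h
    rfl
  e := by
    intro (a : Fin 1)
    obtain rfl := Subsingleton.elim a 0
    rfl
  f := by
    intro (a : Fin 1)
    obtain rfl := Subsingleton.elim a 0
    rfl

/-- The map underlying the projection `𝔹(1) ⊗ 𝔹(1) ⟶ 𝔹(0)`. -/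
def capFun : Fin 2 × Fin 2 → Option (Fin 1)
  | (1, 0) => some 0
  | _ => none

theorem eq_of_capFun {p : Fin 2 × Fin 2} {b : Fin 1} (h : capFun p = some b) :
    p = (1, 0) ∧ b = 0 := by
  refine ⟨?_, Subsingleton.elim _ _⟩
  revert p b
  decide

/-- The morphism `𝔹(1) ⊗ 𝔹(1) ⟶ 𝔹(0)` that is non-zero on `v₋₁ ⊗ v₁`. -/
def cap : BB 1 ⊗ BB 1 ⟶ BB 0 where
  toFun := capFun
  wt p b h := by
    obtain ⟨rfl, rfl⟩ := eq_of_capFun h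
    rfl
  ε p b h := by
    obtain ⟨rfl, rfl⟩ := eq_of_capFun h
    rfl
  φ p b h := by
    obtain ⟨rfl, rfl⟩ := eq_of_capFun h
    rfl
  e := by
    intro (p : Fin 2 × Fin 2)
    obtain ⟨a, b⟩ := p
    fin_cases a <;> fin_cases b <;> rfl
  f := by
    intro (p : Fin 2 × Fin 2)
    obtain ⟨a, b⟩ := p
    fin_cases a <;> fin_cases b <;> rfl

/-- The data on crystals given by `𝔹(1)`. -/
def datum : CPrime.Datum Crystal where
  F := BB 1
  zero := empty
  id_zero := hom_ext fun b => b.elim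
  cup := cup
  cap := cap
  cup_cap := hom_ext fun a => by
    obtain rfl : a = (0 : Fin 1) := Subsingleton.elim (α := Fin 1) _ _
    rfl
  -- The indices `0`, `1` stand for `v₁`, `v₋₁`. Here `a` becomes `(v₋₁ ⊗ v₁) ⊗ a`, and `cap` kills
  -- `v₁ ⊗ a` since its first factor is not `v₋₁`. In `zigzag_right` it kills `a ⊗ v₋₁` since the
  -- second factor is not `v₁`.
  zigzag_left := hom_ext fun (a : Fin 2) => by fin_cases a <;> rfl
  zigzag_right := hom_ext fun (a : Fin 2) => by fin_cases a <;> rfl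

/-- The vector of the multiplicity space of a crystal given by a morphism. -/
def vec {A : Crystal} {n : ℕ} (α : BB n ⟶ A) : (toQ.obj A).V n →₀ ℚ := δ α

theorem vec_zero {A : Crystal} {n : ℕ} : vec (0 : BB n ⟶ A) = 0 := δ_zero

theorem vec_val {A : Crystal} {n : ℕ} (α : (toQ.obj A).V n) : vec α.1 = Finsupp.single α 1 :=
  δ_ne α

/-- The element of the multiplicity set given by a non-zero morphism. -/
def ofNe {A : Crystal} {n : ℕ} {α : BB n ⟶ A} (h : α ≠ 0) : (toQ.obj A).V n := ⟨α, h⟩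

theorem vec_of_ne {A : Crystal} {n : ℕ} {α : BB n ⟶ A} (h : α ≠ 0) :
    vec α = Finsupp.single (ofNe h) 1 := δ_ne ⟨α, h⟩

/-- Because `vec 0 = 0`, no distinction is needed according to whether the composite vanishes; this
is the advantage of `vec` over basis elements. -/
theorem toQ_vec {A B : Crystal} (f : A ⟶ B) {n : ℕ} (α : BB n ⟶ A) :
    (toQ.map f).app n (vec α) = vec (α ≫ f) := by
  by_cases h : α = 0
  · subst h
    rw [vec_zero, zero_comp, vec_zero, map_zero]
  · rw [vec_of_ne h]
    change Finsupp.linearCombination ℚ (fun α : mult n A => (δ (α.1 ≫ f) : mult n B →₀ ℚ))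
      (Finsupp.single (⟨α, h⟩ : mult n A) 1) = δ (α ≫ f)
    rw [Finsupp.linearCombination_single, one_smul]

theorem toQ_hom_ext {A : Crystal} {Z : CrystalsQ} {S T : toQ.obj A ⟶ Z}
    (h : ∀ (n : ℕ) (α : BB n ⟶ A), S.app n (vec α) = T.app n (vec α)) : S = T :=
  CrystalsQ.hom_ext_single fun n α => by rw [← vec_val, h]

instance toQ_preservesZeroMorphisms : toQ.PreservesZeroMorphisms where
  map_zero A B := toQ_hom_ext fun n α => by
    rw [toQ_vec, comp_zero, vec_zero]
    rfl

/-- The bijections between the set of `𝔹(n) = 𝔹(m)` and that of the non-zero morphisms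
`𝔹(n) ⟶ 𝔹(m)`. -/
def simpleEquiv (m n : ℕ) : (CrystalsQ.simple m).V n ≃ mult n (BB m) :=
  Equiv.ofBijective (fun h => ⟨eqToHom (congrArg BB h.down), by
    obtain ⟨rfl⟩ := h
    exact ne_zero_of (α := 𝟙 (BB n)) (i := 0) (id_toFun (A := BB n) (0 : Fin (n + 1)))⟩) (by
    constructor
    · rintro ⟨_⟩ ⟨_⟩ _
      rfl
    · intro α
      have h := mult_BB α
      obtain rfl : n = m := congrArg Sigma.fst h
      exact ⟨⟨rfl⟩, Subtype.ext (eq_of_heq (Sigma.mk.inj h).2).symm⟩)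

/-- The image of the crystal `𝔹(m)` is the object `𝔹(m)`. -/
def simpleIso (m : ℕ) : CrystalsQ.simple m ≅ toQ.obj (BB m) := CrystalsQ.ofEquiv (simpleEquiv m)

theorem simpleIso_hom_app (m : ℕ) :
    (simpleIso m).hom.app m (Finsupp.single ⟨rfl⟩ 1) = vec (𝟙 (BB m)) :=
  (CrystalsQ.ofMap_single (Y := toQ.obj (BB m)) (fun n => simpleEquiv m n) m ⟨rfl⟩ 1).trans
    (vec_val (A := BB m) (simpleEquiv m m ⟨rfl⟩)).symm

/-- This factorization is the one used by `tensEquiv`, which applies `rightComp` and then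
`leftComp`. -/
theorem whisker_tensor {A B : Crystal} {i j k : ℕ} (α : BB i ⟶ A) (β : BB j ⟶ B)
    (m : BB k ⟶ BB i ⊗ BB j) : m ≫ (α ⊗ₘ β) = (m ≫ BB i ◁ β) ≫ α ▷ B := by
  rw [Category.assoc, ← tensorHom_id, ← id_tensorHom, tensorHom_comp_tensorHom, Category.id_comp,
    Category.comp_id]

/-- The decomposition of a tensor product of crystals. -/
def tensEquiv (A B : Crystal) (k : ℕ) :
    (CrystalsQ.tens (toQ.obj A) (toQ.obj B)).V k ≃ mult k (A ⊗ B) :=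
  Equiv.ofBijective (fun b => leftComp A B k
    ⟨b.1.1, b.2.1, rightComp (BB b.1.1) B k ⟨b.1.2, b.2.2.2, b.2.2.1⟩⟩) (by
    constructor
    · rintro ⟨⟨i, j⟩, α, β, m⟩ ⟨⟨i', j'⟩, α', β', m'⟩ h
      have h1 := (leftComp_bijective A B k).1 h
      obtain rfl : i = i' := congrArg Sigma.fst h1
      have h2 := eq_of_heq (Sigma.mk.inj h1).2
      obtain rfl : α = α' := congrArg Prod.fst h2
      have h3 := (rightComp_bijective (BB i) B k).1 (congrArg Prod.snd h2)
      cases h3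
      rfl
    · intro x
      obtain ⟨⟨i, α, y⟩, rfl⟩ := (leftComp_bijective A B k).2 x
      obtain ⟨⟨j, m, β⟩, rfl⟩ := (rightComp_bijective (BB i) B k).2 y
      exact ⟨⟨(i, j), α, β, m⟩, rfl⟩)

/-- The tensor constraint of the functor from crystals. -/
def μIso (A B : Crystal) : toQ.obj A ⊗ toQ.obj B ≅ toQ.obj (A ⊗ B) :=
  CrystalsQ.ofEquiv (tensEquiv A B)

/-- The vector of the tensor product given by morphisms. -/
def tvec {A B : Crystal} {i j k : ℕ} (m : VV i j k) (α : BB i ⟶ A) (β : BB j ⟶ B) :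
    (CrystalsQ.tens (toQ.obj A) (toQ.obj B)).V k →₀ ℚ :=
  CrystalsQ.incl m (vec α) (vec β)

/-- Zero morphisms are allowed so that naturality squares need no case distinction; both sides then
vanish. For non-zero morphisms it is the definition of `tensEquiv`, rewritten by `whisker_tensor`.
-/
theorem μIso_tvec {A B : Crystal} {i j k : ℕ} (m : VV i j k) (α : BB i ⟶ A) (β : BB j ⟶ B) :
    (μIso A B).hom.app k (tvec m α β) = vec (m.1 ≫ (α ⊗ₘ β)) := by
  unfold tvec
  by_cases hα : α = 0
  · subst hα
    rw [ZeroTensor.zero_tensor, comp_zero, vec_zero, vec_zero, map_zero, LinearMap.zero_apply]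
    exact map_zero _
  by_cases hβ : β = 0
  · subst hβ
    rw [ZeroTensor.tensor_zero, comp_zero, vec_zero, vec_zero, map_zero]
    exact map_zero _
  rw [vec_of_ne hα, vec_of_ne hβ, CrystalsQ.incl_single]
  refine (CrystalsQ.ofMap_single (X := CrystalsQ.tens (toQ.obj A) (toQ.obj B))
    (Y := toQ.obj (A ⊗ B)) (fun k => tensEquiv A B k) k _ 1).trans ?_
  refine (vec_val (A := A ⊗ B) _).symm.trans ?_
  exact congrArg vec (whisker_tensor α β m.1).symm

theorem tens_hom_ext {A B : Crystal} {Z : CrystalsQ} {S T : toQ.obj A ⊗ toQ.obj B ⟶ Z}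
    (h : ∀ (i j k : ℕ) (m : VV i j k) (α : BB i ⟶ A) (β : BB j ⟶ B),
      S.app k (tvec m α β) = T.app k (tvec m α β)) : S = T :=
  CrystalsQ.hom_ext_single fun k b => by
    obtain ⟨i, j, α, β, m, rfl⟩ := CrystalsQ.eq_elt b
    have e : tvec m α.1 β.1 = Finsupp.single (CrystalsQ.elt α β m) 1 := by
      rw [tvec, vec_val, vec_val, CrystalsQ.incl_single]
    have := h i j k m α.1 β.1
    rw [e] at this
    exact this

theorem tens₃_hom_ext {A B D : Crystal} {Z : CrystalsQ}
    {S T : (toQ.obj A ⊗ toQ.obj B) ⊗ toQ.obj D ⟶ Z}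
    (h : ∀ (i j k a l : ℕ) (m : VV i j a) (m' : VV a k l) (α : BB i ⟶ A) (β : BB j ⟶ B)
      (γ : BB k ⟶ D),
      S.app l (CrystalsQ.incl (X := toQ.obj A ⊗ toQ.obj B) m' (tvec m α β) (vec γ)) =
        T.app l (CrystalsQ.incl (X := toQ.obj A ⊗ toQ.obj B) m' (tvec m α β) (vec γ))) : S = T :=
  CrystalsQ.hom_ext_single fun l b => by
    obtain ⟨a, k, x, γ, m', rfl⟩ := CrystalsQ.eq_elt b
    obtain ⟨i, j, α, β, m, rfl⟩ := CrystalsQ.eq_elt x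
    have e : tvec m α.1 β.1 = Finsupp.single (CrystalsQ.elt α β m) 1 := by
      rw [tvec, vec_val, vec_val, CrystalsQ.incl_single]
    have e' := CrystalsQ.incl_single (X := CrystalsQ.tens (toQ.obj A) (toQ.obj B)) m'
      (CrystalsQ.elt α β m) γ
    have := h i j k a l m m' α.1 β.1 γ.1
    rw [e, vec_val] at this
    refine (congrArg _ e').symm.trans (this.trans (congrArg _ e'))

theorem toQ_map_tvec {A B A' B' : Crystal} {i j k : ℕ} (m : VV i j k) (α : BB i ⟶ A)
    (β : BB j ⟶ B) (f : A ⟶ A') (g : B ⟶ B') :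
    (CrystalsQ.tensMap (toQ.map f) (toQ.map g)).app k (tvec m α β) =
      tvec m (α ≫ f) (β ≫ g) := by
  rw [tvec, CrystalsQ.tensMap_incl, toQ_vec, toQ_vec, tvec]

/-- Each diagram is evaluated on the vectors attached to morphisms out of the `𝔹(n)`, where by
`μIso_tvec` it becomes an identity between composites of crystal morphisms. Associativity holds
because the associator of `Crystals_ℚ` was defined by comparing precisely such composites. -/
instance toQMonoidal : toQ.Monoidal := Functor.CoreMonoidal.toMonoidal
  { εIso := simpleIso 0
    μIso := μIso
    μIso_hom_natural_left := by
      intro A B f D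
      refine tens_hom_ext fun i j k m α β => ?_
      have h1 := toQ_map_tvec m α β f (𝟙 D)
      rw [toQ.map_id] at h1
      refine (congrArg ((μIso B D).hom.app k) h1).trans ?_
      refine (μIso_tvec m _ _).trans ?_
      refine Eq.trans ?_ (congrArg ((toQ.map (f ▷ D)).app k) (μIso_tvec m α β)).symm
      rw [toQ_vec, Category.assoc, ← tensorHom_id, tensorHom_comp_tensorHom]
    μIso_hom_natural_right := by
      intro A B D f
      refine tens_hom_ext fun i j k m α β => ?_
      have h1 := toQ_map_tvec m α β (𝟙 D) f
      rw [toQ.map_id] at h1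
      refine (congrArg ((μIso D B).hom.app k) h1).trans ?_
      refine (μIso_tvec m _ _).trans ?_
      refine Eq.trans ?_ (congrArg ((toQ.map (D ◁ f)).app k) (μIso_tvec m α β)).symm
      rw [toQ_vec, Category.assoc, ← id_tensorHom, tensorHom_comp_tensorHom]
    associativity := by
      intro A B D
      refine tens₃_hom_ext fun i j k a l m m' α β γ => ?_
      obtain ⟨b, p, q, h⟩ := exists_assoc m m'
      have h1 : (CrystalsQ.tensMap (μIso A B).hom (𝟙 (toQ.obj D))).app l
          (CrystalsQ.incl (X := toQ.obj A ⊗ toQ.obj B) m' (tvec m α β) (vec γ)) =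
          tvec m' (m.1 ≫ (α ⊗ₘ β)) γ := by
        rw [CrystalsQ.tensMap_incl, μIso_tvec]
        rfl
      have h2 : (CrystalsQ.assocIso (toQ.obj A) (toQ.obj B) (toQ.obj D)).hom.app l
          (CrystalsQ.incl (X := toQ.obj A ⊗ toQ.obj B) m' (tvec m α β) (vec γ)) =
          CrystalsQ.incl (Y := toQ.obj B ⊗ toQ.obj D) p (vec α) (tvec q β γ) :=
        CrystalsQ.assoc_incl h _ _ _
      have h3 : (CrystalsQ.tensMap (𝟙 (toQ.obj A)) (μIso B D).hom).app l
          (CrystalsQ.incl (Y := toQ.obj B ⊗ toQ.obj D) p (vec α) (tvec q β γ)) =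
          tvec p α (q.1 ≫ (β ⊗ₘ γ)) := by
        rw [CrystalsQ.tensMap_incl, μIso_tvec]
        rfl
      have h4 : (m'.1 ≫ ((m.1 ≫ (α ⊗ₘ β)) ⊗ₘ γ)) ≫ (α_ A B D).hom =
          p.1 ≫ (α ⊗ₘ (q.1 ≫ (β ⊗ₘ γ))) := by
        have e1 : (m.1 ≫ (α ⊗ₘ β)) ⊗ₘ γ = m.1 ▷ BB k ≫ ((α ⊗ₘ β) ⊗ₘ γ) := by
          rw [← tensorHom_id, tensorHom_comp_tensorHom, Category.id_comp]
        have e2 : α ⊗ₘ (q.1 ≫ (β ⊗ₘ γ)) = BB i ◁ q.1 ≫ (α ⊗ₘ (β ⊗ₘ γ)) := by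
          rw [← id_tensorHom, tensorHom_comp_tensorHom, Category.id_comp]
        rw [e1, e2, reassoc_of% h, Category.assoc, Category.assoc,
          MonoidalCategory.associator_naturality]
      refine (congrArg (fun v => (toQ.map (α_ A B D).hom).app l ((μIso (A ⊗ B) D).hom.app l v))
        h1).trans ?_
      rw [μIso_tvec, toQ_vec, h4, ← μIso_tvec, ← h3, ← h2]
      rfl
    left_unitality := by
      intro A
      -- The unit constraint of `Crystals_ℚ` is explicit only through its inverse, so the diagram is
      -- read starting from the image of `A`.
      refine (Category.comp_id _).symm.trans ((Iso.inv_comp_eq (λ_ (toQ.obj A))).mp ?_).symm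
      refine toQ_hom_ext fun n α => ?_
      have h1 := CrystalsQ.leftIso_inv_app (toQ.obj A) n (vec α)
      have h2 : (CrystalsQ.tensMap (simpleIso 0).hom (𝟙 (toQ.obj A))).app n
          (CrystalsQ.incl (CrystalsQ.leftMult n) CrystalsQ.unitElt (vec α)) =
          tvec (CrystalsQ.leftMult n) (𝟙 (BB 0)) α := by
        rw [CrystalsQ.tensMap_incl, CrystalsQ.unitElt, simpleIso_hom_app]
        rfl
      refine (congrArg (fun v => (toQ.map (λ_ A).hom).app n ((μIso (BB 0) A).hom.app n
        ((CrystalsQ.tensMap (simpleIso 0).hom (𝟙 (toQ.obj A))).app n v))) h1).trans ?_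
      rw [h2, μIso_tvec, toQ_vec]
      refine congrArg vec ?_
      change ((λ_ (BB n)).inv ≫ (𝟙 (𝟙_ Crystal) ⊗ₘ α)) ≫ _ = α
      simp
    right_unitality := by
      intro A
      refine (Category.comp_id _).symm.trans ((Iso.inv_comp_eq (ρ_ (toQ.obj A))).mp ?_).symm
      refine toQ_hom_ext fun n α => ?_
      have h1 := CrystalsQ.rightIso_inv_app (toQ.obj A) n (vec α)
      have h2 : (CrystalsQ.tensMap (𝟙 (toQ.obj A)) (simpleIso 0).hom).app n
          (CrystalsQ.incl (CrystalsQ.rightMult n) (vec α) CrystalsQ.unitElt) =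
          tvec (CrystalsQ.rightMult n) α (𝟙 (BB 0)) := by
        rw [CrystalsQ.tensMap_incl, CrystalsQ.unitElt, simpleIso_hom_app]
        rfl
      refine (congrArg (fun v => (toQ.map (ρ_ A).hom).app n ((μIso A (BB 0)).hom.app n
        ((CrystalsQ.tensMap (𝟙 (toQ.obj A)) (simpleIso 0).hom).app n v))) h1).trans ?_
      rw [h2, μIso_tvec, toQ_vec]
      refine congrArg vec ?_
      change ((ρ_ (BB n)).inv ≫ (α ⊗ₘ 𝟙 (𝟙_ Crystal))) ≫ _ = α
      simp }

end Crystal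

/-! ### `𝒪^ℤ` is linear, additive and pseudo-abelian -/

namespace VectZ

instance instLinear : Linear ℂ VectZ where
  homModule V W := (homEquiv V W).module ℂ
  smul_comp _ _ _ c f g := hom_ext fun i v => map_smul (g.app i) c (f.app i v)
  comp_smul _ _ _ _ _ _ := rfl

theorem shift_map_smul (n : ℤ) {V W : VectZ} (c : ℂ) (f : V ⟶ W) :
    (shift n).map (c • f) = c • (shift n).map f := rfl

/-- The first inclusion. -/
def inl (V W : VectZ) : V ⟶ V.sum W := ⟨fun _ => LinearMap.inl ℂ _ _⟩

/-- The second inclusion. -/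
def inr (V W : VectZ) : W ⟶ V.sum W := ⟨fun _ => LinearMap.inr ℂ _ _⟩

/-- The first projection. -/
def fst (V W : VectZ) : V.sum W ⟶ V := ⟨fun _ => LinearMap.fst ℂ _ _⟩

/-- The second projection. -/
def snd (V W : VectZ) : V.sum W ⟶ W := ⟨fun _ => LinearMap.snd ℂ _ _⟩

theorem total (V W : VectZ) : fst V W ≫ inl V W + snd V W ≫ inr V W = 𝟙 (V.sum W) :=
  hom_ext fun _ v => Prod.ext (add_zero v.1) (zero_add v.2)

/-- The image of an endomorphism. -/
def range {V : VectZ} (p : V ⟶ V) : VectZ where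
  V i := LinearMap.range (p.app i)
  finite i := by
    have := V.finite i
    infer_instance
  bounded := V.bounded.subset fun _ hi =>
    have : Nontrivial _ := hi
    (Subtype.val_injective (p := fun v => v ∈ LinearMap.range (p.app _))).nontrivial

/-- The inclusion of the image. -/
def rangeι {V : VectZ} (p : V ⟶ V) : range p ⟶ V := ⟨fun i => (LinearMap.range (p.app i)).subtype⟩

/-- The projection to the image. -/
def rangeπ {V : VectZ} (p : V ⟶ V) : V ⟶ range p := ⟨fun i => (p.app i).rangeRestrict⟩

theorem rangeι_π {V : VectZ} (p : V ⟶ V) (hp : p ≫ p = p) : rangeι p ≫ rangeπ p = 𝟙 _ :=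
  hom_ext fun i v => by
    obtain ⟨_, w, rfl⟩ := v
    exact Subtype.ext (LinearMap.congr_fun (congrArg (fun q => Hom.app q i) hp) w)

end VectZ

namespace OZero

open VectZ

instance instSMul (X Y : OZero) : SMul ℂ (X ⟶ Y) where
  smul c f := ⟨c • f.ψ, c • f.φ,
    by rw [shift_map_smul, Linear.comp_smul, Linear.smul_comp, f.var],
    by rw [shift_map_smul, Linear.comp_smul, Linear.smul_comp, f.can]⟩

/-- The components of a morphism. -/
def homs_hom (X Y : OZero) : (X ⟶ Y) →+ (X.Ψ ⟶ Y.Ψ) × (X.Φ ⟶ Y.Φ) where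
  toFun f := (f.ψ, f.φ)
  map_zero' := rfl
  map_add' _ _ := rfl

theorem homs_hom_injective (X Y : OZero) : Function.Injective (homs_hom X Y) := fun _ _ h =>
  hom_ext (congrArg Prod.fst h) (congrArg Prod.snd h)

instance instLinear : Linear ℂ OZero where
  homModule X Y := (homs_hom_injective X Y).module ℂ (homs_hom X Y) fun _ _ => rfl
  smul_comp _ _ _ c f g := hom_ext (Linear.smul_comp _ _ _ c f.ψ g.ψ)
    (Linear.smul_comp _ _ _ c f.φ g.φ)
  comp_smul _ _ _ f c g := hom_ext (Linear.comp_smul _ _ _ f.ψ c g.ψ)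
    (Linear.comp_smul _ _ _ f.φ c g.φ)

/-- The first inclusion. -/
def inl (X Y : OZero) : X ⟶ X.sum Y where
  ψ := VectZ.inl X.Ψ Y.Ψ
  φ := VectZ.inl X.Φ Y.Φ
  var := VectZ.hom_ext fun i _ => Prod.ext rfl (map_zero (Y.var.app i)).symm
  can := VectZ.hom_ext fun i _ => Prod.ext rfl (map_zero (Y.can.app i)).symm

/-- The second inclusion. -/
def inr (X Y : OZero) : Y ⟶ X.sum Y where
  ψ := VectZ.inr X.Ψ Y.Ψ
  φ := VectZ.inr X.Φ Y.Φ
  var := VectZ.hom_ext fun i _ => Prod.ext (map_zero (X.var.app i)).symm rfl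
  can := VectZ.hom_ext fun i _ => Prod.ext (map_zero (X.can.app i)).symm rfl

/-- The first projection. -/
def fst (X Y : OZero) : X.sum Y ⟶ X where
  ψ := VectZ.fst X.Ψ Y.Ψ
  φ := VectZ.fst X.Φ Y.Φ
  var := rfl
  can := rfl

/-- The second projection. -/
def snd (X Y : OZero) : X.sum Y ⟶ Y where
  ψ := VectZ.snd X.Ψ Y.Ψ
  φ := VectZ.snd X.Φ Y.Φ
  var := rfl
  can := rfl

theorem inl_snd (X Y : OZero) : inl X Y ≫ snd X Y = 0 := rfl

theorem total (X Y : OZero) : fst X Y ≫ inl X Y + snd X Y ≫ inr X Y = 𝟙 (X.sum Y) :=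
  hom_ext (VectZ.total _ _) (VectZ.total _ _)

theorem var_apply {X Y : OZero} (f : X ⟶ Y) (i : ℤ) (v : X.Φ.V i) :
    f.ψ.app (i - -1) (X.var.app i v) = Y.var.app i (f.φ.app i v) :=
  LinearMap.congr_fun (congrArg (fun q => VectZ.Hom.app q i) f.var) v

theorem can_apply {X Y : OZero} (f : X ⟶ Y) (i : ℤ) (v : X.Ψ.V i) :
    f.φ.app (i - -1) (X.can.app i v) = Y.can.app i (f.ψ.app i v) :=
  LinearMap.congr_fun (congrArg (fun q => VectZ.Hom.app q i) f.can) v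

/-- The image of an endomorphism. -/
def range {X : OZero} (p : X ⟶ X) : OZero where
  Ψ := VectZ.range p.ψ
  Φ := VectZ.range p.φ
  var := ⟨fun i => (X.var.app i).restrict (p := LinearMap.range (p.φ.app i))
    (q := LinearMap.range (p.ψ.app (i - -1))) (by
      rintro _ ⟨v, rfl⟩
      exact ⟨X.var.app i v, var_apply p i v⟩)⟩
  can := ⟨fun i => (X.can.app i).restrict (p := LinearMap.range (p.ψ.app i))
    (q := LinearMap.range (p.φ.app (i - -1))) (by
      rintro _ ⟨v, rfl⟩
      exact ⟨X.can.app i v, can_apply p i v⟩)⟩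
  var_can := VectZ.hom_ext fun i v => Subtype.ext
    (LinearMap.congr_fun (congrArg (fun q => VectZ.Hom.app q i) X.var_can) v.1)

theorem IsTrivial.range {X : OZero} (hX : X.IsTrivial) (p : X ⟶ X) :
    (OZero.range p).IsTrivial := by
  constructor
  · intro i
    have := hX.1 i
    exact inferInstanceAs (Subsingleton (LinearMap.range (p.ψ.app i)))
  · intro i
    have := hX.2 i
    exact inferInstanceAs (Subsingleton (LinearMap.range (p.φ.app i)))

/-- The inclusion of the image. -/
def rangeι {X : OZero} (p : X ⟶ X) : range p ⟶ X where
  ψ := VectZ.rangeι p.ψ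
  φ := VectZ.rangeι p.φ
  var := rfl
  can := rfl

/-- The projection to the image. -/
def rangeπ {X : OZero} (p : X ⟶ X) : X ⟶ range p where
  ψ := VectZ.rangeπ p.ψ
  φ := VectZ.rangeπ p.φ
  var := VectZ.hom_ext fun i v => Subtype.ext (var_apply p i v)
  can := VectZ.hom_ext fun i v => Subtype.ext (can_apply p i v)

theorem rangeι_π {X : OZero} (p : X ⟶ X) (hp : p ≫ p = p) : rangeι p ≫ rangeπ p = 𝟙 _ :=
  hom_ext (VectZ.rangeι_π p.ψ (congrArg Hom.ψ hp)) (VectZ.rangeι_π p.φ (congrArg Hom.φ hp))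

end OZero

namespace OZ

instance instLinearComplex : Linear ℂ OZ where
  homModule X Y := (homEquiv X Y).module ℂ
  smul_comp _ _ _ c f g := hom_ext (Linear.smul_comp _ _ _ c f.sing g.sing)
    fun k => Linear.smul_comp _ _ _ c (f.reg k) (g.reg k)
  comp_smul _ _ _ f c g := hom_ext (Linear.comp_smul _ _ _ f.sing c g.sing)
    fun k => Linear.comp_smul _ _ _ (f.reg k) c (g.reg k)

/-- Restriction of scalars along `ℚ ⊂ ℂ`; the extension of functors to `𝒞` uses only this structure.
-/
instance instLinear : Linear ℚ OZ where
  homModule _ _ := Module.compHom _ (algebraMap ℚ ℂ)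
  smul_comp _ _ _ c f g := Linear.smul_comp (R := ℂ) _ _ _ (algebraMap ℚ ℂ c) f g
  comp_smul _ _ _ f c g := Linear.comp_smul (R := ℂ) _ _ _ f (algebraMap ℚ ℂ c) g

/-- The zero object. -/
def zeroObj : OZ where
  sing := ⟨fun _ => PUnit, fun _ => inferInstance,
    Set.finite_empty.subset fun _ h => (not_nontrivial PUnit h).elim⟩
  reg _ := ⟨⟨fun _ => PUnit, fun _ => inferInstance,
    Set.finite_empty.subset fun _ h => (not_nontrivial PUnit h).elim⟩,
    ⟨fun _ => PUnit, fun _ => inferInstance,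
    Set.finite_empty.subset fun _ h => (not_nontrivial PUnit h).elim⟩, 0, 0, rfl⟩
  finite := Set.finite_empty.subset fun _ h =>
    (h ⟨fun _ => inferInstanceAs (Subsingleton PUnit),
      fun _ => inferInstanceAs (Subsingleton PUnit)⟩).elim

/-- The direct sum. -/
def sum (X Y : OZ) : OZ where
  sing := X.sing.sum Y.sing
  reg k := (X.reg k).sum (Y.reg k)
  finite := (X.finite.union Y.finite).subset fun k hk => by
    by_contra h
    simp only [Set.mem_union, Set.mem_ofPred_eq, not_or, not_not] at h hk
    exact hk (h.1.sum h.2)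

instance instHasFiniteBiproducts : HasFiniteBiproducts OZ :=
  hasFiniteBiproducts_of_isZero_of_sum zeroObj rfl fun X Y =>
    ⟨sum X Y, ⟨VectZ.inl _ _, fun _ => OZero.inl _ _⟩, ⟨VectZ.inr _ _, fun _ => OZero.inr _ _⟩,
      ⟨VectZ.fst _ _, fun _ => OZero.fst _ _⟩, ⟨VectZ.snd _ _, fun _ => OZero.snd _ _⟩,
      rfl, rfl, rfl, rfl, hom_ext (VectZ.total _ _) fun _ => OZero.total _ _⟩

/-- Images are taken block by block; `var` and `can` restrict to them because they commute with the
idempotent, and the image in a trivial block is trivial. -/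
instance instIsIdempotentComplete : IsIdempotentComplete OZ where
  idempotents_split X p hp :=
    ⟨⟨VectZ.range p.sing, fun k => OZero.range (p.reg k),
      X.finite.subset fun _ hk h => hk (h.range _)⟩,
      ⟨VectZ.rangeι _, fun _ => OZero.rangeι _⟩, ⟨VectZ.rangeπ _, fun _ => OZero.rangeπ _⟩,
      hom_ext (VectZ.rangeι_π _ (congrArg Hom.sing hp))
        fun k => OZero.rangeι_π _ (congrArg (fun q => Hom.reg q k) hp), rfl⟩

instance F_additive : F.Additive where
  map_add := hom_ext rfl fun k => by cases k <;> rfl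

end OZ

/-! ### Additive endofunctors -/

/-- The additive endofunctors of a category. -/
structure AddEnd (D : Type*) [Category D] [Preadditive D] where
  functor : D ⥤ D
  additive : functor.Additive

namespace AddEnd

variable {D : Type*} [Category D] [Preadditive D]

instance instCat : Category (AddEnd D) where
  Hom X Y := X.functor ⟶ Y.functor
  id X := 𝟙 X.functor
  comp f g := NatTrans.vcomp f g

theorem hom_ext {X Y : AddEnd D} {f g : X ⟶ Y} (h : ∀ A, f.app A = g.app A) : f = g :=
  NatTrans.ext (funext h)

theorem comp_app {X Y Z : AddEnd D} (f : X ⟶ Y) (g : Y ⟶ Z) (A : D) :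
    (f ≫ g).app A = f.app A ≫ g.app A := rfl

theorem id_app (X : AddEnd D) (A : D) : NatTrans.app (𝟙 X) A = 𝟙 _ := rfl

instance instPreadditive : Preadditive (AddEnd D) where
  homGroup X Y := inferInstanceAs (AddCommGroup (X.functor ⟶ Y.functor))
  add_comp X Y Z f f' g := Preadditive.add_comp X.functor Y.functor Z.functor f f' g
  comp_add X Y Z f g g' := Preadditive.comp_add X.functor Y.functor Z.functor f g g'

instance instLinear [Linear ℚ D] : Linear ℚ (AddEnd D) where
  homModule X Y := inferInstanceAs (Module ℚ (X.functor ⟶ Y.functor))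
  smul_comp X Y Z c f g := Linear.smul_comp X.functor Y.functor Z.functor c f g
  comp_smul X Y Z f c g := Linear.comp_smul X.functor Y.functor Z.functor f c g

instance instMonoidalStruct : MonoidalCategoryStruct (AddEnd D) where
  tensorObj X Y := ⟨Y.functor ⋙ X.functor, by
    have := X.additive
    have := Y.additive
    infer_instance⟩
  tensorHom f g := NatTrans.hcomp g f
  whiskerLeft X _ _ f := Functor.whiskerRight f X.functor
  whiskerRight f Y := Functor.whiskerLeft Y.functor f
  tensorUnit := ⟨𝟭 D, inferInstance⟩
  associator X Y Z := ⟨𝟙 (Z.functor ⋙ Y.functor ⋙ X.functor), 𝟙 (Z.functor ⋙ Y.functor ⋙ X.functor),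
    Category.id_comp (𝟙 (Z.functor ⋙ Y.functor ⋙ X.functor)),
    Category.id_comp (𝟙 (Z.functor ⋙ Y.functor ⋙ X.functor))⟩
  leftUnitor X := ⟨𝟙 X.functor, 𝟙 X.functor, Category.id_comp (𝟙 X.functor),
    Category.id_comp (𝟙 X.functor)⟩
  rightUnitor X := ⟨𝟙 X.functor, 𝟙 X.functor, Category.id_comp (𝟙 X.functor),
    Category.id_comp (𝟙 X.functor)⟩

theorem tensorHom_app {W X Y Z : AddEnd D} (f : W ⟶ Y) (g : X ⟶ Z) (A : D) :
    (f ⊗ₘ g).app A = f.app (X.functor.obj A) ≫ Y.functor.map (g.app A) := rfl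

theorem whiskerLeft_app (X : AddEnd D) {Y Z : AddEnd D} (f : Y ⟶ Z) (A : D) :
    (X ◁ f).app A = X.functor.map (f.app A) := rfl

theorem whiskerRight_app {X Y : AddEnd D} (f : X ⟶ Y) (Z : AddEnd D) (A : D) :
    (f ▷ Z).app A = f.app (Z.functor.obj A) := rfl

theorem associator_hom_app (X Y Z : AddEnd D) (A : D) : (α_ X Y Z).hom.app A = 𝟙 _ := rfl
theorem leftUnitor_hom_app (X : AddEnd D) (A : D) : (λ_ X).hom.app A = 𝟙 _ := rfl
theorem rightUnitor_hom_app (X : AddEnd D) (A : D) : (ρ_ X).hom.app A = 𝟙 _ := rfl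

instance instMonoidal : MonoidalCategory (AddEnd D) := MonoidalCategory.ofTensorHom
  (id_tensorHom_id := fun X Y => hom_ext fun A => by
    rw [tensorHom_app]
    exact (Category.id_comp _).trans (X.functor.map_id _))
  (id_tensorHom := fun X Y Z f => hom_ext fun A => by
    rw [tensorHom_app, whiskerLeft_app]
    exact Category.id_comp _)
  (tensorHom_id := fun {X Y} f Z => hom_ext fun A => by
    rw [tensorHom_app, whiskerRight_app]
    exact (congrArg _ (Y.functor.map_id _)).trans (Category.comp_id _))
  (tensorHom_comp_tensorHom := fun {X₁ Y₁ Z₁ X₂ Y₂ Z₂} f₁ f₂ g₁ g₂ => hom_ext fun A => by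
    rw [comp_app, tensorHom_app, tensorHom_app, tensorHom_app, comp_app, comp_app,
      Functor.map_comp]
    simp only [Category.assoc]
    have := g₁.naturality (f₂.app A)
    rw [reassoc_of% this])
  (associator_naturality := fun {X₁ X₂ X₃ Y₁ Y₂ Y₃} f₁ f₂ f₃ => hom_ext fun A => by
    rw [comp_app, comp_app, tensorHom_app, tensorHom_app, tensorHom_app, tensorHom_app,
      associator_hom_app, associator_hom_app, Functor.map_comp]
    refine (Category.comp_id _).trans ((Category.assoc _ _ _).trans (Category.id_comp _).symm))
  (leftUnitor_naturality := fun {X Y} f => hom_ext fun A => by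
    rw [comp_app, comp_app, tensorHom_app, leftUnitor_hom_app, leftUnitor_hom_app]
    exact (Category.comp_id _).trans rfl)
  (rightUnitor_naturality := fun {X Y} f => hom_ext fun A => by
    rw [comp_app, comp_app, tensorHom_app, rightUnitor_hom_app, rightUnitor_hom_app]
    refine (Category.comp_id _).trans (Eq.trans ?_ (Category.id_comp _).symm)
    exact (congrArg _ (Y.functor.map_id _)).trans (Category.comp_id _))
  (pentagon := fun W X Y Z => hom_ext fun A => by
    simp only [comp_app, tensorHom_app, associator_hom_app, id_app]
    simp only [CategoryTheory.Functor.map_id, Category.comp_id]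
    exact (Category.id_comp _).trans
      (Category.comp_id (𝟙 (W.functor.obj (X.functor.obj (Y.functor.obj (Z.functor.obj A)))))))
  (triangle := fun X Y => hom_ext fun A => by
    simp only [comp_app, tensorHom_app, associator_hom_app, id_app]
    simp only [CategoryTheory.Functor.map_id, Category.comp_id, Category.id_comp]
    exact X.functor.map_id _)

/-- Whiskering on the left by `X` applies the functor `X` to components, so additivity in the second
variable is exactly the additivity of `X`. For this reason the construction takes place in additive
endofunctors. -/
instance instMonoidalPreadditive : MonoidalPreadditive (AddEnd D) where
  whiskerLeft_zero {X _ _} := hom_ext fun _ => have := X.additive; X.functor.map_zero _ _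
  zero_whiskerRight := rfl
  whiskerLeft_add {X _ _} _ _ := hom_ext fun _ => X.additive.map_add
  add_whiskerRight _ _ := rfl

/-- By naturality `S(f)` is the sum of a conjugate of `X(f)` and one of `Y(f)`, hence additive in
`f`. This covers direct sums and, when some of the maps are zero, direct summands and the zero
functor. -/
theorem additive_of_total {S : D ⥤ D} (X Y : AddEnd D) (fst : S ⟶ X.functor) (inl : X.functor ⟶ S)
    (snd : S ⟶ Y.functor) (inr : Y.functor ⟶ S) (h : fst ≫ inl + snd ≫ inr = 𝟙 S) :
    S.Additive where
  map_add {A B} f g := by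
    have := X.additive
    have := Y.additive
    have key : ∀ f : A ⟶ B, S.map f = fst.app A ≫ X.functor.map f ≫ inl.app B +
        snd.app A ≫ Y.functor.map f ≫ inr.app B := fun f => by
      have h' : fst.app B ≫ inl.app B + snd.app B ≫ inr.app B = 𝟙 _ :=
        congrArg (fun q : S ⟶ S => q.app B) h
      rw [← fst.naturality_assoc, ← snd.naturality_assoc, ← Preadditive.comp_add, h',
        Category.comp_id]
    rw [key, key f, key g, Functor.map_add, Functor.map_add]
    simp only [Preadditive.add_comp, Preadditive.comp_add]
    abel

instance instHasFiniteBiproducts [HasFiniteBiproducts D] : HasFiniteBiproducts (AddEnd D) := by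
  have : HasFiniteBiproducts (D ⥤ D) := HasFiniteBiproducts.of_hasFiniteProducts
  have : HasBinaryBiproducts (D ⥤ D) := hasBinaryBiproducts_of_finite_biproducts _
  have : HasZeroObject D := hasZeroObject_of_hasFiniteBiproducts D
  obtain ⟨Z, hZ'⟩ := HasZeroObject.zero (C := D)
  have hZ : 𝟙 ((Functor.const D).obj Z) = 0 := NatTrans.ext (funext fun _ => hZ'.eq_of_src _ _)
  refine hasFiniteBiproducts_of_isZero_of_sum
    ⟨(Functor.const D).obj Z, additive_of_total (𝟙_ _) (𝟙_ _) 0 0 0 0 ?_⟩ hZ fun X Y =>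
    ⟨⟨X.functor ⊞ Y.functor, additive_of_total X Y biprod.fst biprod.inl biprod.snd biprod.inr
      biprod.total⟩, (biprod.inl : X.functor ⟶ X.functor ⊞ Y.functor),
      (biprod.inr : Y.functor ⟶ X.functor ⊞ Y.functor),
      (biprod.fst : X.functor ⊞ Y.functor ⟶ X.functor),
      (biprod.snd : X.functor ⊞ Y.functor ⟶ Y.functor), biprod.inl_fst (X := X.functor) (Y := Y.functor),
      biprod.inl_snd (X := X.functor) (Y := Y.functor),
      biprod.inr_fst (X := X.functor) (Y := Y.functor),
      biprod.inr_snd (X := X.functor) (Y := Y.functor), biprod.total (X := X.functor) (Y := Y.functor)⟩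
  rw [hZ, comp_zero, add_zero]

instance instIsIdempotentComplete [IsIdempotentComplete D] : IsIdempotentComplete (AddEnd D) where
  idempotents_split X p hp := by
    obtain ⟨S, i, e, h, h'⟩ := IsIdempotentComplete.idempotents_split X.functor p hp
    refine ⟨⟨S, additive_of_total X X i e 0 0 ?_⟩, i, e, h, h'⟩
    rw [h, comp_zero, add_zero]

end AddEnd

/-! ### The action of `F` -/

theorem VectZ.inl_sumMap {V W V' W' : VectZ} (f : V ⟶ V') (g : W ⟶ W') :
    inl V W ≫ sumMap f g = f ≫ inl V' W' :=
  hom_ext fun i _ => Prod.ext rfl (map_zero (g.app i))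

theorem VectZ.inr_sumMap {V W V' W' : VectZ} (f : V ⟶ V') (g : W ⟶ W') :
    inr V W ≫ sumMap f g = g ≫ inr V' W' :=
  hom_ext fun i _ => Prod.ext (map_zero (f.app i)) rfl

theorem OZero.inl_sumMap {X Y X' Y' : OZero} (f : X ⟶ X') (g : Y ⟶ Y') :
    inl X Y ≫ sumMap f g = f ≫ inl X' Y' :=
  hom_ext (VectZ.inl_sumMap _ _) (VectZ.inl_sumMap _ _)

theorem OZero.inr_sumMap {X Y X' Y' : OZero} (f : X ⟶ X') (g : Y ⟶ Y') :
    inr X Y ≫ sumMap f g = g ≫ inr X' Y' :=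
  hom_ext (VectZ.inr_sumMap _ _) (VectZ.inr_sumMap _ _)

/-- Naturality of `OZ.cup` in block `-1`; `OZero.inl_inr_naturality` serves for the blocks `k ≥ 0`.
-/
theorem VectZ.inr_inl_naturality {V W U V' W' U' : VectZ} (f : V ⟶ V') (g : W ⟶ W')
    (h : U ⟶ U') : g ≫ inr V' W' ≫ inl (V'.sum W') U' =
      (inr V W ≫ inl (V.sum W) U) ≫ sumMap (sumMap f g) h := by
  rw [Category.assoc, inl_sumMap, ← Category.assoc, ← Category.assoc, inr_sumMap]

theorem OZero.inl_inr_naturality {X Y Z X' Y' Z' : OZero} (f : X ⟶ X') (g : Y ⟶ Y')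
    (h : Z ⟶ Z') : g ≫ inl Y' Z' ≫ inr X' (Y'.sum Z') =
      (inl Y Z ≫ inr X (Y.sum Z)) ≫ sumMap f (sumMap g h) := by
  rw [Category.assoc, inr_sumMap, ← Category.assoc, ← Category.assoc, inl_sumMap]

/-- Used for the first zigzag on `𝒪^ℤ`: the inclusion lands in the summand `Y`, which `snd`
annihilates. -/
theorem OZero.inl_inr_sumMap_snd {X Y Z X' W : OZero} (f : X ⟶ X') (g : Z ⟶ W) :
    (inl Y Z ≫ inr X (Y.sum Z)) ≫ sumMap f (snd Y Z ≫ g) = 0 := by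
  rw [Category.assoc, inr_sumMap, ← Category.assoc, ← Category.assoc, inl_snd, zero_comp,
    zero_comp]

namespace OZ

/-- The embedding of the additive endofunctors. -/
def endEmbedding : AddEnd OZ ⥤ EndOZ where
  obj X := MonoidalOpposite.mop X.functor
  map f := Quiver.Hom.mop f
  map_id _ := rfl
  map_comp _ _ := rfl

/-- On both sides the tensor product of `G` and `H` is `G ∘ H`, so the constraints are identities.
-/
instance endEmbeddingMonoidal : endEmbedding.Monoidal := Functor.CoreMonoidal.toMonoidal
  { εIso := Iso.refl _
    μIso := fun X Y => Iso.refl (MonoidalOpposite.mop (Y.functor ⋙ X.functor))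
    μIso_hom_natural_left := fun f Z => (Category.comp_id _).trans (Category.id_comp _).symm
    μIso_hom_natural_right := fun Z f => (Category.comp_id _).trans (Category.id_comp _).symm
    associativity := fun X Y Z => by
      refine Quiver.Hom.unmop_inj (NatTrans.ext (funext fun A => ?_))
      have h : X.functor.map (𝟙 (Y.functor.obj (Z.functor.obj A))) = 𝟙 _ := X.functor.map_id _
      change 𝟙 (X.functor.obj (Y.functor.obj (Z.functor.obj A))) ≫ 𝟙 _ ≫ 𝟙 _ =
        𝟙 _ ≫ X.functor.map (𝟙 (Y.functor.obj (Z.functor.obj A))) ≫ 𝟙 _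
      rw [h]
    left_unitality := fun X => by
      refine Quiver.Hom.unmop_inj (NatTrans.ext (funext fun A => ?_))
      change 𝟙 (X.functor.obj A) = 𝟙 _ ≫ 𝟙 _ ≫ 𝟙 _
      simp
    right_unitality := fun X => by
      refine Quiver.Hom.unmop_inj (NatTrans.ext (funext fun A => ?_))
      change 𝟙 (X.functor.obj A) = X.functor.map (𝟙 A) ≫ 𝟙 _ ≫ 𝟙 _
      simp }

/-- `F` as an additive endofunctor. -/
def addF : AddEnd OZ := ⟨F, F_additive⟩

/-- The inclusion of the identity in `F²`: the summand of `F(F(X))` obtained by going from the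
block `k` to the block `k + 1` and back. -/
def cup : 𝟙_ (AddEnd OZ) ⟶ addF ⊗ addF where
  app X := ⟨VectZ.inr ((VectZ.shift 2).obj X.sing) X.sing ≫
      VectZ.inl (((VectZ.shift 2).obj X.sing).sum X.sing) (X.reg 1).Φ, fun
    | 0 => OZero.inl (X.reg 0) (X.reg 2) ≫ OZero.inr (piUpper.obj (F.obj X).sing) (fReg X 1)
    | k + 1 => OZero.inl (X.reg (k + 1)) (X.reg (k + 3)) ≫ OZero.inr (fReg X k) (fReg X (k + 2))⟩
  naturality X Y f := by
    refine hom_ext ?_ fun k => ?_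
    · exact VectZ.inr_inl_naturality _ _ _
    · cases k with
      | zero => exact OZero.inl_inr_naturality _ _ _
      | succ k => exact OZero.inl_inr_naturality _ _ _

/-- The projection of `F²` to the identity. -/
def cap : addF ⊗ addF ⟶ 𝟙_ (AddEnd OZ) where
  app X := ⟨VectZ.fst (((VectZ.shift 2).obj X.sing).sum X.sing) (X.reg 1).Φ ≫
      VectZ.snd ((VectZ.shift 2).obj X.sing) X.sing, fun
    | 0 => OZero.snd (piUpper.obj (F.obj X).sing) (fReg X 1) ≫ OZero.fst (X.reg 0) (X.reg 2)
    | k + 1 => OZero.snd (fReg X k) (fReg X (k + 2)) ≫ OZero.fst (X.reg (k + 1)) (X.reg (k + 3))⟩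
  naturality X Y f := hom_ext rfl fun k => by cases k <;> rfl

/-- The data on additive endofunctors given by `F`. -/
def datum : CPrime.Datum (AddEnd OZ) where
  F := addF
  zero := ⟨(Functor.const OZ).obj zeroObj, ⟨by intros; rfl⟩⟩
  id_zero := rfl
  cup := cup
  cap := cap
  cup_cap := AddEnd.hom_ext fun X => hom_ext rfl fun k => by cases k <;> rfl
  zigzag_left := AddEnd.hom_ext fun X => by
    -- The summands of `F³` are paths of three steps between neighbouring blocks. Here `cup` at `F
    -- X` creates paths whose last two steps are up and down, while `F(cap)` keeps those whose first
    -- two steps are up and down. The middle step cannot be both.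
    have h : cup.app (F.obj X) ≫ F.map (cap.app X) = 0 := by
      refine hom_ext rfl fun k => ?_
      cases k with
      | zero => exact OZero.inl_inr_sumMap_snd _ _
      | succ k => exact OZero.inl_inr_sumMap_snd _ _
    refine (Category.id_comp _).trans ?_
    refine (congrArg (cup.app (F.obj X) ≫ ·) ((Category.id_comp _).trans
      (Category.comp_id (F.map (cap.app X))))).trans h
  zigzag_right := AddEnd.hom_ext fun X => by
    -- Now `F(cup)` makes the middle step go down, whereas `cap` at `F X` requires it to go up.
    have h : F.map (cup.app X) ≫ cap.app (F.obj X) = 0 :=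
      hom_ext rfl fun k => by cases k <;> rfl
    refine (Category.id_comp _).trans ?_
    refine (congrArg (F.map (cup.app X) ≫ ·) ((Category.id_comp _).trans
      (Category.comp_id (cap.app (F.obj X))))).trans h

end OZ

/-! ### The simple objects generated by a self-dual object -/

namespace CPrime.Datum

section Simples

variable {V : Type*} [Category V] [Preadditive V] [MonoidalCategory V] [MonoidalPreadditive V]
  (d : Datum V)

/-- The map `X ⟶ X ⊗ F²`. -/
def cupAt (X : V) : X ⟶ (X ⊗ d.F) ⊗ d.F := (ρ_ X).inv ≫ X ◁ d.cup ≫ (α_ X d.F d.F).inv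

/-- The map `X ⊗ F² ⟶ X`. -/
def capAt (X : V) : (X ⊗ d.F) ⊗ d.F ⟶ X := (α_ X d.F d.F).hom ≫ X ◁ d.cap ≫ (ρ_ X).hom

theorem cupAt_capAt (X : V) : d.cupAt X ≫ d.capAt X = 𝟙 X := by
  simp [cupAt, capAt, ← MonoidalCategory.whiskerLeft_comp_assoc, d.cup_cap]

theorem cupAt_naturality {X Y : V} (f : X ⟶ Y) :
    d.cupAt X ≫ (f ▷ d.F) ▷ d.F = f ≫ d.cupAt Y := by
  simp only [cupAt, Category.assoc, ← associator_inv_naturality_left]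
  rw [whisker_exchange_assoc, rightUnitor_inv_naturality_assoc]

theorem capAt_naturality {X Y : V} (f : X ⟶ Y) :
    (f ▷ d.F) ▷ d.F ≫ d.capAt Y = d.capAt X ≫ f := by
  simp only [capAt, Category.assoc, associator_naturality_left_assoc]
  rw [← whisker_exchange_assoc, rightUnitor_naturality]

/-- After coherence isomorphisms the composite is `X` tensored with the second zigzag;
`cupAt_capAt_left` uses the first one in the same way. -/
theorem cupAt_capAt_right (X : V) : d.cupAt (X ⊗ d.F) ≫ d.capAt X ▷ d.F = 0 := by
  have h : d.cupAt (X ⊗ d.F) ≫ d.capAt X ▷ d.F = X ◁ ((ρ_ d.F).inv ≫ d.F ◁ d.cup ≫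
      (α_ d.F d.F d.F).inv ≫ d.cap ▷ d.F ≫ (λ_ d.F).hom) := by
    simp only [cupAt, capAt]
    monoidal
  rw [h, d.zigzag_right, MonoidalPreadditive.whiskerLeft_zero]

theorem cupAt_capAt_left (X : V) : d.cupAt X ▷ d.F ≫ d.capAt (X ⊗ d.F) = 0 := by
  have h : d.cupAt X ▷ d.F ≫ d.capAt (X ⊗ d.F) = X ◁ ((λ_ d.F).inv ≫ d.cup ▷ d.F ≫
      (α_ d.F d.F d.F).hom ≫ d.F ◁ d.cap ≫ (ρ_ d.F).hom) := by
    simp only [cupAt, capAt]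
    monoidal
  rw [h, d.zigzag_left, MonoidalPreadditive.whiskerLeft_zero]

/-- Two consecutive simple objects. -/
structure Step where
  A : V
  B : V
  j : B ⟶ A ⊗ d.F
  q : A ⊗ d.F ⟶ B
  j_q : j ≫ q = 𝟙 B
  -- The partial trace over `F` of the projector `q ≫ j` is the identity. This is exactly what makes
  -- `A` a direct summand of `B ⊗ F`.
  trace : d.cupAt A ≫ (q ≫ j) ▷ d.F ≫ d.capAt A = 𝟙 A

namespace Step

variable {d} (s : Step d)

/-- The inclusion of `A` in `B ⊗ F`. -/
def i : s.A ⟶ s.B ⊗ d.F := d.cupAt s.A ≫ s.q ▷ d.F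

/-- The projection of `B ⊗ F` to `A`. -/
def p : s.B ⊗ d.F ⟶ s.A := s.j ▷ d.F ≫ d.capAt s.A

theorem i_p : s.i ≫ s.p = 𝟙 s.A := by
  rw [i, p, Category.assoc, ← comp_whiskerRight_assoc, s.trace]

/-- The map `p` begins with `j`, past which `cup` slides; what remains is the second zigzag. Dually,
`i_capAt` comes from the first zigzag. -/
theorem cupAt_p : d.cupAt s.B ≫ s.p ▷ d.F = 0 := by
  rw [p, comp_whiskerRight, ← Category.assoc, cupAt_naturality, Category.assoc, cupAt_capAt_right,
    comp_zero]

theorem i_capAt : s.i ▷ d.F ≫ d.capAt s.B = 0 := by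
  rw [i, comp_whiskerRight, Category.assoc, capAt_naturality, ← Category.assoc, cupAt_capAt_left,
    zero_comp]

theorem idem : (𝟙 _ - s.p ≫ s.i) ≫ (𝟙 _ - s.p ≫ s.i) = 𝟙 _ - s.p ≫ s.i := by
  have h : s.p ≫ s.i ≫ s.p ≫ s.i = s.p ≫ s.i := by rw [reassoc_of% s.i_p]
  simp [Preadditive.comp_sub, Preadditive.sub_comp, h]

/-- The first step. -/
def init (d : Datum V) : Step d where
  A := 𝟙_ V
  B := d.F
  j := (λ_ d.F).inv
  q := (λ_ d.F).hom
  j_q := Iso.inv_hom_id _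
  trace := by
    rw [Iso.hom_inv_id, id_whiskerRight, Category.id_comp, cupAt_capAt]

variable [IsIdempotentComplete V]

/-- The next step: `B ⊗ F` is the direct sum of `A` and the new object. -/
def next : Step d :=
  have h := IsIdempotentComplete.idempotents_split _ _ s.idem
  { A := s.B
    B := h.choose
    j := h.choose_spec.choose
    q := h.choose_spec.choose_spec.choose
    j_q := h.choose_spec.choose_spec.choose_spec.1
    trace := by
      -- By `cupAt_p` the projector `p ≫ i` has partial trace zero, so the complementary projector
      -- has the same partial trace as the identity, namely `cup ≫ cap = 𝟙`. No denominator appears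
      -- and the recursion can continue indefinitely.
      have e : (𝟙 (s.B ⊗ d.F) - s.p ≫ s.i) ▷ d.F = 𝟙 _ ▷ d.F - (s.p ≫ s.i) ▷ d.F :=
        (tensorRight d.F).map_sub
      rw [h.choose_spec.choose_spec.choose_spec.2, e, comp_whiskerRight, Preadditive.sub_comp,
        Preadditive.comp_sub, id_whiskerRight, Category.id_comp, cupAt_capAt, Category.assoc,
        ← Category.assoc (d.cupAt s.B), cupAt_p, zero_comp, sub_zero] }

theorem next_q_j : s.next.q ≫ s.next.j = 𝟙 (s.B ⊗ d.F) - s.p ≫ s.i :=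
  (IsIdempotentComplete.idempotents_split _ _ s.idem).choose_spec.choose_spec.choose_spec.2

end Step

variable [IsIdempotentComplete V]

/-- The sequence of steps. -/
def step : ℕ → Step d
  | 0 => Step.init d
  | n + 1 => (step n).next

/-- The simple objects. -/
def S (n : ℕ) : V := (d.step n).A

/-- The inclusion of `S (n + 1)` in `S n ⊗ F`. -/
def j (n : ℕ) : d.S (n + 1) ⟶ d.S n ⊗ d.F := (d.step n).j

/-- The projection of `S n ⊗ F` to `S (n + 1)`. -/
def q (n : ℕ) : d.S n ⊗ d.F ⟶ d.S (n + 1) := (d.step n).q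

/-- The inclusion of `S n` in `S (n + 1) ⊗ F`. -/
def i (n : ℕ) : d.S n ⟶ d.S (n + 1) ⊗ d.F := (d.step n).i

/-- The projection of `S (n + 1) ⊗ F` to `S n`. -/
def p (n : ℕ) : d.S (n + 1) ⊗ d.F ⟶ d.S n := (d.step n).p

theorem j_q (n : ℕ) : d.j n ≫ d.q n = 𝟙 _ := (d.step n).j_q
theorem i_p (n : ℕ) : d.i n ≫ d.p n = 𝟙 _ := (d.step n).i_p
theorem cupAt_p (n : ℕ) : d.cupAt (d.S (n + 1)) ≫ d.p n ▷ d.F = 0 := (d.step n).cupAt_p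
theorem i_capAt (n : ℕ) : d.i n ▷ d.F ≫ d.capAt (d.S (n + 1)) = 0 := (d.step n).i_capAt
theorem q_j_zero : d.q 0 ≫ d.j 0 = 𝟙 (d.S 0 ⊗ d.F) := (λ_ d.F).hom_inv_id

theorem total_succ (n : ℕ) : d.p n ≫ d.i n + d.q (n + 1) ≫ d.j (n + 1) = 𝟙 _ := by
  have h : d.q (n + 1) ≫ d.j (n + 1) = 𝟙 _ - d.p n ≫ d.i n := (d.step n).next_q_j
  rw [h]
  abel

/-- Placing `total_succ` between `i` and `q` gives `i ≫ q + i ≫ q = i ≫ q`; `j_p` is obtained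
likewise. -/
theorem i_q (n : ℕ) : d.i n ≫ d.q (n + 1) = 0 := by
  have h := congrArg (fun x => d.i n ≫ x ≫ d.q (n + 1)) (d.total_succ n)
  simp only [Preadditive.add_comp, Preadditive.comp_add, Category.assoc, j_q, Category.comp_id,
    Category.id_comp, reassoc_of% d.i_p n] at h
  simpa using h

theorem j_p (n : ℕ) : d.j (n + 1) ≫ d.p n = 0 := by
  have h := congrArg (fun x => d.j (n + 1) ≫ x ≫ d.p n) (d.total_succ n)
  simp only [Preadditive.add_comp, Preadditive.comp_add, Category.assoc, i_p, Category.comp_id,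
    Category.id_comp, reassoc_of% d.j_q (n + 1)] at h
  simpa using h

end Simples

end CPrime.Datum

/-! ### Decomposition into simple objects -/

namespace CPrime.Datum

section Decomposition

variable {V : Type*} [Category V] [Preadditive V] [Linear ℚ V] [MonoidalCategory V]
  [MonoidalPreadditive V] [IsIdempotentComplete V] (d : Datum V)

open scoped Classical in
/-- The scalar morphisms between simple objects. -/
def IsScalar {k l : ℕ} (f : d.S k ⟶ d.S l) : Prop :=
  ∃ c : ℚ, f = c • if h : k = l then eqToHom (congrArg d.S h) else 0

variable {d}

theorem isScalar_zero {k l : ℕ} : d.IsScalar (0 : d.S k ⟶ d.S l) := ⟨0, by simp⟩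

theorem isScalar_id (k : ℕ) : d.IsScalar (𝟙 (d.S k)) := ⟨1, by simp⟩

theorem IsScalar.add {k l : ℕ} {f g : d.S k ⟶ d.S l} (hf : d.IsScalar f) (hg : d.IsScalar g) :
    d.IsScalar (f + g) := by
  obtain ⟨a, rfl⟩ := hf
  obtain ⟨b, rfl⟩ := hg
  exact ⟨a + b, (add_smul _ _ _).symm⟩

theorem IsScalar.smul {k l : ℕ} (c : ℚ) {f : d.S k ⟶ d.S l} (hf : d.IsScalar f) :
    d.IsScalar (c • f) := by
  obtain ⟨a, rfl⟩ := hf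
  exact ⟨c * a, (mul_smul _ _ _).symm⟩

theorem IsScalar.sum {ι : Type*} {s : Finset ι} {k l : ℕ} {f : ι → (d.S k ⟶ d.S l)}
    (hf : ∀ i ∈ s, d.IsScalar (f i)) : d.IsScalar (∑ i ∈ s, f i) := by
  classical
  induction s using Finset.induction_on with
  | empty => simpa using isScalar_zero
  | insert a s ha ih =>
    rw [Finset.sum_insert ha]
    exact (hf a (Finset.mem_insert_self a s)).add
      (ih fun i hi => hf i (Finset.mem_insert_of_mem hi))

/-- Eliminates the transport `eqToHom`: a property of scalar morphisms need only be verified for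
zero and for multiples of an identity. -/
theorem IsScalar.induction {P : ∀ k l, (d.S k ⟶ d.S l) → Prop} {k l : ℕ} {f : d.S k ⟶ d.S l}
    (hf : d.IsScalar f) (zero : ∀ k l, P k l 0) (smul : ∀ k (c : ℚ), P k k (c • 𝟙 _)) :
    P k l f := by
  obtain ⟨c, rfl⟩ := hf
  by_cases h : k = l
  · subst h
    simpa using smul k c
  · simpa [h] using zero k l

variable (d)

/-- A decomposition into simple objects. -/
structure Dec (Z : V) where
  idx : Type
  [fin : Fintype idx]
  k : idx → ℕ
  a : ∀ t, Z ⟶ d.S (k t)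
  b : ∀ t, d.S (k t) ⟶ Z
  total : ∑ t, a t ≫ b t = 𝟙 Z
  b_a : ∀ t s, d.IsScalar (b t ≫ a s)

attribute [instance] Dec.fin

variable {d}

namespace Dec

/-- The condition that the entries of a morphism are scalar. -/
def Scal {Z Z' : V} (D : d.Dec Z) (D' : d.Dec Z') (f : Z ⟶ Z') : Prop :=
  ∀ t s, d.IsScalar (D.b t ≫ f ≫ D'.a s)

theorem scal_id {Z : V} (D : d.Dec Z) : D.Scal D (𝟙 Z) := fun t s => by
  rw [Category.id_comp]
  exact D.b_a t s

theorem scal_zero {Z Z' : V} (D : d.Dec Z) (D' : d.Dec Z') : D.Scal D' 0 := fun t s => by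
  rw [zero_comp, comp_zero]
  exact isScalar_zero

theorem IsScalar.comp {k l m : ℕ} {f : d.S k ⟶ d.S l} {g : d.S l ⟶ d.S m} (hf : d.IsScalar f)
    (hg : d.IsScalar g) : d.IsScalar (f ≫ g) := by
  refine hf.induction (P := fun k l f => ∀ g : d.S l ⟶ d.S m, d.IsScalar g → d.IsScalar (f ≫ g))
    (fun k l g _ => ?_) (fun k c g hg => ?_) g hg
  · rw [zero_comp]
    exact isScalar_zero
  · rw [Linear.smul_comp, Category.id_comp]
    exact hg.smul c

/-- Matrix multiplication: the decomposition of the middle object is inserted between `f` and `g`.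
-/
theorem Scal.comp {Z Z' Z'' : V} {D : d.Dec Z} {D' : d.Dec Z'} {D'' : d.Dec Z''} {f : Z ⟶ Z'}
    {g : Z' ⟶ Z''} (hf : D.Scal D' f) (hg : D'.Scal D'' g) : D.Scal D'' (f ≫ g) := fun t s => by
  have h : D.b t ≫ (f ≫ g) ≫ D''.a s =
      ∑ r, (D.b t ≫ f ≫ D'.a r) ≫ (D'.b r ≫ g ≫ D''.a s) := by
    have h' : ∀ r, (D.b t ≫ f ≫ D'.a r) ≫ (D'.b r ≫ g ≫ D''.a s) =
        (D.b t ≫ f) ≫ (D'.a r ≫ D'.b r) ≫ g ≫ D''.a s := fun r => by simp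
    simp only [h']
    rw [← Preadditive.comp_sum, ← Preadditive.sum_comp, D'.total, Category.id_comp]
    simp
  rw [h]
  exact IsScalar.sum fun r _ => IsScalar.comp (hf t r) (hg r s)

theorem Scal.add {Z Z' : V} {D : d.Dec Z} {D' : d.Dec Z'} {f g : Z ⟶ Z'} (hf : D.Scal D' f)
    (hg : D.Scal D' g) : D.Scal D' (f + g) := fun t s => by
  rw [Preadditive.add_comp, Preadditive.comp_add]
  exact (hf t s).add (hg t s)

theorem Scal.smul {Z Z' : V} {D : d.Dec Z} {D' : d.Dec Z'} {f : Z ⟶ Z'} (c : ℚ)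
    (hf : D.Scal D' f) : D.Scal D' (c • f) := fun t s => by
  rw [Linear.smul_comp, Linear.comp_smul]
  exact (hf t s).smul c

/-- Transport along an isomorphism. -/
def ofIso {Z Z' : V} (D : d.Dec Z) (e : Z ≅ Z') : d.Dec Z' where
  idx := D.idx
  k := D.k
  a t := e.inv ≫ D.a t
  b t := D.b t ≫ e.hom
  total := by
    have h : ∀ t, (e.inv ≫ D.a t) ≫ D.b t ≫ e.hom = e.inv ≫ (D.a t ≫ D.b t) ≫ e.hom :=
      fun t => by simp
    simp only [h]
    rw [← Preadditive.comp_sum, ← Preadditive.sum_comp, D.total, Category.id_comp, e.inv_hom_id]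
  b_a t s := by
    rw [Category.assoc, e.hom_inv_id_assoc]
    exact D.b_a t s

theorem scal_ofIso {Z Z' Z₁ Z₁' : V} {D : d.Dec Z} {D₁ : d.Dec Z₁} {e : Z ≅ Z'} {e₁ : Z₁ ≅ Z₁'}
    {f : Z' ⟶ Z₁'} : (D.ofIso e).Scal (D₁.ofIso e₁) f ↔ D.Scal D₁ (e.hom ≫ f ≫ e₁.inv) := by
  refine forall_congr' fun t => forall_congr' fun s => ?_
  simp only [ofIso, Category.assoc]

/-- The entries of `x ▷ W` for a scalar morphism `x`. -/
theorem isScalar_mid {W W' : V} {D : ∀ n, d.Dec (d.S n ⊗ W)} {D' : ∀ n, d.Dec (d.S n ⊗ W')}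
    {g : W ⟶ W'} (hg : ∀ n, (D n).Scal (D' n) (d.S n ◁ g)) {k l : ℕ} {x : d.S k ⟶ d.S l}
    (hx : d.IsScalar x) (t : (D k).idx) (s : (D' l).idx) :
    d.IsScalar ((D k).b t ≫ x ▷ W ≫ d.S l ◁ g ≫ (D' l).a s) := by
  refine hx.induction (P := fun k l x => ∀ (t : (D k).idx) (s : (D' l).idx),
    d.IsScalar ((D k).b t ≫ x ▷ W ≫ d.S l ◁ g ≫ (D' l).a s)) (fun k l t s => ?_)
    (fun k c t s => ?_) t s
  · rw [MonoidalPreadditive.zero_whiskerRight, zero_comp, comp_zero]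
    exact isScalar_zero
  · rw [QLin.smul_whiskerRight, id_whiskerRight, Linear.smul_comp, Linear.comp_smul,
      Category.id_comp]
    exact (hg k t s).smul c

theorem isScalar_mid_id {W : V} {D : ∀ n, d.Dec (d.S n ⊗ W)} {k l : ℕ} {x : d.S k ⟶ d.S l}
    (hx : d.IsScalar x) (t : (D k).idx) (s : (D l).idx) :
    d.IsScalar ((D k).b t ≫ x ▷ W ≫ (D l).a s) := by
  have h := isScalar_mid (D := D) (D' := D) (g := 𝟙 W)
    (fun n => by rw [MonoidalCategory.whiskerLeft_id]; exact (D n).scal_id) hx t s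
  rw [MonoidalCategory.whiskerLeft_id, Category.id_comp] at h
  exact h

/-- The decomposition of a tensor product. -/
def bind {Z W : V} (D : d.Dec Z) (D' : ∀ n, d.Dec (d.S n ⊗ W)) : d.Dec (Z ⊗ W) where
  idx := Σ t : D.idx, (D' (D.k t)).idx
  k x := (D' (D.k x.1)).k x.2
  a x := D.a x.1 ▷ W ≫ (D' (D.k x.1)).a x.2
  b x := (D' (D.k x.1)).b x.2 ≫ D.b x.1 ▷ W
  total := by
    rw [Fintype.sum_sigma]
    have h : ∀ t, ∑ s, (D.a t ▷ W ≫ (D' (D.k t)).a s) ≫ (D' (D.k t)).b s ≫ D.b t ▷ W =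
        (D.a t ≫ D.b t) ▷ W := fun t => by
      have h' : ∀ s, (D.a t ▷ W ≫ (D' (D.k t)).a s) ≫ (D' (D.k t)).b s ≫ D.b t ▷ W =
        D.a t ▷ W ≫ ((D' (D.k t)).a s ≫ (D' (D.k t)).b s) ≫ D.b t ▷ W := fun s => by simp
      simp only [h']
      rw [← Preadditive.comp_sum, ← Preadditive.sum_comp, (D' (D.k t)).total, Category.id_comp,
        comp_whiskerRight]
    refine (Finset.sum_congr rfl fun t _ => h t).trans ?_
    rw [← sum_whiskerRight, D.total, id_whiskerRight]
  b_a x y := by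
    rw [Category.assoc, ← comp_whiskerRight_assoc]
    exact isScalar_mid_id (D.b_a x.1 y.1) x.2 y.2

/-- An entry of `f ⊗ g` is computed by first taking an entry of `f`, which is a scalar between
simple objects, and then an entry of `S n ◁ g`. Hence only whiskerings of `g` by simple objects
matter. -/
theorem Scal.bind {Z Z₁ W W₁ : V} {D : d.Dec Z} {D₁ : d.Dec Z₁} {D' : ∀ n, d.Dec (d.S n ⊗ W)}
    {D₁' : ∀ n, d.Dec (d.S n ⊗ W₁)} {f : Z ⟶ Z₁} {g : W ⟶ W₁} (hf : D.Scal D₁ f)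
    (hg : ∀ n, (D' n).Scal (D₁' n) (d.S n ◁ g)) : (D.bind D').Scal (D₁.bind D₁') (f ⊗ₘ g) :=
  fun x y => by
    have h := isScalar_mid hg (hf x.1 y.1) x.2 y.2
    have e : (D.bind D').b x ≫ (f ⊗ₘ g) ≫ (D₁.bind D₁').a y = (D' (D.k x.1)).b x.2 ≫
        (D.b x.1 ≫ f ≫ D₁.a y.1) ▷ W ≫ d.S (D₁.k y.1) ◁ g ≫ (D₁' (D₁.k y.1)).a y.2 := by
      simp only [Dec.bind, MonoidalCategory.tensorHom_def, comp_whiskerRight, Category.assoc,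
        whisker_exchange_assoc]
    rw [e]
    exact h

/-- Naturality of the associator matches the two iterated decompositions, and the entries reduce to
nested composites of the scalars `b ≫ a` of the given decompositions. -/
theorem scal_associator_hom {Z W U : V} (D : d.Dec Z) (D' : ∀ n, d.Dec (d.S n ⊗ W))
    (D'' : ∀ n, d.Dec (d.S n ⊗ U)) : ((D.bind D').bind D'').Scal
      (D.bind fun n => ((D' n).bind D'').ofIso (α_ (d.S n) W U)) (α_ Z W U).hom := fun x y => by
  have h := isScalar_mid_id (D := D'') (isScalar_mid_id (D := D') (D.b_a x.1.1 y.1) x.1.2 y.2.1)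
    x.2 y.2.2
  have e : ((D.bind D').bind D'').b x ≫ (α_ Z W U).hom ≫
      (D.bind fun n => ((D' n).bind D'').ofIso (α_ (d.S n) W U)).a y =
      (D'' _).b x.2 ≫ ((D' _).b x.1.2 ≫ (D.b x.1.1 ≫ D.a y.1) ▷ W ≫ (D' _).a y.2.1) ▷ U ≫
        (D'' _).a y.2.2 := by
    simp only [Dec.bind, ofIso, comp_whiskerRight, Category.assoc,
      ← associator_naturality_left_assoc, Iso.hom_inv_id_assoc]
  rw [e]
  exact h

theorem scal_associator_inv {Z W U : V} (D : d.Dec Z) (D' : ∀ n, d.Dec (d.S n ⊗ W))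
    (D'' : ∀ n, d.Dec (d.S n ⊗ U)) :
    (D.bind fun n => ((D' n).bind D'').ofIso (α_ (d.S n) W U)).Scal
      ((D.bind D').bind D'') (α_ Z W U).inv := fun y x => by
  have h := isScalar_mid_id (D := D'') (isScalar_mid_id (D := D') (D.b_a y.1 x.1.1) y.2.1 x.1.2)
    y.2.2 x.2
  have e : (D.bind fun n => ((D' n).bind D'').ofIso (α_ (d.S n) W U)).b y ≫ (α_ Z W U).inv ≫
      ((D.bind D').bind D'').a x =
      (D'' _).b y.2.2 ≫ ((D' _).b y.2.1 ≫ (D.b y.1 ≫ D.a x.1.1) ▷ W ≫ (D' _).a x.1.2) ▷ U ≫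
        (D'' _).a x.2 := by
    simp only [Dec.bind, ofIso, comp_whiskerRight, Category.assoc,
      associator_inv_naturality_left_assoc, Iso.hom_inv_id_assoc]
  rw [e]
  exact h

variable (d) in
/-- The decomposition of `S n ⊗ 𝟙`. -/
def ofUnit (n : ℕ) : d.Dec (d.S n ⊗ 𝟙_ V) where
  idx := PUnit
  k _ := n
  a _ := (ρ_ _).hom
  b _ := (ρ_ _).inv
  total := (Fintype.sum_unique _).trans (Iso.hom_inv_id _)
  b_a _ _ := by
    rw [Iso.inv_hom_id]
    exact isScalar_id n

variable (d) in
/-- The decomposition of `S n ⊗ F`. -/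
def ofF : ∀ n : ℕ, d.Dec (d.S n ⊗ d.F)
  | 0 =>
    { idx := PUnit
      k := fun _ => 1
      a := fun _ => d.q 0
      b := fun _ => d.j 0
      total := (Fintype.sum_unique _).trans d.q_j_zero
      b_a := fun _ _ => by
        rw [j_q]
        exact isScalar_id 1 }
  | n + 1 =>
    { idx := Bool
      k := fun t => cond t (n + 2) n
      a := fun | true => d.q (n + 1) | false => d.p n
      b := fun | true => d.j (n + 1) | false => d.i n
      total := by
        refine (Fintype.sum_bool _).trans ((add_comm _ _).trans ?_)
        exact d.total_succ n
      b_a := fun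
        | true, true => by
          rw [j_q]
          exact isScalar_id (n + 2)
        | true, false => by
          rw [j_p]
          exact isScalar_zero
        | false, true => by
          rw [i_q]
          exact isScalar_zero
        | false, false => by
          rw [i_p]
          exact isScalar_id n }

/-- The decomposition of `S n ⊗ Z` for a zero object `Z`. -/
def ofZero {Z : V} (h : 𝟙 Z = 0) : d.Dec Z where
  idx := PEmpty
  k := PEmpty.elim
  a t := t.elim
  b t := t.elim
  total := by
    rw [h]
    exact Finset.sum_empty
  b_a t := t.elim

variable (d) in
/-- The decomposition of `S n ⊗ X` for the objects generated by `F`. -/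
def ofObj : ∀ (X : CPrime) (n : ℕ), d.Dec (d.S n ⊗ d.obj X)
  | .F, n => ofF d n
  | .zero, n => ofZero (Z := d.S n ⊗ d.zero) (by
      rw [← MonoidalCategory.whiskerLeft_id, d.id_zero, MonoidalPreadditive.whiskerLeft_zero])
  | .unit, n => ofUnit d n
  | .tensor X Y, n => ((ofObj X n).bind (ofObj Y)).ofIso (α_ (d.S n) (d.obj X) (d.obj Y))

end Dec

end Decomposition

end CPrime.Datum

/-! ### Scalar entries of the morphisms generated by `cup` and `cap` -/

namespace CPrime.Datum

section Entries

variable {V : Type*} [Category V] [Preadditive V] [Linear ℚ V] [MonoidalCategory V]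
  [MonoidalPreadditive V] [IsIdempotentComplete V] {d : Datum V}

namespace Dec

theorem scal_ofIso_left {Z Z' Z₁ : V} {D : d.Dec Z} {D₁ : d.Dec Z₁} {e : Z ≅ Z'} {f : Z' ⟶ Z₁} :
    (D.ofIso e).Scal D₁ f ↔ D.Scal D₁ (e.hom ≫ f) := by
  refine forall_congr' fun t => forall_congr' fun s => ?_
  simp only [ofIso, Category.assoc]

theorem scal_ofIso_right {Z Z₁ Z₁' : V} {D : d.Dec Z} {D₁ : d.Dec Z₁} {e₁ : Z₁ ≅ Z₁'}
    {f : Z ⟶ Z₁'} : D.Scal (D₁.ofIso e₁) f ↔ D.Scal D₁ (f ≫ e₁.inv) := by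
  refine forall_congr' fun t => forall_congr' fun s => ?_
  simp only [ofIso, Category.assoc]

theorem scal_ofIso_inv {Z Z' : V} (D : d.Dec Z) (e : Z ≅ Z') : (D.ofIso e).Scal D e.inv := by
  rw [scal_ofIso_left, Iso.hom_inv_id]
  exact scal_id _

theorem scal_ofIso_hom {Z Z' : V} (D : d.Dec Z) (e : Z ≅ Z') : D.Scal (D.ofIso e) e.hom := by
  rw [scal_ofIso_right, Iso.hom_inv_id]
  exact scal_id _

theorem ofIso_b_a {Z Z' : V} (D : d.Dec Z) (e : Z ≅ Z') (t s : D.idx) :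
    (D.ofIso e).b t ≫ (D.ofIso e).a s = D.b t ≫ D.a s := by
  simp [ofIso]

theorem scal_of_whiskerLeft {W : V} (D' : ∀ n, d.Dec (d.S n ⊗ W)) (n : ℕ) :
    (D' n).Scal (D' n) (d.S n ◁ 𝟙 W) := by
  rw [MonoidalCategory.whiskerLeft_id]
  exact (D' n).scal_id

theorem scal_leftUnitor_hom {W : V} (D' : ∀ n, d.Dec (d.S n ⊗ W)) (n : ℕ) :
    ((ofUnit d n).bind D').Scal (D' n) ((ρ_ (d.S n)).hom ▷ W) := fun x s => by
  have e : ((ofUnit d n).bind D').b x ≫ (ρ_ (d.S n)).hom ▷ W ≫ (D' n).a s =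
      (D' n).b x.2 ≫ (D' n).a s := by
    simp [Dec.bind, ofUnit]
  rw [e]
  exact (D' n).b_a x.2 s

theorem scal_leftUnitor_inv {W : V} (D' : ∀ n, d.Dec (d.S n ⊗ W)) (n : ℕ) :
    (D' n).Scal ((ofUnit d n).bind D') ((ρ_ (d.S n)).inv ▷ W) := fun s x => by
  have e : (D' n).b s ≫ (ρ_ (d.S n)).inv ▷ W ≫ ((ofUnit d n).bind D').a x =
      (D' n).b s ≫ (D' n).a x.2 := by
    simp [Dec.bind, ofUnit]
  rw [e]
  exact (D' n).b_a s x.2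

theorem scal_rightUnitor_hom {Z : V} (D : d.Dec Z) :
    (D.bind (ofUnit d)).Scal D (ρ_ Z).hom := fun x s => by
  have e : (D.bind (ofUnit d)).b x ≫ (ρ_ Z).hom ≫ D.a s = D.b x.1 ≫ D.a s := by
    simp [Dec.bind, ofUnit]
  rw [e]
  exact D.b_a x.1 s

theorem scal_rightUnitor_inv {Z : V} (D : d.Dec Z) :
    D.Scal (D.bind (ofUnit d)) (ρ_ Z).inv := fun s x => by
  have e : D.b s ≫ (ρ_ Z).inv ≫ (D.bind (ofUnit d)).a x = D.b s ≫ D.a x.1 := by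
    simp [Dec.bind, ofUnit]
  rw [e]
  exact D.b_a s x.1

theorem isScalar_i (n : ℕ) (u : (ofF d (n + 1)).idx) :
    d.IsScalar (d.i n ≫ (ofF d (n + 1)).a u) := by
  rcases u with _ | _
  · exact (d.i_p n).symm ▸ isScalar_id n
  · exact (d.i_q n).symm ▸ isScalar_zero

theorem isScalar_p (n : ℕ) (u : (ofF d (n + 1)).idx) :
    d.IsScalar ((ofF d (n + 1)).b u ≫ d.p n) := by
  rcases u with _ | _
  · exact (d.i_p n).symm ▸ isScalar_id n
  · exact (d.j_p n).symm ▸ isScalar_zero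

/-- Projecting `cupAt` to the summand `S (n + 1)` of `S n ⊗ F` gives `i n`, by its definition, and
projecting to `S (n - 1)` gives zero, by `cupAt_p`. The entries of `i n` are in turn zero or an
identity. The argument for `scal_capAt` is dual. -/
theorem scal_cupAt (n : ℕ) : (ofUnit d n).Scal ((ofF d n).bind (ofF d))
    ((ρ_ (d.S n)).hom ≫ d.cupAt (d.S n)) := fun t x => by
  obtain ⟨t', u⟩ := x
  have e : (ofUnit d n).b t ≫ ((ρ_ (d.S n)).hom ≫ d.cupAt (d.S n)) ≫
      ((ofF d n).bind (ofF d)).a ⟨t', u⟩ =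
      (d.cupAt (d.S n) ≫ (ofF d n).a t' ▷ d.F) ≫ (ofF d _).a u := by
    simp [Dec.bind, ofUnit]
  rw [e]
  cases n with
  -- The object `S 0 ⊗ F` has the single summand `S 1`.
  | zero => exact isScalar_i 0 u
  | succ n =>
    rcases t' with _ | _
    · have h : (d.cupAt (d.S (n + 1)) ≫ (ofF d (n + 1)).a false ▷ d.F) = 0 := d.cupAt_p n
      rw [h, zero_comp]
      exact isScalar_zero
    · exact isScalar_i (n + 1) u

theorem scal_capAt (n : ℕ) : ((ofF d n).bind (ofF d)).Scal (ofUnit d n)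
    (d.capAt (d.S n) ≫ (ρ_ (d.S n)).inv) := fun x t => by
  obtain ⟨t', u⟩ := x
  have e : ((ofF d n).bind (ofF d)).b ⟨t', u⟩ ≫ (d.capAt (d.S n) ≫ (ρ_ (d.S n)).inv) ≫
      (ofUnit d n).a t =
      (ofF d _).b u ≫ (ofF d n).b t' ▷ d.F ≫ d.capAt (d.S n) := by
    simp [Dec.bind, ofUnit]
  rw [e]
  cases n with
  | zero => exact isScalar_p 0 u
  | succ n =>
    rcases t' with _ | _
    · have h : (ofF d (n + 1)).b false ▷ d.F ≫ d.capAt (d.S (n + 1)) = 0 := d.i_capAt n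
      rw [h, comp_zero]
      exact isScalar_zero
    · exact isScalar_p (n + 1) u

/-- The entries of the morphisms generated by `cup` and `cap` are scalar. -/
theorem scal_preMap {X Y : CPrime} (f : Pre X Y) (n : ℕ) :
    (ofObj d X n).Scal (ofObj d Y n) (d.S n ◁ d.preMap f) := by
  -- Whiskering by an arbitrary `S n` makes the induction close: a tensor product is decomposed
  -- factor by factor from the left, and each factor only meets simple objects of varying index.
  induction f generalizing n with
  | cup =>
    refine scal_ofIso_right.mpr ?_
    have e : d.S n ◁ d.preMap Pre.cup ≫ (α_ (d.S n) d.F d.F).inv =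
        (ρ_ (d.S n)).hom ≫ d.cupAt (d.S n) := by
      simp [cupAt, preMap]
      rfl
    exact e ▸ scal_cupAt n
  | cap =>
    refine scal_ofIso_left.mpr ?_
    have e : (α_ (d.S n) d.F d.F).hom ≫ d.S n ◁ d.preMap Pre.cap =
        d.capAt (d.S n) ≫ (ρ_ (d.S n)).inv := by
      simp [capAt, preMap]
      rfl
    exact e ▸ scal_capAt n
  | zeroHom X Y =>
    rw [preMap, MonoidalPreadditive.whiskerLeft_zero]
    exact scal_zero _ _
  | id X => exact scal_of_whiskerLeft (ofObj d X) n
  | comp f g ihf ihg =>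
    rw [preMap, MonoidalCategory.whiskerLeft_comp]
    exact (ihf n).comp (ihg n)
  | @tensorHom W X Y Z f g ihf ihg =>
    refine scal_ofIso.mpr ?_
    have e : (α_ (d.S n) (d.obj W) (d.obj X)).hom ≫ d.S n ◁ (d.preMap f ⊗ₘ d.preMap g) ≫
        (α_ (d.S n) (d.obj Y) (d.obj Z)).inv = (d.S n ◁ d.preMap f) ⊗ₘ d.preMap g := by
      simp [MonoidalCategory.tensorHom_def]
    exact e ▸ (ihf n).bind ihg
  | assocHom X Y Z =>
    refine scal_ofIso.mpr ?_
    have e : (α_ (d.S n) (d.obj X ⊗ d.obj Y) (d.obj Z)).hom ≫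
        d.S n ◁ (α_ (d.obj X) (d.obj Y) (d.obj Z)).hom ≫
          (α_ (d.S n) (d.obj X) (d.obj Y ⊗ d.obj Z)).inv =
        ((α_ (d.S n) (d.obj X) (d.obj Y)).inv ⊗ₘ 𝟙 (d.obj Z)) ≫
          (α_ (d.S n ⊗ d.obj X) (d.obj Y) (d.obj Z)).hom := by simp
    refine e ▸ Scal.comp (D' := ((ofObj d X n).bind (ofObj d Y)).bind (ofObj d Z)) ?_
      (scal_associator_hom _ _ _)
    exact Scal.bind (scal_ofIso_inv _ _) (scal_of_whiskerLeft _)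
  | assocInv X Y Z =>
    refine scal_ofIso.mpr ?_
    have e : (α_ (d.S n) (d.obj X) (d.obj Y ⊗ d.obj Z)).hom ≫
        d.S n ◁ (α_ (d.obj X) (d.obj Y) (d.obj Z)).inv ≫
          (α_ (d.S n) (d.obj X ⊗ d.obj Y) (d.obj Z)).inv =
        (α_ (d.S n ⊗ d.obj X) (d.obj Y) (d.obj Z)).inv ≫
          ((α_ (d.S n) (d.obj X) (d.obj Y)).hom ⊗ₘ 𝟙 (d.obj Z)) := by simp
    refine e ▸ Scal.comp (D' := ((ofObj d X n).bind (ofObj d Y)).bind (ofObj d Z))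
      (scal_associator_inv _ _ _) ?_
    exact Scal.bind (scal_ofIso_hom _ _) (scal_of_whiskerLeft _)
  | leftHom X =>
    refine scal_ofIso_left.mpr ?_
    have e : (α_ (d.S n) (𝟙_ V) (d.obj X)).hom ≫ d.S n ◁ (λ_ (d.obj X)).hom =
        (ρ_ (d.S n)).hom ▷ d.obj X := by simp
    exact e ▸ scal_leftUnitor_hom _ n
  | leftInv X =>
    refine scal_ofIso_right.mpr ?_
    have e : d.S n ◁ (λ_ (d.obj X)).inv ≫ (α_ (d.S n) (𝟙_ V) (d.obj X)).inv =
        (ρ_ (d.S n)).inv ▷ d.obj X := by simp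
    exact e ▸ scal_leftUnitor_inv _ n
  | rightHom X =>
    refine scal_ofIso_left.mpr ?_
    have e : (α_ (d.S n) (d.obj X) (𝟙_ V)).hom ≫ d.S n ◁ (ρ_ (d.obj X)).hom =
        (ρ_ (d.S n ⊗ d.obj X)).hom := by simp
    exact e ▸ scal_rightUnitor_hom _
  | rightInv X =>
    refine scal_ofIso_right.mpr ?_
    have e : d.S n ◁ (ρ_ (d.obj X)).inv ≫ (α_ (d.S n) (d.obj X) (𝟙_ V)).inv =
        (ρ_ (d.S n ⊗ d.obj X)).inv := by simp
    exact e ▸ scal_rightUnitor_inv _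

variable (d) in
/-- The decomposition of the objects generated by `F`. -/
def ofObj₀ (X : CPrime) : d.Dec (d.obj X) := (ofObj d X 0).ofIso (Z := 𝟙_ V ⊗ d.obj X) (λ_ (d.obj X))

theorem scal_preMap₀ {X Y : CPrime} (f : Pre X Y) :
    (ofObj₀ d X).Scal (ofObj₀ d Y) (d.preMap f) := by
  refine (scal_ofIso (Z := 𝟙_ V ⊗ d.obj X) (Z₁ := 𝟙_ V ⊗ d.obj Y)).mpr ?_
  have e : (λ_ (d.obj X)).hom ≫ d.preMap f ≫ (λ_ (d.obj Y)).inv = 𝟙_ V ◁ d.preMap f := by simp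
  rw [e]
  exact scal_preMap f 0

theorem exists_ofF (n : ℕ) : ∃ u : (ofF d n).idx, (ofF d n).k u = n + 1 ∧
    (ofF d n).b u ≫ (ofF d n).a u = 𝟙 _ := by
  cases n with
  | zero => exact ⟨PUnit.unit, rfl, d.j_q 0⟩
  | succ n => exact ⟨true, rfl, d.j_q (n + 1)⟩

/-- Up to a unit factor the word is the `k`-th tensor power of `F`; the index follows the summand `S
(n + 1)` of `S n ⊗ F` at every stage. -/
theorem exists_ofObj (k : ℕ) : ∃ (X : CPrime) (t : (ofObj d X 0).idx), (ofObj d X 0).k t = k ∧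
    (ofObj d X 0).b t ≫ (ofObj d X 0).a t = 𝟙 _ := by
  induction k with
  | zero => exact ⟨.unit, PUnit.unit, rfl, Iso.inv_hom_id _⟩
  | succ k ih =>
    obtain ⟨X, t, rfl, h⟩ := ih
    obtain ⟨u, hu, h'⟩ := exists_ofF (d := d) ((ofObj d X 0).k t)
    refine ⟨.tensor X .F, ⟨t, u⟩, hu, ?_⟩
    have e : (ofObj d (.tensor X .F) 0).b ⟨t, u⟩ ≫ (ofObj d (.tensor X .F) 0).a ⟨t, u⟩ =
        (ofF d _).b u ≫ ((ofObj d X 0).b t ≫ (ofObj d X 0).a t) ▷ d.F ≫ (ofF d _).a u := by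
      refine (ofIso_b_a _ _ _ _).trans ?_
      simp only [Dec.bind, comp_whiskerRight, Category.assoc]
      rfl
    rw [e, h, id_whiskerRight, Category.id_comp]
    exact h'

end Dec

/-- Every morphism between the objects generated by `F` is a linear combination of morphisms
generated by `cup` and `cap`. -/
def Generates (d : Datum V) : Prop :=
  ∀ (X Y : CPrime) (f : d.obj X ⟶ d.obj Y),
    f ∈ Submodule.span ℚ (Set.range fun g : Pre X Y => d.preMap g)

/-- The condition `Scal` is linear in the morphism, so it passes from the generated morphisms to
their span. -/
theorem Generates.scal (hd : d.Generates) {X Y : CPrime} (f : d.obj X ⟶ d.obj Y) :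
    (Dec.ofObj₀ d X).Scal (Dec.ofObj₀ d Y) f := by
  induction hd X Y f using Submodule.span_induction with
  | mem f hf =>
    obtain ⟨g, rfl⟩ := hf
    exact Dec.scal_preMap₀ g
  | zero => exact Dec.scal_zero _ _
  | add f g _ _ hf hg => exact hf.add hg
  | smul c f _ hf => exact hf.smul c

theorem comp_comp_of_id {C : Type*} [Category C] {X Y Z W : C} {b : X ⟶ Z} {a : Z ⟶ X}
    {b' : Y ⟶ W} {a' : W ⟶ Y} {f : X ⟶ Y} (h : b ≫ a = 𝟙 X) (h' : b' ≫ a' = 𝟙 Y) :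
    b ≫ (a ≫ f ≫ b') ≫ a' = f := by
  rw [Category.assoc, Category.assoc, h', Category.comp_id, ← Category.assoc, h, Category.id_comp]

/-- Since `S k` and `S l` are retracts of words in `F`, the morphism `f` is an entry of the morphism
it induces between these words. -/
theorem Generates.isScalar (hd : d.Generates) {k l : ℕ} (f : d.S k ⟶ d.S l) : d.IsScalar f := by
  obtain ⟨X, t, rfl, ht⟩ := Dec.exists_ofObj (d := d) k
  obtain ⟨Y, s, rfl, hs⟩ := Dec.exists_ofObj (d := d) l
  have h := hd.scal ((Dec.ofObj₀ d X).a t ≫ f ≫ (Dec.ofObj₀ d Y).b s) t s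
  have ht' : (Dec.ofObj₀ d X).b t ≫ (Dec.ofObj₀ d X).a t = 𝟙 _ :=
    (Dec.ofIso_b_a (Z := 𝟙_ V ⊗ d.obj X) _ _ t t).trans ht
  have hs' : (Dec.ofObj₀ d Y).b s ≫ (Dec.ofObj₀ d Y).a s = 𝟙 _ :=
    (Dec.ofIso_b_a (Z := 𝟙_ V ⊗ d.obj Y) _ _ s s).trans hs
  have e := comp_comp_of_id (f := f) ht' hs'
  exact (congrArg d.IsScalar e).mp h

end Entries

end CPrime.Datum

/-! ### The generating data in the category `𝒞` -/

namespace CPrime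

/-- The generator `𝟙 ⟶ F²`. -/
def cupHom : 𝟙_ CPrime ⟶ F ⊗ F := (⟦Pre.cup⟧ : Quotient (preSetoid unit (tensor F F)))

/-- The generator `F² ⟶ 𝟙`. -/
def capHom : F ⊗ F ⟶ 𝟙_ CPrime := (⟦Pre.cap⟧ : Quotient (preSetoid (tensor F F) unit))

theorem cupHom_capHom : cupHom ≫ capHom = 𝟙 _ := Quotient.sound Rel.cup_cap

theorem zigzag_left : (λ_ F).inv ≫ cupHom ▷ F ≫ (α_ F F F).hom ≫ F ◁ capHom ≫ (ρ_ F).hom = 0 :=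
  Quotient.sound Rel.zigzag_left

theorem zigzag_right : (ρ_ F).inv ≫ F ◁ cupHom ≫ (α_ F F F).inv ≫ capHom ▷ F ≫ (λ_ F).hom = 0 :=
  Quotient.sound Rel.zigzag_right

/-! ### Recovering a monoidal functor on `CPrime` from the images of the generators -/

namespace Datum

open Functor.LaxMonoidal Functor.OplaxMonoidal

variable {V : Type*} [Category V] [MonoidalCategory V] [HasZeroMorphisms V] [ZeroTensor V]
  (G : CPrime ⥤ V) [G.Monoidal] [G.PreservesZeroMorphisms]

/-- The images of the generators under a monoidal functor. -/
def ofFunctor : Datum V where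
  F := G.obj CPrime.F
  zero := G.obj CPrime.zero
  id_zero := by
    have h : 𝟙 CPrime.zero = 0 := Quotient.sound Rel.id_zero
    rw [← G.map_id, h, G.map_zero]
  cup := ε G ≫ G.map cupHom ≫ δ G CPrime.F CPrime.F
  cap := μ G CPrime.F CPrime.F ≫ G.map capHom ≫ η G
  cup_cap := by
    have h := congrArg G.map cupHom_capHom
    rw [G.map_comp, G.map_id] at h
    simp [reassoc_of% h]
  zigzag_left := by
    have h := congrArg G.map CPrime.zigzag_left
    simp only [G.map_comp, G.map_zero, Functor.Monoidal.map_whiskerRight,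
      Functor.Monoidal.map_whiskerLeft, Functor.Monoidal.map_associator,
      Functor.Monoidal.map_leftUnitor_inv, Functor.Monoidal.map_rightUnitor, Category.assoc,
      Functor.Monoidal.μ_δ_assoc] at h
    simp only [comp_whiskerRight, MonoidalCategory.whiskerLeft_comp, Category.assoc] at h ⊢
    exact h
  zigzag_right := by
    have h := congrArg G.map CPrime.zigzag_right
    simp only [G.map_comp, G.map_zero, Functor.Monoidal.map_whiskerRight,
      Functor.Monoidal.map_whiskerLeft, Functor.Monoidal.map_associator_inv,
      Functor.Monoidal.map_rightUnitor_inv, Functor.Monoidal.map_leftUnitor, Category.assoc,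
      Functor.Monoidal.μ_δ_assoc] at h
    simp only [comp_whiskerRight, MonoidalCategory.whiskerLeft_comp, Category.assoc] at h ⊢
    exact h

/-- A monoidal functor is determined on objects by the images of the generators. -/
def ofFunctorIso : ∀ X : CPrime, (ofFunctor G).obj X ≅ G.obj X
  | .F => Iso.refl _
  | .zero => Iso.refl _
  | .unit => Functor.Monoidal.εIso G
  | .tensor X Y => (ofFunctorIso X ⊗ᵢ ofFunctorIso Y) ≪≫ Functor.Monoidal.μIso G X Y

/-- A commutative square whose horizontal maps are isomorphisms. -/
structure IsoSquare {X Y X' Y' : V} (e : X ≅ Y) (e' : X' ≅ Y') (t : X ≅ X') (t' : Y ≅ Y') :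
    Prop where
  w : e.hom ≫ t'.hom = t.hom ≫ e'.hom

theorem IsoSquare.symm {X Y X' Y' : V} {e : X ≅ Y} {e' : X' ≅ Y'} {t : X ≅ X'} {t' : Y ≅ Y'}
    (h : IsoSquare e e' t t') : IsoSquare e.symm e'.symm t' t where
  w := by
    rw [Iso.symm_hom, Iso.symm_hom, Iso.inv_comp_eq, ← Category.assoc, h.w, Category.assoc,
      Iso.hom_inv_id, Category.comp_id]

theorem isoSquare_associator (X Y Z : CPrime) :
    IsoSquare (α_ ((ofFunctor G).obj X) ((ofFunctor G).obj Y) ((ofFunctor G).obj Z))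
      (G.mapIso (α_ X Y Z)) (ofFunctorIso G (.tensor (.tensor X Y) Z))
      (ofFunctorIso G (.tensor X (.tensor Y Z))) where
  w := by
    generalize hx : ofFunctorIso G X = x
    generalize hy : ofFunctorIso G Y = y
    generalize hz : ofFunctorIso G Z = z
    change _ ≫ ((ofFunctorIso G X).hom ⊗ₘ (((ofFunctorIso G Y).hom ⊗ₘ (ofFunctorIso G Z).hom) ≫
      μ G Y Z)) ≫ μ G X (Y ⊗ Z) = (((((ofFunctorIso G X).hom ⊗ₘ (ofFunctorIso G Y).hom) ≫
        μ G X Y) ⊗ₘ (ofFunctorIso G Z).hom) ≫ μ G (X ⊗ Y) Z) ≫ G.map (α_ X Y Z).hom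
    rw [hx, hy, hz]
    have e1 : (x.hom ⊗ₘ ((y.hom ⊗ₘ z.hom) ≫ μ G Y Z)) =
        (x.hom ⊗ₘ (y.hom ⊗ₘ z.hom)) ≫ G.obj X ◁ μ G Y Z := by
      rw [← MonoidalCategory.id_tensorHom, MonoidalCategory.tensorHom_comp_tensorHom,
        Category.comp_id]
    have e2 : ((x.hom ⊗ₘ y.hom) ≫ μ G X Y) ⊗ₘ z.hom =
        ((x.hom ⊗ₘ y.hom) ⊗ₘ z.hom) ≫ μ G X Y ▷ G.obj Z := by
      rw [← MonoidalCategory.tensorHom_id, MonoidalCategory.tensorHom_comp_tensorHom,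
        Category.comp_id]
    rw [e1, e2, Category.assoc, Category.assoc, Category.assoc, Functor.LaxMonoidal.associativity,
      associator_naturality_assoc]

theorem isoSquare_leftUnitor (X : CPrime) :
    IsoSquare (λ_ ((ofFunctor G).obj X)) (G.mapIso (λ_ X)) (ofFunctorIso G (.tensor .unit X))
      (ofFunctorIso G X) where
  w := by
    change _ ≫ (ofFunctorIso G X).hom = ((ε G ⊗ₘ (ofFunctorIso G X).hom) ≫ μ G (𝟙_ CPrime) X) ≫
      G.map (λ_ X).hom
    rw [← leftUnitor_naturality, Functor.LaxMonoidal.left_unitality, MonoidalCategory.tensorHom_def',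
      Category.assoc, Category.assoc]

theorem isoSquare_rightUnitor (X : CPrime) :
    IsoSquare (ρ_ ((ofFunctor G).obj X)) (G.mapIso (ρ_ X)) (ofFunctorIso G (.tensor X .unit))
      (ofFunctorIso G X) where
  w := by
    change _ ≫ (ofFunctorIso G X).hom = ((((ofFunctorIso G X).hom) ⊗ₘ ε G) ≫ μ G X (𝟙_ CPrime)) ≫
      G.map (ρ_ X).hom
    rw [← rightUnitor_naturality, Functor.LaxMonoidal.right_unitality, MonoidalCategory.tensorHom_def,
      Category.assoc, Category.assoc]

/-- Induction on formal morphisms. The generators match by the definition of `ofFunctor`, the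
structural isomorphisms by the coherence squares of `G`, and their inverses by `IsoSquare.symm`. -/
theorem ofFunctorIso_natural {X Y : CPrime} (f : Pre X Y) :
    (ofFunctor G).preMap f ≫ (ofFunctorIso G Y).hom =
      (ofFunctorIso G X).hom ≫ G.map (⟦f⟧ : Quotient (preSetoid X Y)) := by
  induction f with
  | cup =>
    change (ε G ≫ G.map cupHom ≫ δ G CPrime.F CPrime.F) ≫ (𝟙 (G.obj CPrime.F) ⊗ₘ 𝟙 (G.obj CPrime.F)) ≫ μ G CPrime.F CPrime.F =
      ε G ≫ G.map cupHom
    simp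
  | cap =>
    change (μ G CPrime.F CPrime.F ≫ G.map capHom ≫ η G) ≫ ε G =
      ((𝟙 (G.obj CPrime.F) ⊗ₘ 𝟙 (G.obj CPrime.F)) ≫ μ G CPrime.F CPrime.F) ≫ G.map capHom
    simp
  | zeroHom X Y =>
    exact Limits.zero_comp.trans ((congrArg (_ ≫ ·) (G.map_zero X Y)).trans Limits.comp_zero).symm
  | id X =>
    exact (Category.id_comp _).trans ((congrArg (_ ≫ ·) (G.map_id X)).trans (Category.comp_id _)).symm
  | comp f g ihf ihg =>
    refine (Category.assoc _ _ _).trans ((congrArg (_ ≫ ·) ihg).trans ?_)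
    refine ((Category.assoc _ _ _).symm.trans ((congrArg (· ≫ _) ihf).trans ?_))
    exact (Category.assoc _ _ _).trans (congrArg (_ ≫ ·) (G.map_comp _ _).symm)
  | @tensorHom W X Y Z f g ihf ihg =>
    change (_ ⊗ₘ _) ≫ (_ ⊗ₘ _) ≫ μ G Y Z = ((_ ⊗ₘ _) ≫ μ G W X) ≫
      G.map ((⟦f⟧ : W ⟶ Y) ⊗ₘ (⟦g⟧ : X ⟶ Z))
    rw [Category.assoc, ← Functor.LaxMonoidal.μ_natural, MonoidalCategory.tensorHom_comp_tensorHom_assoc,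
      MonoidalCategory.tensorHom_comp_tensorHom_assoc]
    exact congrArg₂ (fun a b => (a ⊗ₘ b) ≫ μ G Y Z) ihf ihg
  | assocHom X Y Z => exact (isoSquare_associator G X Y Z).w
  | assocInv X Y Z => exact (isoSquare_associator G X Y Z).symm.w
  | leftHom X => exact (isoSquare_leftUnitor G X).w
  | leftInv X => exact (isoSquare_leftUnitor G X).symm.w
  | rightHom X => exact (isoSquare_rightUnitor G X).w
  | rightInv X => exact (isoSquare_rightUnitor G X).symm.w

end Datum

end CPrime

namespace CatC

instance instZeroTensor : ZeroTensor CatC := MonoidalPreadditive.toZeroTensor CatC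

/-- The functor from the free monoidal category to `𝒞`. -/
abbrev functor : CPrime ⥤ CatC := QLin.functor CPrime ⋙ karoubiMatEmbedding (QLin CPrime)

/-- The generating data of `𝒞`. -/
def datum : CPrime.Datum CatC := CPrime.Datum.ofFunctor functor

/-- The identification of the objects generated by `F`. -/
def objIso (X : CPrime) : datum.obj X ≅ (karoubiMatEmbedding (QLin CPrime)).obj ⟨X⟩ :=
  CPrime.Datum.ofFunctorIso functor X

theorem preMap_eq_map {X Y : CPrime} (f : CPrime.Pre X Y) : datum.preMap f = (objIso X).hom ≫
    (karoubiMatEmbedding (QLin CPrime)).map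
      (QLin.hom (⟦f⟧ : Quotient (CPrime.preSetoid X Y)) : (⟨X⟩ : QLin CPrime) ⟶ ⟨Y⟩) ≫
      (objIso Y).inv := by
  have h := (Iso.eq_comp_inv (objIso Y)).mpr (CPrime.Datum.ofFunctorIso_natural functor f)
  exact h.trans (Category.assoc _ _ _)

/-- Morphisms of the linearization are linear combinations of classes of formal morphisms, and
`preMap_eq_map` identifies each class with a generated morphism. -/
theorem map_mem_span {X Y : CPrime} (h : (⟨X⟩ : QLin CPrime) ⟶ ⟨Y⟩) :
    (objIso X).hom ≫ (karoubiMatEmbedding (QLin CPrime)).map h ≫ (objIso Y).inv ∈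
      Submodule.span ℚ (Set.range fun g : CPrime.Pre X Y => datum.preMap g) := by
  induction h using QLin.ind with
  | h0 a =>
    obtain ⟨f, rfl⟩ := Quotient.exists_rep a
    exact Submodule.subset_span ⟨f, preMap_eq_map f⟩
  | hadd x y hx hy =>
    rw [Functor.map_add, Preadditive.add_comp, Preadditive.comp_add]
    exact Submodule.add_mem _ hx hy
  | hs c x hx =>
    rw [Functor.map_smul, Linear.smul_comp, Linear.comp_smul]
    exact Submodule.smul_mem _ _ hx

/-- The linearization embeds fully in `𝒞`, so passing to the additive completion and the Karoubi
envelope creates no new morphisms between words in `F`. -/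
theorem generates : datum.Generates := by
  intro X Y f
  have h := map_mem_span ((karoubiMatEmbedding (QLin CPrime)).preimage
    ((objIso X).inv ≫ f ≫ (objIso Y).hom))
  rw [Functor.map_preimage] at h
  simpa using h

theorem isScalar {k l : ℕ} (f : datum.S k ⟶ datum.S l) : datum.IsScalar f := generates.isScalar f

/-- Every object of `𝒞` is a direct summand of a sum of objects `S k`. -/
theorem exists_dec (M : CatC) : ∃ (T : Type) (_ : Fintype T) (k : T → ℕ) (a : ∀ t, M ⟶ datum.S (k t))
    (b : ∀ t, datum.S (k t) ⟶ M), ∑ t, a t ≫ b t = 𝟙 M := by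
  let D := idExtension (QLin CPrime)
  let Δ := fun i : M.X.ι => CPrime.Datum.Dec.ofObj₀ datum (M.X.X i).as
  let e := fun i : M.X.ι => objIso (M.X.X i).as
  refine ⟨Σ i, (Δ i).idx, inferInstance, fun t => (Δ t.1).k t.2,
    fun t => D.π M t.1 ≫ (e t.1).inv ≫ (Δ t.1).a t.2,
    fun t => (Δ t.1).b t.2 ≫ (e t.1).hom ≫ D.ι M t.1, ?_⟩
  rw [Fintype.sum_sigma]
  refine Eq.trans (Finset.sum_congr rfl fun i _ => ?_) (D.total M)
  have h : ∀ s, (D.π M i ≫ (e i).inv ≫ (Δ i).a s) ≫ (Δ i).b s ≫ (e i).hom ≫ D.ι M i =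
      (D.π M i ≫ (e i).inv) ≫ ((Δ i).a s ≫ (Δ i).b s) ≫ (e i).hom ≫ D.ι M i := fun s => by
    simp only [Category.assoc]
  rw [Finset.sum_congr rfl fun s _ => h s, ← Preadditive.comp_sum, ← Preadditive.sum_comp,
    (Δ i).total, Category.id_comp, Category.assoc, Iso.inv_hom_id_assoc]

end CatC

/-! ### Tensoring with `𝔹(1)` -/

namespace Crystal

/-- A non-zero morphism out of `𝔹(m)` is determined by the image of the highest element, which can
be any element with `ε = 0` and `φ = m`. -/
theorem card_mult (m : ℕ) (A : Crystal) :
    Nat.card (mult m A) = Nat.card {b : A.carrier // A.ε b = 0 ∧ A.φ b = m} := by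
  have key : ∀ α : mult m A, ∃ b : {b : A.carrier // A.ε b = 0 ∧ A.φ b = m},
      α.1.toFun (0 : Fin (m + 1)) = some b.1 := by
    intro α
    obtain ⟨b, hb⟩ := exists_some α.2 (0 : Fin (m + 1))
    have h1 : A.ε b = ((0 : Fin (m + 1)) : ℕ) := α.1.ε _ _ hb
    have h2 : A.φ b = m - ((0 : Fin (m + 1)) : ℕ) := α.1.φ _ _ hb
    exact ⟨⟨b, by simpa using h1, by simpa using h2⟩, hb⟩
  choose g hg using key
  refine Nat.card_eq_of_bijective g ⟨fun α β h => ?_, fun b => ?_⟩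
  · exact Subtype.ext (hom_eq_of (0 : Fin (m + 1)) ((hg α).trans (h ▸ (hg β).symm)))
  · obtain ⟨n, α, h⟩ := A.exists_of_highest b.1 (A.e_none b.1 b.2.1)
    have h2 : A.φ b.1 = n - ((0 : Fin (n + 1)) : ℕ) := α.φ _ _ h
    obtain rfl : n = m := by
      have := b.2.2
      simp at h2
      omega
    refine ⟨⟨α, ne_zero_of h⟩, Subtype.ext (Option.some_injective _ ?_)⟩
    exact (hg ⟨α, ne_zero_of h⟩).symm.trans h

/-- The pair `(a, b)` stands for `v_{n-2a} ⊗ v_{1-2b}`. The highest elements are `v_n ⊗ v₁` and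
`v_{n-2} ⊗ v₁`, of weights `n + 1` and `n - 1`; writing `m + 1 = n` excludes the second one for `n =
0`. -/
theorem highest_iff (n m : ℕ) (p : Fin (n + 1) × Fin 2) :
    ((tens (BB n) (BB 1)).ε p = 0 ∧ (tens (BB n) (BB 1)).φ p = m) ↔
      (p.2 : ℕ) = 0 ∧ ((p.1 : ℕ) = 0 ∧ m = n + 1 ∨ (p.1 : ℕ) = 1 ∧ m + 1 = n) := by
  obtain ⟨⟨a, ha⟩, ⟨b, hb⟩⟩ := p
  change (max (b : ℤ) (a - ((1 : ℕ) - 2 * b)) = 0 ∧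
    max ((n : ℤ) - a) (((1 : ℕ) - (b : ℤ)) + (n - 2 * a)) = m) ↔
      b = 0 ∧ (a = 0 ∧ m = n + 1 ∨ a = 1 ∧ m + 1 = n)
  omega

/-- The Clebsch–Gordan rule for tensoring with `𝔹(1)`: each neighbour `𝔹(n ± 1)` occurs once, and
`𝔹(-1)` is absent when `n = 0`. -/
theorem card_mult_tens (n m : ℕ) : Nat.card (mult m (tens (BB n) (BB 1))) =
    if m = n + 1 ∨ m + 1 = n then 1 else 0 := by
  rw [card_mult]
  refine (Nat.card_congr (Equiv.subtypeEquivRight (highest_iff n m))).trans ?_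
  split_ifs with h
  · rw [Nat.card_eq_one_iff_unique]
    constructor
    · refine ⟨fun p q => Subtype.ext (Prod.ext (Fin.ext ?_) (Fin.ext ?_))⟩
      · have := p.2
        have := q.2
        omega
      · exact p.2.1.trans q.2.1.symm
    · rcases h with h | h
      · exact ⟨⟨(0, 0), rfl, Or.inl ⟨rfl, h⟩⟩⟩
      · exact ⟨⟨(⟨1, by omega⟩, 0), rfl, Or.inr ⟨rfl, h⟩⟩⟩
  · have : IsEmpty {p : Fin (n + 1) × Fin 2 // (p.2 : ℕ) = 0 ∧
        ((p.1 : ℕ) = 0 ∧ m = n + 1 ∨ (p.1 : ℕ) = 1 ∧ m + 1 = n)} := ⟨fun p => by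
      have := p.2
      omega⟩
    exact Nat.card_of_isEmpty

end Crystal

namespace CrystalsQ

theorem dim_simple_tensor (n m : ℕ) :
    (simple n ⊗ simple 1).dim m = if m = n + 1 ∨ m + 1 = n then 1 else 0 :=
  (dim_eq_of_iso ((Crystal.simpleIso n ⊗ᵢ Crystal.simpleIso 1) ≪≫
    Crystal.μIso (Crystal.BB n) (Crystal.BB 1)) m).trans (Crystal.card_mult_tens n m)

theorem dim_eq_add {X A B : CrystalsQ} {i : A ⟶ X} {p : X ⟶ A} {j : B ⟶ X} {q : X ⟶ B}
    (hip : i ≫ p = 𝟙 A) (hjq : j ≫ q = 𝟙 B) (hiq : i ≫ q = 0) (hjp : j ≫ p = 0)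
    (h : p ≫ i + q ≫ j = 𝟙 X) (n : ℕ) : X.dim n = A.dim n + B.dim n := by
  obtain ⟨inl, inr, fst, snd, h1, h2, h3, h4, h5⟩ := exists_sum A B
  have e : X ≅ sum A B :=
    { hom := p ≫ inl + q ≫ inr
      inv := fst ≫ i + snd ≫ j
      hom_inv_id := by
        simp [reassoc_of% h1, reassoc_of% h2, reassoc_of% h3, reassoc_of% h4, h]
      inv_hom_id := by
        simp [reassoc_of% hip, reassoc_of% hjq, reassoc_of% hiq, reassoc_of% hjp, h5] }
  rw [dim_eq_of_iso e, dim_sum]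

theorem hom_simple_eq_smul {k l : ℕ} (f : simple k ⟶ simple l) :
    ∃ c : ℚ, f = c • if h : k = l then eqToHom (congrArg simple h) else 0 := by
  by_cases h : k = l
  · subst h
    refine ⟨f.app k (Finsupp.single ⟨rfl⟩ 1) ⟨rfl⟩, ?_⟩
    rw [dif_pos rfl, eqToHom_refl]
    refine hom_ext_single fun n v => ?_
    obtain ⟨⟨⟩⟩ := v
    refine Finsupp.ext fun w => ?_
    obtain ⟨_⟩ := w
    change _ = f.app k (Finsupp.single ⟨rfl⟩ 1) ⟨rfl⟩ *
      (Finsupp.single (⟨rfl⟩ : (simple k).V k) (1 : ℚ)) ⟨rfl⟩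
    rw [Finsupp.single_eq_same, mul_one]
  · refine ⟨0, ?_⟩
    rw [zero_smul]
    refine hom_ext_single fun n v => Finsupp.ext fun w => ?_
    exact absurd (v.down.symm.trans w.down) h

theorem id_simple_ne_zero (k : ℕ) : 𝟙 (simple k) ≠ 0 := by
  intro h
  have h' := congrArg (fun f : simple k ⟶ simple k =>
    f.app k (Finsupp.single (⟨rfl⟩ : (simple k).V k) 1) ⟨rfl⟩) h
  have h'' : (Finsupp.single (⟨rfl⟩ : (simple k).V k) (1 : ℚ)) ⟨rfl⟩ = 0 := h'
  rw [Finsupp.single_eq_same] at h''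
  exact one_ne_zero h''

end CrystalsQ

/-! ### The equivalence -/

namespace CatC

open CrystalsQ

variable (E : CatC ⥤ CrystalsQ) [E.Additive]

section Dim

variable [E.Monoidal]

/-- An additive functor preserves the direct sum decomposition of `S (n + 1) ⊗ F` given by `i`, `p`,
`j`, `q`. -/
theorem dim_succ_tensor (n m : ℕ) : (E.obj (datum.S (n + 1)) ⊗ E.obj CatC.F).dim m =
    (E.obj (datum.S n)).dim m + (E.obj (datum.S (n + 1 + 1))).dim m := by
  refine (dim_eq_of_iso (Functor.Monoidal.μIso E _ _) m).trans ?_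
  refine dim_eq_add (i := E.map (datum.i n)) (p := E.map (datum.p n)) (j := E.map (datum.j (n + 1)))
    (q := E.map (datum.q (n + 1))) ?_ ?_ ?_ ?_ ?_ m
  · exact (E.map_comp _ _).symm.trans ((congrArg E.map (datum.i_p n)).trans (E.map_id _))
  · exact (E.map_comp _ _).symm.trans ((congrArg E.map (datum.j_q (n + 1))).trans (E.map_id _))
  · exact (E.map_comp _ _).symm.trans ((congrArg E.map (datum.i_q n)).trans (E.map_zero _ _))
  · exact (E.map_comp _ _).symm.trans ((congrArg E.map (datum.j_p n)).trans (E.map_zero _ _))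
  · refine (congrArg₂ (· + ·) (E.map_comp _ _).symm (E.map_comp _ _).symm).trans ?_
    exact E.map_add.symm.trans ((congrArg E.map (datum.total_succ n)).trans (E.map_id _))

/-- The recursion has order two, so two consecutive indices are carried along. Removing `𝔹(n)` from
`𝔹(n + 1) ⊗ 𝔹(1)` leaves the multiplicities of `𝔹(n + 2)`. -/
theorem dim_S (e : E.obj CatC.F ≅ simple 1) (n : ℕ) :
    (∀ m, (E.obj (datum.S n)).dim m = (simple n).dim m) ∧
      ∀ m, (E.obj (datum.S (n + 1))).dim m = (simple (n + 1)).dim m := by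
  induction n with
  | zero =>
    exact ⟨dim_eq_of_iso (Functor.Monoidal.εIso E).symm, dim_eq_of_iso e⟩
  | succ n ih =>
    refine ⟨ih.2, fun m => ?_⟩
    obtain ⟨φ⟩ := nonempty_iso_of_dim_eq ih.2
    have h1 := dim_succ_tensor E n m
    rw [dim_eq_of_iso (φ ⊗ᵢ e) m, dim_simple_tensor, ih.1, dim_simple] at h1
    rw [dim_simple]
    split_ifs at h1 ⊢ <;> omega

theorem nonempty_iso_simple (e : E.obj CatC.F ≅ simple 1) (n : ℕ) :
    Nonempty (E.obj (datum.S n) ≅ simple n) := nonempty_iso_of_dim_eq (dim_S E e n).1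

end Dim

instance instHasBinaryBiproducts : HasBinaryBiproducts CatC :=
  hasBinaryBiproducts_of_finite_biproducts CatC

theorem dim_biprod (X Y : CatC) (m : ℕ) :
    (E.obj (X ⊞ Y)).dim m = (E.obj X).dim m + (E.obj Y).dim m := by
  refine dim_eq_add (i := E.map biprod.inl) (p := E.map biprod.fst) (j := E.map biprod.inr)
    (q := E.map biprod.snd) ?_ ?_ ?_ ?_ ?_ m
  · rw [← E.map_comp, biprod.inl_fst, E.map_id]
  · rw [← E.map_comp, biprod.inr_snd, E.map_id]
  · rw [← E.map_comp, biprod.inl_snd, E.map_zero]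
  · rw [← E.map_comp, biprod.inr_fst, E.map_zero]
  · rw [← E.map_comp, ← E.map_comp, ← E.map_add, biprod.total, E.map_id]

/-- When the identity is zero, the zero maps exhibit `X` as `X ⊕ X`, so each multiplicity equals its
own double. -/
theorem dim_zero (X : CrystalsQ) (h : 𝟙 X = 0) (m : ℕ) : X.dim m = 0 := by
  have := dim_eq_add (X := X) (A := X) (B := X) (i := 0) (p := 0) (j := 0) (q := 0)
    (by simp [h]) (by simp [h]) (by simp) (by simp) (by simp [h]) m
  omega

variable {E}

theorem exists_dim (hE : ∀ n, Nonempty (E.obj (datum.S n) ≅ simple n))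
    (d : ℕ →₀ ℕ) : ∃ X : CatC, ∀ m, (E.obj X).dim m = d m := by
  have h0 : ∃ X : CatC, ∀ m, (E.obj X).dim m = 0 := by
    refine ⟨datum.zero, dim_zero _ ?_⟩
    rw [← E.map_id, datum.id_zero, E.map_zero]
  have hadd : ∀ d d' : ℕ →₀ ℕ, (∃ X : CatC, ∀ m, (E.obj X).dim m = d m) →
      (∃ X : CatC, ∀ m, (E.obj X).dim m = d' m) →
        ∃ X : CatC, ∀ m, (E.obj X).dim m = (d + d') m := by
    rintro d d' ⟨X, hX⟩ ⟨Y, hY⟩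
    exact ⟨X ⊞ Y, fun m => by rw [dim_biprod, hX, hY, Finsupp.add_apply]⟩
  induction d using Finsupp.induction_linear with
  | zero => exact h0
  | add d d' h h' => exact hadd d d' h h'
  | single n c =>
    induction c with
    | zero => simpa using h0
    | succ c ih =>
      rw [Finsupp.single_add]
      refine hadd _ _ ih ⟨datum.S n, fun m => ?_⟩
      obtain ⟨φ⟩ := hE n
      rw [dim_eq_of_iso φ, dim_simple, Finsupp.single_apply]
      exact if_congr eq_comm rfl rfl

/-- Only finitely many multiplicities of `Y` are non-zero, and a direct sum of objects `S n` with
these multiplicities has an image isomorphic to `Y`. -/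
theorem essSurj (hE : ∀ n, Nonempty (E.obj (datum.S n) ≅ simple n)) : E.EssSurj where
  mem_essImage Y := by
    have hY : (Function.support Y.dim).Finite := by
      have := Y.finite
      refine (Set.finite_range (fun t : Σ n, Y.V n => t.1)).subset fun n hn => ?_
      obtain ⟨⟨v⟩, _⟩ := Nat.card_ne_zero.mp hn
      exact ⟨⟨n, v⟩, rfl⟩
    obtain ⟨X, hX⟩ := exists_dim hE (Finsupp.ofSupportFinite Y.dim hY)
    exact ⟨X, nonempty_iso_of_dim_eq hX⟩

/-- By `isScalar` only multiples of identities have to be considered, and the identity of `E (S k) ≅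
𝔹(k)` is non-zero. -/
theorem eq_zero_of_map_eq_zero (hE : ∀ n, Nonempty (E.obj (datum.S n) ≅ simple n))
    {k l : ℕ} (f : datum.S k ⟶ datum.S l) (h : E.map f = 0) : f = 0 := by
  obtain ⟨c, rfl⟩ := isScalar f
  by_cases hkl : k = l
  · subst hkl
    rw [dif_pos rfl, eqToHom_refl] at h ⊢
    obtain ⟨φ⟩ := hE k
    rw [E.map_smul, E.map_id] at h
    have h' : c • 𝟙 (simple k) = 0 := by
      have := congrArg (fun x => φ.inv ≫ x ≫ φ.hom) h
      simpa using this
    rcases smul_eq_zero.mp h' with h' | h'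
    · rw [h', zero_smul]
    · exact absurd h' (id_simple_ne_zero k)
  · rw [dif_neg hkl, smul_zero]

/-- Schur's lemma in `Crystals_ℚ`: morphisms between the `𝔹(k)` are scalars, and scalars lift to
`𝒞`. -/
theorem exists_map_eq (hE : ∀ n, Nonempty (E.obj (datum.S n) ≅ simple n))
    {k l : ℕ} (g : E.obj (datum.S k) ⟶ E.obj (datum.S l)) :
    ∃ f : datum.S k ⟶ datum.S l, E.map f = g := by
  by_cases hkl : k = l
  · subst hkl
    obtain ⟨φ⟩ := hE k
    obtain ⟨c, hc⟩ := hom_simple_eq_smul (φ.inv ≫ g ≫ φ.hom)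
    rw [dif_pos rfl, eqToHom_refl] at hc
    refine ⟨c • 𝟙 _, ?_⟩
    rw [E.map_smul, E.map_id]
    have h : φ.hom ≫ (φ.inv ≫ g ≫ φ.hom) ≫ φ.inv = g := by simp
    rw [← h, hc, Linear.smul_comp, Linear.comp_smul, Category.id_comp, Iso.hom_inv_id]
  · obtain ⟨φ⟩ := hE k
    obtain ⟨ψ⟩ := hE l
    obtain ⟨c, hc⟩ := hom_simple_eq_smul (φ.inv ≫ g ≫ ψ.hom)
    rw [dif_neg hkl, smul_zero] at hc
    refine ⟨0, ?_⟩
    have h : φ.hom ≫ (φ.inv ≫ g ≫ ψ.hom) ≫ ψ.inv = g := by simp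
    rw [← h, hc, zero_comp, comp_zero, E.map_zero]

/-- Reduces fullness and faithfulness to entries between the objects `S k`. Only the relation `∑ a ≫
b = 𝟙` is needed, not orthogonality of the summands. -/
theorem eq_sum {M N : CatC} {T U : Type} [Fintype T] [Fintype U] {k : T → ℕ} {l : U → ℕ}
    {a : ∀ t, M ⟶ datum.S (k t)} {b : ∀ t, datum.S (k t) ⟶ M} (h : ∑ t, a t ≫ b t = 𝟙 M)
    {a' : ∀ t, N ⟶ datum.S (l t)} {b' : ∀ t, datum.S (l t) ⟶ N} (h' : ∑ t, a' t ≫ b' t = 𝟙 N)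
    (f : M ⟶ N) : f = ∑ t, ∑ u, a t ≫ (b t ≫ f ≫ a' u) ≫ b' u := by
  conv_lhs => rw [← Category.id_comp f, ← Category.comp_id f, ← h, ← h', Preadditive.sum_comp]
  refine Finset.sum_congr rfl fun t _ => ?_
  rw [Preadditive.comp_sum, Preadditive.comp_sum]
  exact Finset.sum_congr rfl fun u _ => by simp only [Category.assoc]

theorem faithful (hE : ∀ n, Nonempty (E.obj (datum.S n) ≅ simple n)) : E.Faithful where
  map_injective {M N} f g hfg := by
    obtain ⟨T, _, k, a, b, h⟩ := exists_dec M
    obtain ⟨U, _, l, a', b', h'⟩ := exists_dec N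
    rw [← sub_eq_zero, eq_sum h h' (f - g)]
    refine Finset.sum_eq_zero fun t _ => Finset.sum_eq_zero fun u _ => ?_
    rw [eq_zero_of_map_eq_zero hE (b t ≫ (f - g) ≫ a' u), zero_comp, comp_zero]
    rw [E.map_comp, E.map_comp, E.map_sub, hfg, sub_self, zero_comp, comp_zero]

theorem full (hE : ∀ n, Nonempty (E.obj (datum.S n) ≅ simple n)) : E.Full where
  map_surjective {M N} g := by
    obtain ⟨T, _, k, a, b, h⟩ := exists_dec M
    obtain ⟨U, _, l, a', b', h'⟩ := exists_dec N
    choose x hx using fun t u => exists_map_eq hE (E.map (b t) ≫ g ≫ E.map (a' u))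
    refine ⟨∑ t, ∑ u, a t ≫ x t u ≫ b' u, ?_⟩
    have e : ∑ t, E.map (a t) ≫ E.map (b t) = 𝟙 (E.obj M) := by
      rw [← E.map_id, ← h, E.map_sum]
      exact Finset.sum_congr rfl fun t _ => (E.map_comp _ _).symm
    have e' : ∑ t, E.map (a' t) ≫ E.map (b' t) = 𝟙 (E.obj N) := by
      rw [← E.map_id, ← h', E.map_sum]
      exact Finset.sum_congr rfl fun t _ => (E.map_comp _ _).symm
    conv_rhs => rw [← Category.id_comp g, ← Category.comp_id g, ← e, ← e', Preadditive.sum_comp]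
    rw [E.map_sum]
    refine Finset.sum_congr rfl fun t _ => ?_
    rw [E.map_sum, Preadditive.comp_sum, Preadditive.comp_sum]
    refine Finset.sum_congr rfl fun u _ => ?_
    rw [E.map_comp, E.map_comp, hx]
    simp only [Category.assoc]

theorem isEquivalence (hE : ∀ n, Nonempty (E.obj (datum.S n) ≅ simple n)) : E.IsEquivalence :=
  { faithful := faithful hE, full := full hE, essSurj := essSurj hE }

end CatC

/-! ### The functors from `𝒞` -/

section

variable {C V : Type*} [Category C] [Preadditive C] [Category V] [Preadditive V] {F : C ⥤ V}
  [F.Additive] {E : Idempotents.Karoubi (Mat_ C) ⥤ V}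

/-- The restriction of the extension is the original functor. -/
def Extension.objIso (D : Extension F E) (X : C) :
    E.obj ((karoubiMatEmbedding C).obj X) ≅ F.obj X where
  hom := D.π ((karoubiMatEmbedding C).obj X) PUnit.unit
  inv := D.ι ((karoubiMatEmbedding C).obj X) PUnit.unit
  hom_inv_id := (Fintype.sum_unique (fun t : PUnit => D.π ((karoubiMatEmbedding C).obj X) t ≫
    D.ι ((karoubiMatEmbedding C).obj X) t)).symm.trans (D.total _)
  inv_hom_id := (D.ι_π ((karoubiMatEmbedding C).obj X) PUnit.unit PUnit.unit).trans (by
    refine (congrArg F.map ?_).trans (F.map_id X)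
    exact Mat_.id_apply_self ((Mat_.embedding C).obj X) PUnit.unit)

end

namespace CPrime.Datum

variable {V : Type*} [Category V] [Preadditive V] [Linear ℚ V] [MonoidalCategory V]
  [MonoidalPreadditive V] [HasFiniteBiproducts V] [IsIdempotentComplete V]

/-- A zero-preserving monoidal functor on `CPrime` with values in a pseudo-abelian `ℚ`-linear
category extends to `𝒞`. -/
theorem exists_extension (G : CPrime ⥤ V) [G.Monoidal] [G.PreservesZeroMorphisms] :
    ∃ (E : CatC ⥤ V) (_ : E.Monoidal), E.Additive ∧
      ∀ X : CPrime, Nonempty (E.obj (CatC.of X) ≅ G.obj X) := by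
  let S : ∀ M, Splitting (QLin.ext G) M := fun M => (Splitting.nonempty M).some
  let D := Splitting.extension S
  exact ⟨Splitting.ext S, D.monoidal, D.additive, fun X => ⟨D.objIso ⟨X⟩⟩⟩

end CPrime.Datum

namespace CatC

theorem exists_equivalence : ∃ (E : CatC ≌ CrystalsQ) (_ : E.functor.Monoidal),
    E.functor.Additive ∧ Nonempty (E.functor.obj CatC.F ≅ CrystalsQ.simple 1) := by
  have := MonoidalPreadditive.toZeroTensor CrystalsQ
  obtain ⟨E, hE, hadd, hF⟩ := CPrime.Datum.exists_extension (Crystal.datum.lift ⋙ Crystal.toQ)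
  obtain ⟨e⟩ := hF CPrime.F
  have e' : E.obj CatC.F ≅ CrystalsQ.simple 1 := e ≪≫ (Crystal.simpleIso 1).symm
  have := isEquivalence (nonempty_iso_simple E e')
  exact ⟨E.asEquivalence, hE, hadd, ⟨e'⟩⟩

/-- The extension is formed in additive endofunctors, where the tensor product is bilinear, and only
afterwards regarded in all endofunctors. -/
theorem exists_action : ∃ (A : CatC ⥤ EndOZ) (_ : A.Monoidal),
    (∀ (X Y : CatC) (f g : X ⟶ Y),
      (A.map (f + g)).unmop = (A.map f).unmop + (A.map g).unmop) ∧
    Nonempty (A.obj CatC.F ≅ MonoidalOpposite.mop OZ.F) := by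
  have := MonoidalPreadditive.toZeroTensor (AddEnd OZ)
  obtain ⟨A, hA, hadd, hF⟩ := CPrime.Datum.exists_extension OZ.datum.lift
  obtain ⟨e⟩ := hF CPrime.F
  refine ⟨A ⋙ OZ.endEmbedding, inferInstance, fun X Y f g => ?_, ⟨OZ.endEmbedding.mapIso e⟩⟩
  exact congrArg (fun x => (OZ.endEmbedding.map x).unmop) A.map_add
end CatC

/-! ### Transport of monoidal functors along an equivalence -/

section

variable {C D V : Type*} [Category C] [Category D] [Category V] [MonoidalCategory C]
  [MonoidalCategory D] [MonoidalCategory V] (e : C ≌ D) (A : C ⥤ V)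

/-- The functor on `D` corresponding to a functor on `C`. -/
def CategoryTheory.Equivalence.compInverseIso : e.functor ⋙ e.inverse ⋙ A ≅ A :=
  (Functor.associator _ _ _).symm ≪≫ Functor.isoWhiskerRight e.unitIso.symm A ≪≫ A.leftUnitor

theorem CategoryTheory.Equivalence.isMonoidal_of_inverseMonoidal [e.functor.Monoidal] :
    letI := e.inverseMonoidal
    e.IsMonoidal := by
  let := e.inverseMonoidal
  exact ⟨rfl, fun _ _ => rfl⟩

variable [e.functor.Monoidal] [e.inverse.Monoidal] [e.IsMonoidal] [A.Monoidal]

/-- Every factor of the composite is monoidal; for the whiskered unit this is the monoidality of the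
equivalence. -/
theorem CategoryTheory.Equivalence.isMonoidal_compInverseIso_hom :
    NatTrans.IsMonoidal (e.compInverseIso A).hom := by
  have h1 : NatTrans.IsMonoidal e.unitIso.hom := inferInstanceAs (NatTrans.IsMonoidal e.unit)
  have h2 : NatTrans.IsMonoidal e.unitIso.inv := inferInstance
  have h3 : NatTrans.IsMonoidal (Functor.whiskerRight e.unitIso.inv A) := inferInstance
  have h4 : NatTrans.IsMonoidal (Functor.associator e.functor e.inverse A).hom := inferInstance
  have h5 : NatTrans.IsMonoidal (Functor.associator e.functor e.inverse A).inv := inferInstance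
  have h6 : NatTrans.IsMonoidal (Functor.whiskerRight e.unitIso.inv A ≫ A.leftUnitor.hom) :=
    inferInstance
  exact NatTrans.IsMonoidal.comp (Functor.associator e.functor e.inverse A).inv
    (Functor.whiskerRight e.unitIso.inv A ≫ A.leftUnitor.hom)

end

end

/-- Functors are only required to be additive: an additive map between `ℚ`-vector spaces is
automatically `ℚ`-linear. For the actions, additivity is expressed after `unmop`, in the groups of
natural transformations. -/
theorem mainTheorem1 :
    -- `Crystals_ℚ` is `ℚ`-linear and pseudo-abelian
    (HasFiniteBiproducts CrystalsQ ∧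
      (∀ (n : ℤ), n ≠ 0 → ∀ X : CrystalsQ, IsIso (n • 𝟙 X)) ∧
      (∀ (X : CrystalsQ) (e : X ⟶ X), e ≫ e = e → HasKernel e)) ∧
    -- `Crystals_ℚ` is monoidally equivalent to `𝒞`, with `F` corresponding to `𝔹(1)`
    ∃ (E : CatC ≌ CrystalsQ) (_ : E.functor.Monoidal),
      E.functor.Additive ∧
      Nonempty (E.functor.obj CatC.F ≅ CrystalsQ.simple 1) ∧
      -- the functor `F` on `𝒪^ℤ` gives an action of `𝒞`
      ∃ (A : CatC ⥤ EndOZ) (_ : A.Monoidal),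
        (∀ (X Y : CatC) (f g : X ⟶ Y),
          (A.map (f + g)).unmop = (A.map f).unmop + (A.map g).unmop) ∧
        Nonempty (A.obj CatC.F ≅ MonoidalOpposite.mop OZ.F) ∧
        -- the action of `Crystals_ℚ` corresponding to it under the equivalence
        ∃ (R : CrystalsQ ⥤ EndOZ) (_ : R.Monoidal),
          (∀ (X Y : CrystalsQ) (f g : X ⟶ Y),
            (R.map (f + g)).unmop = (R.map f).unmop + (R.map g).unmop) ∧
          (∃ i : E.functor ⋙ R ≅ A, NatTrans.IsMonoidal i.hom) ∧
          Nonempty (R.obj (CrystalsQ.simple 1) ≅ MonoidalOpposite.mop OZ.F) ∧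
          -- the resulting action of crystals
          ∃ (_ : Crystal.toQ.Monoidal) (P : Crystal ⥤ EndOZ) (_ : P.Monoidal)
            (j : P ≅ Crystal.toQ ⋙ R),
            NatTrans.IsMonoidal j.hom ∧
            Nonempty (P.obj (Crystal.BB 1) ≅ MonoidalOpposite.mop OZ.F) := by
  refine ⟨⟨inferInstance, fun n hn X => isIso_zsmul_id hn X,
    -- In a preadditive category all idempotents split if and only if all idempotents have kernels.
    (Idempotents.isIdempotentComplete_iff_idempotents_have_kernels CrystalsQ).mp inferInstance⟩, ?_⟩
  obtain ⟨E, hE, hadd, ⟨e⟩⟩ := CatC.exists_equivalence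
  obtain ⟨A, hA, hAadd, ⟨a⟩⟩ := CatC.exists_action
  let := E.inverseMonoidal
  have := E.isMonoidal_of_inverseMonoidal
  -- The chain is `A(E⁻¹(𝔹(1))) ≅ A(E⁻¹(E(F))) ≅ A(F)`.
  have hR : Nonempty ((E.inverse ⋙ A).obj (CrystalsQ.simple 1) ≅ MonoidalOpposite.mop OZ.F) :=
    ⟨A.mapIso (E.inverse.mapIso e.symm ≪≫ (E.unitIso.app CatC.F).symm) ≪≫ a⟩
  refine ⟨E, hE, hadd, ⟨e⟩, A, hA, hAadd, ⟨a⟩, E.inverse ⋙ A, inferInstance, ?_,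
    ⟨E.compInverseIso A, E.isMonoidal_compInverseIso_hom A⟩, hR,
    -- The action of crystals is the composite itself, so the comparison isomorphism is the
    -- identity.
    Crystal.toQMonoidal, Crystal.toQ ⋙ E.inverse ⋙ A, inferInstance, Iso.refl _,
    inferInstanceAs (NatTrans.IsMonoidal (𝟙 (Crystal.toQ ⋙ E.inverse ⋙ A))), ?_⟩
  · intro X Y f g
    have := E.inverse_additive
    refine (congrArg (fun x => (A.map x).unmop) (E.inverse.map_add (f := f) (g := g))).trans ?_
    exact hAadd _ _ _ _
  · obtain ⟨r⟩ := hR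
    exact ⟨(E.inverse ⋙ A).mapIso (Crystal.simpleIso 1).symm ≪≫ r⟩
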